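/- All vector spaces are over $\mathbb{C}$. A vertex algebra is a vector space $V$ with a vector $\mathbf 1\in V$ and a linear map $Y:V\to \mathrm{Hom}(V,V((x)))$ such that $Y(\mathbf 1,x)=1$, $Y(v,x)\mathbf 1\in v+xV[[x]]$ and the Jacobi identity holds. A $V$-module is a vector space $W$ with a linear map $Y_W:V\to\mathrm{Hom}(W,W((x)))$ such that $Y_W(\mathbf 1,x)=1$ and, for all $u,v\in V$, the Jacobi identity $$x_0^{-1}\delta\Big(\tfrac{x_1-x_2}{x_0}\Big)Y_W(u,x_1)Y_W(v,x_2)-x_0^{-1}\delta\Big(\tfrac{x_2-x_1}{-x_0}\Big)Y_W(v,x_2)Y_W(u,x_1)=x_2^{-1}\delta\Big(\tfrac{x_1-x_0}{x_2}\Big)Y_W(Y(u,x_0)v,x_2)$$ holds. A quasimodule for the vertex algebra $V$ is defined in the same way, except that for each pair $u,v\in V$ the Jacobi identity is only required to hold after multiplication of both sides by some nonzero polynomial $p(x_1,x_2)$, depending on $u,v$. Given a group $\Gamma$ and homomorphisms $R:\Gamma\to GL(V)$, $\phi:\Gamma\to\mathbb{C}^\times$ making $V$ a $\Gamma$-vertex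 algebra (that is, $R_g\mathbf 1=\mathbf 1$ and $R_gY(v,x)R_g^{-1}=Y(R_gv,\phi(g)^{-1}x)$), a quasimodule for the $\Gamma$-vertex algebra $V$ is a quasimodule $(W,Y_W)$ for the vertex algebra $V$ such that $Y_W(R_gv,x)=Y_W(v,\phi(g)x)$ for all $g\in\Gamma$, $v\in V$, and such that for all $u,v\in V$ there are $\alpha_1,\dots,\alpha_k\in\phi(\Gamma)$ with $(x_1-\alpha_1x_2)\cdots(x_1-\alpha_kx_2)[Y_W(u,x_1),Y_W(v,x_2)]=0$. **Theorem.** Let $V=\coprod_{n\in\mathbb{Z}}V_{(n)}$ be a $\mathbb{Z}$-graded vertex algebra (i.e. $u_kV_{(n)}\subset V_{(m+n-k-1)}$ for $u\in V_{(m)}$ and $m,n,k\in\mathbb Z$, where $Y(u,x)=\sum_{k}u_kx^{-k-1}$), and let $N$ be a positive integer. Let $V^{\otimes N}$ be the tensor product vertex algebra, with its natural $\mathbb{Z}$-grading and grading operator $L(0)$. Let $\Gamma=\langle\sigma\rangle$ be the cyclic group of order $N$ generated by the cyclic permutation $\sigma$ of the tensor positions, acting on $V^{\otimes N}$ by $\sigma(v^1\otimes\cdots\otimes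 v^{N-1}\otimes v^N)=v^2\otimes\cdots\otimes v^N\otimes v^1$, and let $\phi:\Gamma\to\mathbb{C}^\times$ be the homomorphism with $\phi(\sigma)=e^{2\pi i/N}$. Regard $V^{\otimes N}$ as a $\Gamma$-vertex algebra with $R_g=\phi(g)^{-L(0)}g$, and regard $V$ as a subspace of $V^{\otimes N}$ through $v\mapsto v\otimes\mathbf 1\otimes\cdots\otimes\mathbf 1$. Let $W$ be a vector space. (1) If $(W,\overline{Y}_W)$ is a quasimodule for the $\Gamma$-vertex algebra $V^{\otimes N}$ and $Y_W$ is the restriction of $\overline Y_W$ to $V$, then $(W,Y_W)$ is a $V$-module. (2) If $(W,Y_W)$ is a $V$-module, then there is exactly one linear map $\overline{Y}_W:V^{\otimes N}\to\mathrm{Hom}(W,W((x)))$ that extends $Y_W$ and makes $(W,\overline{Y}_W)$ a quasimodule for the $\Gamma$-vertex algebra $V^{\otimes N}$. -/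

import Mathlib

open scoped TensorProduct

noncomputable section

/-! ### Formal series

`VertexOperator ℂ W` is Mathlib's type of linear maps `W → W((x))`.  For such an `A`,
`HVertexOperator.coeff A n` is the coefficient of `x ^ n`, and `VertexOperator.ncoeff A n` is the
coefficient of `x ^ (-n - 1)`. -/

/-- Formal series in `x₁, x₂`, infinite in both directions: `F a b` is the coefficient of
`x₁ ^ a * x₂ ^ b`. -/
abbrev Series2 (W : Type*) := ℤ → ℤ → W

/-- Formal series in `x₀, x₁, x₂`: `F c a b` is the coefficient of
`x₀ ^ c * x₁ ^ a * x₂ ^ b`. -/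
abbrev Series3 (W : Type*) := ℤ → ℤ → ℤ → W

section FormalCalculus

variable {W : Type*} [AddCommGroup W] [Module ℂ W]

/-- The product `p(x₁, x₂) F(x₁, x₂)` of a polynomial and a formal series; the variables `0` and
`1` of `p` stand for `x₁` and `x₂`. -/
def polyMul2 (p : MvPolynomial (Fin 2) ℂ) (F : Series2 W) : Series2 W :=
  fun a b => ∑ m ∈ p.support, p.coeff m • F (a - m 0) (b - m 1)

/-- The product `p(x₁, x₂) F(x₀, x₁, x₂)`. -/
def polyMul3 (p : MvPolynomial (Fin 2) ℂ) (F : Series3 W) : Series3 W :=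
  fun c => polyMul2 p (F c)

/-- The series `A(x₁) B(x₂) w`. -/
def prod12 (A B : VertexOperator ℂ W) (w : W) : Series2 W :=
  fun a b => HVertexOperator.coeff A a (HVertexOperator.coeff B b w)

/-- The series `B(x₂) A(x₁) w`. -/
def prod21 (A B : VertexOperator ℂ W) (w : W) : Series2 W :=
  fun a b => HVertexOperator.coeff B b (HVertexOperator.coeff A a w)

/-- The product `x₀⁻¹ δ((x₁ - x₂) / x₀) F(x₁, x₂)`, where
`x₀⁻¹ δ((x₁ - x₂) / x₀) = ∑ₙ x₀ ^ (-n - 1) (x₁ - x₂) ^ n` and `(x₁ - x₂) ^ n` is expanded in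
nonnegative powers of `x₂`. The sum is finite if the powers of `x₂` in `F` are bounded below. -/
def deltaMul12 (F : Series2 W) : Series3 W := fun c a b =>
  ∑ᶠ i : ℕ, ((-1 : ℤ) ^ i * Ring.choose (-c - 1) i) • F (a - (-c - 1) + i) (b - i)

/-- The product `x₀⁻¹ δ((x₂ - x₁) / (-x₀)) F(x₁, x₂)`, where
`x₀⁻¹ δ((x₂ - x₁) / (-x₀)) = ∑ₙ (-1) ^ n x₀ ^ (-n - 1) (x₂ - x₁) ^ n` and `(x₂ - x₁) ^ n` is
expanded in nonnegative powers of `x₁`. The sum is finite if the powers of `x₁` in `F` are bounded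
below. -/
def deltaMul21 (F : Series2 W) : Series3 W := fun c a b =>
  ∑ᶠ i : ℕ, ((Int.negOnePow (-c - 1) : ℤ) * ((-1 : ℤ) ^ i * Ring.choose (-c - 1) i)) •
    F (a - i) (b - (-c - 1) + i)

/-- The product `x₂⁻¹ δ((x₁ - x₀) / x₂) G(x₀, x₂)`, where
`x₂⁻¹ δ((x₁ - x₀) / x₂) = ∑ₙ x₂ ^ (-n - 1) (x₁ - x₀) ^ n` and `(x₁ - x₀) ^ n` is expanded in
nonnegative powers of `x₀`; here `G c b` is the coefficient of `x₀ ^ c * x₂ ^ b`. The sum is finite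
if the powers of `x₀` in `G` are bounded below. -/
def deltaMul10 (G : Series2 W) : Series3 W := fun c a b =>
  ∑ᶠ i : ℕ, ((-1 : ℤ) ^ i * Ring.choose (a + i) i) • G (c - i) (b + (a + i) + 1)

end FormalCalculus

/-! ### Vertex algebras, modules, quasimodules -/

/-- The data underlying a vertex algebra: a vacuum vector `𝟏` and a linear map
`Y : V → Hom(V, V((x)))`. -/
structure VertexData (V : Type*) [AddCommGroup V] [Module ℂ V] where
  /-- the vacuum vector `𝟏` -/
  vac : V
  /-- the vertex operator map `v ↦ Y(v, x)` -/
  Y : V →ₗ[ℂ] VertexOperator ℂ V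

section VertexAlgebra

variable {V : Type*} [AddCommGroup V] [Module ℂ V] {W : Type*} [AddCommGroup W] [Module ℂ W]

/-- `A(x) = id_W`, i.e. the constant series with value the identity. -/
def IsIdentitySeries (A : VertexOperator ℂ W) : Prop :=
  ∀ n : ℤ, HVertexOperator.coeff A n = if n = 0 then LinearMap.id else 0

/-- The left-hand side of the Jacobi identity applied to `w`:
`x₀⁻¹ δ((x₁ - x₂) / x₀) Y_W(u, x₁) Y_W(v, x₂) w - x₀⁻¹ δ((x₂ - x₁) / (-x₀)) Y_W(v, x₂) Y_W(u, x₁) w`.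
-/
def jacobiLeft (YW : V →ₗ[ℂ] VertexOperator ℂ W) (u v : V) (w : W) : Series3 W :=
  deltaMul12 (prod12 (YW u) (YW v) w) - deltaMul21 (prod21 (YW u) (YW v) w)

/-- The right-hand side of the Jacobi identity applied to `w`:
`x₂⁻¹ δ((x₁ - x₀) / x₂) Y_W(Y(u, x₀) v, x₂) w`. -/
def jacobiRight (A : VertexData V) (YW : V →ₗ[ℂ] VertexOperator ℂ W) (u v : V) (w : W) :
    Series3 W :=
  deltaMul10 fun c b => HVertexOperator.coeff (YW (HVertexOperator.coeff (A.Y u) c v)) b w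

/-- `(W, Y_W)` is a `V`-module: `Y_W(𝟏, x) = 1` and the Jacobi identity holds. -/
structure VertexData.IsModule (A : VertexData V) (YW : V →ₗ[ℂ] VertexOperator ℂ W) : Prop where
  vacuum : IsIdentitySeries (YW A.vac)
  jacobi : ∀ (u v : V) (w : W), jacobiLeft YW u v w = jacobiRight A YW u v w

/-- The data `(V, Y, 𝟏)` form a vertex algebra: the vacuum property `Y(𝟏, x) = 1`, the creation
property `Y(v, x)𝟏 ∈ v + x V[[x]]`, and the Jacobi identity. -/
structure VertexData.IsVertexAlgebra (A : VertexData V) : Prop where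
  vacuum : IsIdentitySeries (A.Y A.vac)
  creation_neg : ∀ (v : V) (n : ℤ), n < 0 → HVertexOperator.coeff (A.Y v) n A.vac = 0
  creation_zero : ∀ v : V, HVertexOperator.coeff (A.Y v) 0 A.vac = v
  jacobi : ∀ u v w : V, jacobiLeft A.Y u v w = jacobiRight A A.Y u v w

/-- `(W, Y_W)` is a quasimodule for the vertex algebra `V`: `Y_W(𝟏, x) = 1`, and for all `u, v`
the Jacobi identity holds after multiplication by some nonzero polynomial `p(x₁, x₂)`. (As `p` is
a polynomial in `x₁, x₂`, multiplying a product by it amounts to multiplying its second factor.) -/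
structure VertexData.IsQuasimodule (A : VertexData V) (YW : V →ₗ[ℂ] VertexOperator ℂ W) :
    Prop where
  vacuum : IsIdentitySeries (YW A.vac)
  quasiJacobi : ∀ u v : V, ∃ p : MvPolynomial (Fin 2) ℂ, p ≠ 0 ∧ ∀ w : W,
    polyMul3 p (jacobiLeft YW u v w) = polyMul3 p (jacobiRight A YW u v w)

end VertexAlgebra

/-! ### Graded vertex algebras -/

/-- A `ℤ`-graded vertex algebra: a vertex algebra with a decomposition `V = ⨁ₙ V₍ₙ₎` such that
`uₖ V₍ₙ₎ ⊆ V₍ₘ₊ₙ₋ₖ₋₁₎` for `u ∈ V₍ₘ₎`. -/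
structure GradedVertexAlgebra (V : Type*) [AddCommGroup V] [Module ℂ V] extends VertexData V where
  isVertexAlgebra : toVertexData.IsVertexAlgebra
  /-- the homogeneous subspaces -/
  grading : ℤ → Submodule ℂ V
  isInternal : DirectSum.IsInternal grading
  mode_mem : ∀ (m n k : ℤ) (u v : V), u ∈ grading m → v ∈ grading n →
    VertexOperator.ncoeff (Y u) k v ∈ grading (m + n - k - 1)

namespace GradedVertexAlgebra

variable {V : Type*} [AddCommGroup V] [Module ℂ V]

/-- The identification `⨁ₙ V₍ₙ₎ = V`. -/
def decomp (A : GradedVertexAlgebra V) : (DirectSum ℤ fun n => A.grading n) ≃ₗ[ℂ] V :=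
  LinearEquiv.ofBijective (DirectSum.coeLinearMap A.grading) A.isInternal

/-- The operator `c ^ L(0)` for `c ∈ ℂˣ`, acting on `V₍ₙ₎` as multiplication by `c ^ n`. -/
def powL0 (A : GradedVertexAlgebra V) (c : ℂˣ) : Module.End ℂ V :=
  A.decomp.toLinearMap ∘ₗ
    (DirectSum.lmap fun n : ℤ => ((c ^ n : ℂˣ) : ℂ) • (LinearMap.id : A.grading n →ₗ[ℂ] _)) ∘ₗ
      A.decomp.symm.toLinearMap

theorem powL0_of_mem (A : GradedVertexAlgebra V) (c : ℂˣ) {n : ℤ} {v : V}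
    (hv : v ∈ A.grading n) : A.powL0 c v = ((c ^ n : ℂˣ) : ℂ) • v := by
  have h : A.decomp (DirectSum.lof ℂ ℤ (fun n => A.grading n) n ⟨v, hv⟩) = v :=
    DirectSum.coeLinearMap_lof A.grading n ⟨v, hv⟩
  have h' : A.decomp.symm v = DirectSum.lof ℂ ℤ (fun n => A.grading n) n ⟨v, hv⟩ := by
    rw [LinearEquiv.symm_apply_eq, h]
  simp only [powL0, LinearMap.comp_apply, LinearEquiv.coe_coe, h', DirectSum.lmap_lof,
    LinearMap.smul_apply, map_smul, LinearMap.id_apply, h]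

theorem powL0_one (A : GradedVertexAlgebra V) : A.powL0 1 = 1 := by
  have h : (fun n : ℤ => (((1 : ℂˣ) ^ n : ℂˣ) : ℂ) • (LinearMap.id : A.grading n →ₗ[ℂ] _)) =
      fun n => LinearMap.id := by
    funext n; simp
  ext v
  simp only [powL0, h, DirectSum.lmap_id]
  simp

theorem powL0_mul (A : GradedVertexAlgebra V) (c d : ℂˣ) :
    A.powL0 (c * d) = A.powL0 c * A.powL0 d := by
  have h : (fun n : ℤ => (((c * d) ^ n : ℂˣ) : ℂ) • (LinearMap.id : A.grading n →ₗ[ℂ] _)) =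
      fun n => (((c ^ n : ℂˣ) : ℂ) • LinearMap.id) ∘ₗ (((d ^ n : ℂˣ) : ℂ) • LinearMap.id) := by
    funext n; ext x; simp [mul_zpow, mul_smul]
  ext v
  simp only [powL0, h, DirectSum.lmap_comp]
  simp

end GradedVertexAlgebra

/-! ### Tensor powers -/

section Tensor

variable {ι : Type*} [Fintype ι] {V : Type*} [AddCommGroup V] [Module ℂ V]

/-- Only finitely many exponents `k` with `∑ kᵢ = n` contribute to the coefficient of `x ^ n` in a
product of Laurent series. -/
theorem finite_exponents (f : ι → HahnModule ℤ ℂ V) (n : ℤ) :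
    ({k : ι → ℤ | ∑ i, k i = n} ∩ Function.support fun k : ι → ℤ =>
      ⨂ₜ[ℂ] i, ((HahnModule.of ℂ).symm (f i)).coeff (k i)).Finite := by
  classical
  set l : ι → ℤ := fun i => ((HahnModule.of ℂ).symm (f i)).order with hl
  refine (Set.finite_Icc l (fun i => n - ∑ j ∈ Finset.univ.erase i, l j)).subset ?_
  rintro k ⟨hk, hs⟩
  have hlk : ∀ i, l i ≤ k i := by
    intro i
    by_contra hlt
    refine hs ((PiTensorProduct.tprod ℂ).map_coord_zero i ?_)
    exact HahnSeries.coeff_eq_zero_of_lt_order (not_le.mp hlt)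
  refine ⟨hlk, fun i => ?_⟩
  have h1 : k i + ∑ j ∈ Finset.univ.erase i, k j = n := by
    rw [Finset.add_sum_erase _ _ (Finset.mem_univ i)]; exact hk
  have h2 : ∑ j ∈ Finset.univ.erase i, l j ≤ ∑ j ∈ Finset.univ.erase i, k j :=
    Finset.sum_le_sum fun j _ => hlk j
  simp only; linarith

/-- The coefficient of `x ^ n` in `f₁(x) ⊗ ⋯ ⊗ f_N(x)`. -/
def tensorCoeff (f : ι → HahnModule ℤ ℂ V) (n : ℤ) : ⨂[ℂ] _ : ι, V :=
  ∑ᶠ k ∈ {k : ι → ℤ | ∑ i, k i = n}, ⨂ₜ[ℂ] i, ((HahnModule.of ℂ).symm (f i)).coeff (k i)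

theorem tensorCoeff_support (f : ι → HahnModule ℤ ℂ V) :
    (Function.support (tensorCoeff f)).IsPWO := by
  refine Set.IsWF.isPWO (BddBelow.isWF
    ⟨∑ i, ((HahnModule.of ℂ).symm (f i)).order, fun n hn => ?_⟩)
  by_contra hlt
  refine hn (finsum_mem_eq_zero_of_forall_eq_zero fun k hk => ?_)
  have hk' : ∑ i, k i = n := hk
  have hlt' : ∑ i, k i < ∑ i, ((HahnModule.of ℂ).symm (f i)).order := by
    rw [hk']; exact not_le.mp hlt
  obtain ⟨i, -, hi⟩ := Finset.exists_lt_of_sum_lt hlt'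
  exact (PiTensorProduct.tprod ℂ).map_coord_zero i (HahnSeries.coeff_eq_zero_of_lt_order hi)

/-- The multilinear product `(f₁(x), …, f_N(x)) ↦ f₁(x) ⊗ ⋯ ⊗ f_N(x)` of Laurent series. -/
def tensorSeries : MultilinearMap ℂ (fun _ : ι => HahnModule ℤ ℂ V)
    (HahnModule ℤ ℂ (⨂[ℂ] _ : ι, V)) where
  toFun f := HahnModule.of ℂ ⟨tensorCoeff f, tensorCoeff_support f⟩
  map_update_add' {inst} f i x y := by
    refine HahnModule.ext _ _ (funext fun n => ?_)
    change tensorCoeff (Function.update f i (x + y)) n =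
      tensorCoeff (Function.update f i x) n + tensorCoeff (Function.update f i y) n
    unfold tensorCoeff
    rw [← finsum_mem_add_distrib' (finite_exponents _ n) (finite_exponents _ n)]
    refine finsum_mem_congr rfl fun k _ => ?_
    have key : ∀ z : HahnModule ℤ ℂ V,
        (fun j => ((HahnModule.of ℂ).symm (Function.update f i z j)).coeff (k j)) =
        Function.update (fun j => ((HahnModule.of ℂ).symm (f j)).coeff (k j)) i
          (((HahnModule.of ℂ).symm z).coeff (k i)) := by
      intro z; funext j
      by_cases h : j = i
      · subst h; simp
      · simp [h]
    rw [key, key, key, ← MultilinearMap.map_update_add]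
    rfl
  map_update_smul' {inst} f i c x := by
    refine HahnModule.ext _ _ (funext fun n => ?_)
    change tensorCoeff (Function.update f i (c • x)) n = c • tensorCoeff (Function.update f i x) n
    unfold tensorCoeff
    simp only [smul_finsum]
    refine finsum_mem_congr rfl fun k _ => ?_
    have key : ∀ z : HahnModule ℤ ℂ V,
        (fun j => ((HahnModule.of ℂ).symm (Function.update f i z j)).coeff (k j)) =
        Function.update (fun j => ((HahnModule.of ℂ).symm (f j)).coeff (k j)) i
          (((HahnModule.of ℂ).symm z).coeff (k i)) := by
      intro z; funext j
      by_cases h : j = i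
      · subst h; simp
      · simp [h]
    rw [key, key, ← MultilinearMap.map_update_smul]
    rfl

/-- The vertex operator map of a tensor power,
`Y(v¹ ⊗ ⋯ ⊗ v^N, x) = Y(v¹, x) ⊗ ⋯ ⊗ Y(v^N, x)`. -/
def tensorY (Y : V →ₗ[ℂ] VertexOperator ℂ V) :
    (⨂[ℂ] _ : ι, V) →ₗ[ℂ] VertexOperator ℂ (⨂[ℂ] _ : ι, V) :=
  (PiTensorProduct.lift (tensorSeries (ι := ι) (V := V))).compRight ℂ ∘ₗ
    PiTensorProduct.lift ((PiTensorProduct.mapMultilinear ℂ (fun _ : ι => V)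
      (fun _ : ι => HahnModule ℤ ℂ V)).compLinearMap fun _ => Y)

theorem tensorY_tprod (Y : V →ₗ[ℂ] VertexOperator ℂ V) (v w : ι → V) (n : ℤ) :
    HVertexOperator.coeff (tensorY Y (⨂ₜ[ℂ] i, v i)) n (⨂ₜ[ℂ] i, w i) =
      ∑ᶠ k ∈ {k : ι → ℤ | ∑ i, k i = n},
        ⨂ₜ[ℂ] i, HVertexOperator.coeff (Y (v i)) (k i) (w i) := by
  have h : tensorY Y (⨂ₜ[ℂ] i, v i) (⨂ₜ[ℂ] i, w i) =
      tensorSeries (ι := ι) (V := V) fun i => Y (v i) (w i) := by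
    simp [tensorY]
  rw [HVertexOperator.coeff_apply_apply, h]
  rfl

/-- The tensor power of a vertex algebra, with vacuum `𝟏 ⊗ ⋯ ⊗ 𝟏`. -/
def VertexData.tensorPower (A : VertexData V) (ι : Type*) [Fintype ι] :
    VertexData (⨂[ℂ] _ : ι, V) where
  vac := ⨂ₜ[ℂ] _, A.vac
  Y := tensorY A.Y

end Tensor

/-! ### `Γ`-vertex algebras and their quasimodules -/

/-- The data underlying a `Γ`-vertex algebra: those of a vertex algebra with group homomorphisms
`R : Γ → GL(V)` and `φ : Γ → ℂˣ`. The notion of quasimodule below involves only these data. -/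
structure GammaVertexData (Γ : Type*) [Group Γ] (V : Type*) [AddCommGroup V] [Module ℂ V]
    extends VertexData V where
  /-- the homomorphism `g ↦ R_g` -/
  R : Γ →* LinearMap.GeneralLinearGroup ℂ V
  /-- the character `φ` -/
  φ : Γ →* ℂˣ

/-- `(W, Y_W)` is a quasimodule for the `Γ`-vertex algebra `V`: a quasimodule for the vertex algebra
`V` with `Y_W(R_g v, x) = Y_W(v, φ(g) x)`, and such that for all `u, v` there are
`α₁, …, αₖ ∈ φ(Γ)` with `(x₁ - α₁ x₂) ⋯ (x₁ - αₖ x₂) [Y_W(u, x₁), Y_W(v, x₂)] = 0`. -/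
structure GammaVertexData.IsGammaQuasimodule {Γ : Type*} [Group Γ] {V : Type*} [AddCommGroup V]
    [Module ℂ V] (A : GammaVertexData Γ V) {W : Type*} [AddCommGroup W] [Module ℂ W]
    (YW : V →ₗ[ℂ] VertexOperator ℂ W) : Prop where
  isQuasimodule : A.toVertexData.IsQuasimodule YW
  equivariant : ∀ (g : Γ) (v : V) (n : ℤ),
    HVertexOperator.coeff (YW ((A.R g : V →ₗ[ℂ] V) v)) n =
      ((A.φ g ^ n : ℂˣ) : ℂ) • HVertexOperator.coeff (YW v) n
  gammaLocal : ∀ u v : V, ∃ α : List ℂˣ, (∀ a ∈ α, a ∈ A.φ.range) ∧ ∀ w : W,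
    polyMul2
      (α.map fun a => MvPolynomial.X 0 - MvPolynomial.C (a : ℂ) * MvPolynomial.X 1).prod
      (prod12 (YW u) (YW v) w - prod21 (YW u) (YW v) w) = 0

/-! ### The cyclic group acting on a tensor power -/

section Cyclic

variable (N : ℕ)

/-- The cyclic permutation of the tensor positions that moves position `i + 1` to position `i`
and the first position to the last. -/
def cyclePerm : Equiv.Perm (Fin N) := (finRotate N)⁻¹

/-- The group `Γ = ⟨σ⟩` generated by the cyclic permutation, acting on `V^{⊗N}` through
`permAction`; the action is faithful if `dim V ≥ 2`. -/
abbrev CycleGroup : Type := Subgroup.zpowers (cyclePerm N)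

/-- The generator `σ` of `Γ`. -/
def cycleGen : CycleGroup N := ⟨cyclePerm N, Subgroup.mem_zpowers _⟩

theorem mem_zpowers_cycleGen (g : CycleGroup N) : g ∈ Subgroup.zpowers (cycleGen N) := by
  obtain ⟨g, k, rfl⟩ := g
  exact ⟨k, by ext; simp [cycleGen]⟩

/-- `exp(2πi / N)` as an element of `ℂˣ`. -/
def rootUnit : ℂˣ :=
  Units.mk0 (Complex.exp (2 * Real.pi * Complex.I / N)) (Complex.exp_ne_zero _)

theorem orderOf_rootUnit_dvd [NeZero N] : orderOf (rootUnit N) ∣ orderOf (cycleGen N) := by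
  obtain ⟨n, rfl⟩ : ∃ n, N = n + 1 := ⟨N - 1, by have := NeZero.pos N; omega⟩
  have hk : ∀ k : ℕ, ((finRotate (n + 1) ^ k) 0).val = k % (n + 1) := by
    intro k
    induction k with
    | zero => simp
    | succ k ih =>
      rw [pow_succ', Equiv.Perm.mul_apply, finRotate_apply, Fin.val_add, ih, Fin.val_one',
        ← Nat.add_mod]
  have h1 : (n + 1) ∣ orderOf (cycleGen (n + 1)) := by
    have h : finRotate (n + 1) ^ orderOf (cycleGen (n + 1)) = 1 := by
      have h' := congrArg Subtype.val (pow_orderOf_eq_one (cycleGen (n + 1)))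
      rw [Subgroup.coe_pow] at h'
      exact inv_eq_one.mp ((inv_pow _ _).symm.trans h')
    have h2 := hk (orderOf (cycleGen (n + 1)))
    rw [h] at h2
    exact Nat.dvd_of_mod_eq_zero h2.symm
  refine (orderOf_dvd_of_pow_eq_one ?_).trans h1
  ext
  have := (Complex.isPrimitiveRoot_exp (n + 1) (Nat.succ_ne_zero n)).pow_eq_one
  simpa [rootUnit] using this

/-- The homomorphism `φ : Γ → ℂˣ` with `φ(σ) = exp(2πi / N)`. -/
def cycleChar [NeZero N] : CycleGroup N →* ℂˣ :=
  monoidHomOfForallMemZpowers (mem_zpowers_cycleGen N) (orderOf_rootUnit_dvd N)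

theorem cycleChar_cycleGen [NeZero N] :
    ((cycleChar N (cycleGen N) : ℂˣ) : ℂ) = Complex.exp (2 * Real.pi * Complex.I / N) := by
  simp [cycleChar, monoidHomOfForallMemZpowers_apply_gen, rootUnit]

variable (V : Type*) [AddCommGroup V] [Module ℂ V]

/-- The action of a permutation of the positions on a tensor power: the factor in position `i` is
moved to position `e i`. -/
def permAction : Equiv.Perm (Fin N) →* Module.End ℂ (⨂[ℂ] _ : Fin N, V) where
  toFun e := (PiTensorProduct.reindex ℂ (fun _ => V) e).toLinearMap
  map_one' := by
    ext v
    exact PiTensorProduct.reindex_tprod (R := ℂ) (s := fun _ => V) (1 : Equiv.Perm (Fin N)) v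
  map_mul' e f := by
    ext v
    change PiTensorProduct.reindex ℂ (fun _ => V) (e * f) (PiTensorProduct.tprod ℂ v) =
      PiTensorProduct.reindex ℂ (fun _ => V) e
        (PiTensorProduct.reindex ℂ (fun _ => V) f (PiTensorProduct.tprod ℂ v))
    rw [PiTensorProduct.reindex_tprod, PiTensorProduct.reindex_tprod]
    exact (PiTensorProduct.reindex_tprod (R := ℂ) (s := fun _ => V) e fun i => v (f.symm i)).symm

/-- `σ(v¹ ⊗ v² ⊗ ⋯ ⊗ v^N) = v² ⊗ ⋯ ⊗ v^N ⊗ v¹`. -/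
theorem permAction_cyclePerm (v : Fin N → V) :
    permAction N V (cyclePerm N) (⨂ₜ[ℂ] i, v i) = ⨂ₜ[ℂ] i, v (finRotate N i) :=
  PiTensorProduct.reindex_tprod (R := ℂ) (s := fun _ => V) (finRotate N)⁻¹ v

end Cyclic

namespace GradedVertexAlgebra

variable {V : Type*} [AddCommGroup V] [Module ℂ V]

/-- The operator `c ^ L(0)` on `V^{⊗N}`, where `L(0)` is the grading operator of `V^{⊗N}`: a tensor
product of homogeneous vectors has as its degree the sum of their degrees. -/
def tensorPowL0 (A : GradedVertexAlgebra V) (N : ℕ) (c : ℂˣ) :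
    Module.End ℂ (⨂[ℂ] _ : Fin N, V) :=
  PiTensorProduct.map fun _ => A.powL0 c

theorem tensorPowL0_tprod (A : GradedVertexAlgebra V) (N : ℕ) (c : ℂˣ) (d : Fin N → ℤ)
    (v : Fin N → V) (hv : ∀ i, v i ∈ A.grading (d i)) :
    A.tensorPowL0 N c (⨂ₜ[ℂ] i, v i) = ((c ^ ∑ i, d i : ℂˣ) : ℂ) • ⨂ₜ[ℂ] i, v i := by
  have h : (fun i => A.powL0 c (v i)) = fun i => (((c ^ d i : ℂˣ) : ℂ) • v i) :=
    funext fun i => A.powL0_of_mem c (hv i)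
  have hp : c ^ ∑ i, d i = ∏ i, c ^ d i :=
    Finset.induction_on Finset.univ (by simp) fun a s ha ih => by
      rw [Finset.sum_insert ha, Finset.prod_insert ha, zpow_add, ih]
  rw [tensorPowL0, PiTensorProduct.map_tprod, h, MultilinearMap.map_smul_univ, hp, Units.coe_prod]

/-- The homomorphism `g ↦ R_g = φ(g) ^ (-L(0)) g` on `V^{⊗N}`. -/
def tensorR (A : GradedVertexAlgebra V) (N : ℕ) [NeZero N] :
    CycleGroup N →* LinearMap.GeneralLinearGroup ℂ (⨂[ℂ] _ : Fin N, V) :=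
  MonoidHom.toHomUnits
    { toFun := fun g => A.tensorPowL0 N (cycleChar N g)⁻¹ * permAction N V g
      map_one' := by
        simp only [map_one, inv_one, OneMemClass.coe_one, tensorPowL0, powL0_one, mul_one]
        exact PiTensorProduct.map_one
      map_mul' := fun g h => by
        have hc : permAction N V (g : Equiv.Perm (Fin N)) * A.tensorPowL0 N (cycleChar N h)⁻¹ =
            A.tensorPowL0 N (cycleChar N h)⁻¹ * permAction N V g := by
          ext v
          simp [permAction, tensorPowL0, PiTensorProduct.reindex_tprod, PiTensorProduct.map_tprod]
        have hm : A.tensorPowL0 N (cycleChar N (g * h))⁻¹ =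
            A.tensorPowL0 N (cycleChar N g)⁻¹ * A.tensorPowL0 N (cycleChar N h)⁻¹ := by
          rw [map_mul, mul_inv, tensorPowL0, funext fun _ : Fin N => A.powL0_mul _ _]
          exact PiTensorProduct.map_mul _ _
        rw [hm, Subgroup.coe_mul, map_mul, mul_assoc, mul_assoc, ← mul_assoc (permAction N V g),
          hc, mul_assoc] }

/-- `V^{⊗N}` as a `Γ`-vertex algebra, with `Γ = ⟨σ⟩`, `φ(σ) = exp(2πi / N)` and
`R_g = φ(g) ^ (-L(0)) g`. -/
def tensorPowerGamma (A : GradedVertexAlgebra V) (N : ℕ) [NeZero N] :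
    GammaVertexData (CycleGroup N) (⨂[ℂ] _ : Fin N, V) where
  toVertexData := A.toVertexData.tensorPower (Fin N)
  R := A.tensorR N
  φ := cycleChar N

/-- The embedding `v ↦ v ⊗ 𝟏 ⊗ ⋯ ⊗ 𝟏` of `V` into `V^{⊗N}` as the first tensor factor. -/
def firstFactor (A : GradedVertexAlgebra V) (N : ℕ) [NeZero N] : V →ₗ[ℂ] ⨂[ℂ] _ : Fin N, V :=
  (PiTensorProduct.tprod ℂ).toLinearMap (fun _ : Fin N => A.vac) 0

end GradedVertexAlgebra

end

/-!
A `V`-module `W` and a quasimodule `W` for `V^{⊗N}` determine each other because a pure tensor is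
built from its factors, placed in the single positions, by vertex operators. The argument has three
parts; throughout, formal series are a module over polynomials (`Ser`), and the Jacobi identity for a
pair `u`, `v` up to a polynomial factor `q(x₁, x₂)` is replaced by locality and associativity with the
same factor: `q Y(u, x₁) Y(v, x₂) = q Y(v, x₂) Y(u, x₁)`, and this series becomes
`q(x₂ + x₀, x₂) Y(Y(u, x₀) v, x₂)` under `x₁ = x₂ + x₀` (`IsIterateWith`). The passage back and forth
rests on the delta function identity `delta12_sub_delta21`.

*Restriction.* For `u`, `v` in the first tensor factor, locality holds up to a product of factors
`x₁ - α x₂` with `α = φ(g)`. If `α ≠ 1`, then `g` moves the first position to another one, so that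
all nonnegative modes of `R_g u` kill `v`; since `Y_W(R_g u, x) = Y_W(u, α x)`, the factor
`x₁ - α x₂` can be dropped (`local_of_linPoly_mul`). What remains is a power of `x₁ - x₂`, for which
locality and associativity give the Jacobi identity itself (`jacobi_of_isIterateWith`).

*Uniqueness.* Equivariance determines the vertex operators of vectors in any single position. A pure
tensor arises from one with fewer nonvacuum factors by the mode `u₋₁` of a vector `u` in a single
position, and associativity determines the iterates of two fields from their products
(`iter_eq_of_cor12_eq`), so that induction on the number of nonvacuum factors applies
(`GradedVertexAlgebra.eq_of_comp_firstFactor_eq`).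

*Existence.* Let `Y_j(u, x) = Y_W(β_j^{L(0)} u, β_j x)` with `β_j = exp(-2πi j / N)` (`twistY`) for the
positions `j = 0, …, N - 1`. Each
`Y_j` is a module structure, and `Y_i`, `Y_j` are local with poles at `β_i x₁ = β_j x₂` only. As the
`β_j` are distinct, the product of all `Y_j(vʲ, x_j)`, multiplied by polynomials that become
monomials when all the variables are identified, can be evaluated with all `x_j = x`; dividing by the
monomial defines the vertex operator of the pure tensor of the `vʲ` (`IsSpec`, `PositionFields.extend`).
Associativity of this extension follows from that of each `Y_j`: two pure tensors give a product of
`2N` fields, which can be reordered into `N` neighbouring pairs up to polynomials; the Taylor expansion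
in each pair produces the iterates of the `Y_j`, and Taylor expansion commutes with the identification
of variables, by the Chu-Vandermonde identity (`Ser.spec_taylor`,
`PositionFields.exists_isIterateWith_tprod`). Equivariance holds because `R_g` permutes the fields
`Y_j` up to scaling the variable (`PositionFields.coeff_extend_of_perm`).
-/

noncomputable section

set_option linter.unusedSectionVars false

open MvPolynomial

/-! ### Formal series in several variables as modules over polynomials -/

/-- Formal `W`-valued series, infinite in both directions, in variables indexed by `σ`: `f n` is the
coefficient of the monomial with exponents `n`. -/
abbrev Ser (σ W : Type*) := (σ → ℤ) → W

namespace Ser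

variable {σ τ W W' : Type*} [AddCommGroup W] [Module ℂ W] [AddCommGroup W'] [Module ℂ W']

/-- The exponents of a monomial, as integers. -/
def expo (m : σ →₀ ℕ) : σ → ℤ := fun i => (m i : ℤ)

@[simp] theorem expo_apply (m : σ →₀ ℕ) (i : σ) : expo m i = m i := rfl

/-- Multiplication by monomials. -/
def shiftHom (σ W : Type*) [AddCommGroup W] [Module ℂ W] :
    Multiplicative (σ →₀ ℕ) →* Module.End ℂ (Ser σ W) where
  toFun m :=
    { toFun := fun f n => f (n - expo m.toAdd)
      map_add' := fun _ _ => rfl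
      map_smul' := fun _ _ => rfl }
  map_one' := by
    ext f n
    change f (n - expo 0) = f n
    congr 1
    funext i
    simp
  map_mul' a b := by
    ext f n
    change f (n - expo (a.toAdd + b.toAdd)) = f (n - expo a.toAdd - expo b.toAdd)
    congr 1
    funext i
    simp only [Pi.sub_apply, expo_apply, Finsupp.add_apply]
    push_cast
    ring

/-- The action of polynomials on formal series. -/
def act (σ W : Type*) [AddCommGroup W] [Module ℂ W] :
    MvPolynomial σ ℂ →ₐ[ℂ] Module.End ℂ (Ser σ W) :=
  AddMonoidAlgebra.lift ℂ _ _ (shiftHom σ W)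

instance : Module (MvPolynomial σ ℂ) (Ser σ W) := Module.compHom _ (act σ W).toRingHom

theorem smul_def (p : MvPolynomial σ ℂ) (f : Ser σ W) : p • f = act σ W p f := rfl

theorem smul_apply (p : MvPolynomial σ ℂ) (f : Ser σ W) (n : σ → ℤ) :
    (p • f) n = ∑ m ∈ p.support, p.coeff m • f (n - expo m) := by
  have h : ∀ (s : Finset (σ →₀ ℕ)) (g : (σ →₀ ℕ) → Ser σ W),
      (∑ m ∈ s, g m) n = ∑ m ∈ s, g m n := fun s g => Finset.sum_apply n s g
  rw [smul_def, act, AddMonoidAlgebra.lift_apply]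
  change ((∑ m ∈ p.support, p.coeff m • shiftHom σ W (.ofAdd m)) f) n = _
  rw [LinearMap.sum_apply, h]
  rfl

theorem C_smul (c : ℂ) (f : Ser σ W) : (C c : MvPolynomial σ ℂ) • f = c • f := by
  rw [smul_def, ← algebraMap_eq, AlgHom.commutes, Module.algebraMap_end_apply]

instance : IsScalarTower ℂ (MvPolynomial σ ℂ) (Ser σ W) where
  smul_assoc c p f := by rw [smul_eq_C_mul, mul_smul, C_smul]

theorem monomial_smul_apply (m : σ →₀ ℕ) (c : ℂ) (f : Ser σ W) (n : σ → ℤ) :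
    (monomial m c • f) n = c • f (n - expo m) := by
  classical
  rw [smul_apply]
  by_cases hc : c = 0
  · simp [hc]
  · rw [support_monomial, if_neg hc, Finset.sum_singleton, coeff_monomial, if_pos rfl]

theorem X_smul_apply [DecidableEq σ] (i : σ) (f : Ser σ W) (n : σ → ℤ) :
    ((X i : MvPolynomial σ ℂ) • f) n = f (n - Pi.single i 1) := by
  have h : expo (Finsupp.single i 1) = (Pi.single i 1 : σ → ℤ) := by
    funext j
    by_cases h : j = i
    · subst h; simp
    · simp [h]
  rw [X, monomial_smul_apply, one_smul, h]

/-- A map of modules that is additive and compatible with constants and variables on a submodule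
is semilinear over polynomials there. -/
theorem map_smul_of_map_X {M M' R' : Type*} [AddCommGroup M] [Module (MvPolynomial σ ℂ) M]
    [CommRing R'] [AddCommGroup M'] [Module R' M'] (s : MvPolynomial σ ℂ →+* R')
    (D : Submodule (MvPolynomial σ ℂ) M) (Φ : M → M')
    (hadd : ∀ f ∈ D, ∀ g ∈ D, Φ (f + g) = Φ f + Φ g)
    (hC : ∀ c, ∀ f ∈ D, Φ ((C c : MvPolynomial σ ℂ) • f) = s (C c) • Φ f)
    (hX : ∀ i, ∀ f ∈ D, Φ ((X i : MvPolynomial σ ℂ) • f) = s (X i) • Φ f)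
    (p : MvPolynomial σ ℂ) {f : M} (hf : f ∈ D) : Φ (p • f) = s p • Φ f := by
  induction p using MvPolynomial.induction_on generalizing f with
  | C c => exact hC c f hf
  | add p q hp hq =>
    rw [add_smul, hadd _ (D.smul_mem p hf) _ (D.smul_mem q hf), hp hf, hq hf, map_add, add_smul]
  | mul_X p i hp => rw [mul_smul, hp (D.smul_mem _ hf), hX i f hf, map_mul, mul_smul]

/-- Coefficientwise application of a linear map. -/
def mapVal (L : W →ₗ[ℂ] W') (f : Ser σ W) : Ser σ W' := fun n => L (f n)

@[simp] theorem mapVal_apply (L : W →ₗ[ℂ] W') (f : Ser σ W) (n : σ → ℤ) :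
    mapVal L f n = L (f n) := rfl

theorem mapVal_smul (L : W →ₗ[ℂ] W') (p : MvPolynomial σ ℂ) (f : Ser σ W) :
    mapVal L (p • f) = p • mapVal L f := by
  ext n
  simp [smul_apply]

/-- The series in the variables `ρ j` that is obtained from `f` by fixing the exponents of the
other variables to those of `n`. -/
def slice (ρ : τ → σ) (n : σ → ℤ) (f : Ser σ W) : Ser τ W := fun a => f (Function.extend ρ a n)

theorem slice_apply_self {ρ : τ → σ} (hρ : ρ.Injective) (n : σ → ℤ) (f : Ser σ W) :
    slice ρ n f (n ∘ ρ) = f n := by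
  unfold slice
  congr 1
  funext i
  by_cases h : ∃ j, ρ j = i
  · obtain ⟨j, rfl⟩ := h
    simp [hρ.extend_apply]
  · rw [Function.extend_apply' _ _ _ h]

theorem slice_smul {ρ : τ → σ} (hρ : ρ.Injective) (n : σ → ℤ) (p : MvPolynomial τ ℂ)
    (f : Ser σ W) : slice ρ n (rename ρ p • f) = p • slice ρ n f := by
  classical
  induction p using MvPolynomial.induction_on generalizing f with
  | C c => rw [rename_C, C_smul, C_smul]; rfl
  | add p q hp hq => rw [map_add, add_smul, add_smul, ← hp, ← hq]; rfl
  | mul_X p i hp =>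
    rw [map_mul, mul_smul, hp, mul_smul, rename_X]
    congr 1
    ext a
    rw [X_smul_apply]
    change ((X (ρ i) : MvPolynomial σ ℂ) • f) (Function.extend ρ a n) = f (Function.extend ρ _ n)
    rw [X_smul_apply]
    congr 1
    funext k
    by_cases h : ∃ j, ρ j = k
    · obtain ⟨j, rfl⟩ := h
      rw [Pi.sub_apply, hρ.extend_apply, hρ.extend_apply, Pi.sub_apply]
      by_cases hj : j = i
      · subst hj; simp
      · simp [hj, hρ.eq_iff]
    · rw [Pi.sub_apply, Function.extend_apply' _ _ _ h, Function.extend_apply' _ _ _ h,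
        Pi.single_eq_of_ne (fun hk => h ⟨i, hk.symm⟩), sub_zero]

/-- The value of `p • f`, when `p` involves only the variables `ρ j`, is computed on a slice. -/
theorem rename_smul_apply {ρ : τ → σ} (hρ : ρ.Injective) (p : MvPolynomial τ ℂ)
    (f : Ser σ W) (n : σ → ℤ) : (rename ρ p • f) n = (p • slice ρ n f) (n ∘ ρ) := by
  rw [← slice_smul hρ, slice_apply_self hρ]

/-! ### Truncation conditions -/

theorem exists_of_smul_apply_ne_zero {p : MvPolynomial σ ℂ} {f : Ser σ W} {n : σ → ℤ}
    (h : (p • f) n ≠ 0) : ∃ m ∈ p.support, f (n - expo m) ≠ 0 := by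
  rw [smul_apply] at h
  obtain ⟨m, hm, h⟩ := Finset.exists_ne_zero_of_sum_ne_zero h
  exact ⟨m, hm, fun h0 => h (by rw [h0, smul_zero])⟩

/-- The series in which the powers of the variable `i` are bounded below. -/
def truncIn (W : Type*) [AddCommGroup W] [Module ℂ W] (i : σ) :
    Submodule (MvPolynomial σ ℂ) (Ser σ W) where
  carrier := {f | ∃ B : ℤ, ∀ n, n i < B → f n = 0}
  add_mem' := by
    rintro f g ⟨B, hB⟩ ⟨B', hB'⟩
    refine ⟨min B B', fun n hn => ?_⟩
    rw [Pi.add_apply, hB n (hn.trans_le (min_le_left _ _)), hB' n (hn.trans_le (min_le_right _ _)),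
      add_zero]
  zero_mem' := ⟨0, fun _ _ => rfl⟩
  smul_mem' := by
    rintro p f ⟨B, hB⟩
    refine ⟨B, fun n hn => ?_⟩
    by_contra h
    obtain ⟨m, -, h⟩ := exists_of_smul_apply_ne_zero h
    refine h (hB _ ?_)
    simp only [Pi.sub_apply, expo_apply]
    omega

/-- The series in which the powers of all the variables are bounded below. -/
def trunc (σ W : Type*) [AddCommGroup W] [Module ℂ W] : Submodule (MvPolynomial σ ℂ) (Ser σ W) :=
  ⨅ i, truncIn W i

theorem mem_trunc {f : Ser σ W} : f ∈ trunc σ W ↔ ∀ i, f ∈ truncIn W i := Submodule.mem_iInf _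

theorem exists_bound_of_mem_trunc [Finite σ] {f : Ser σ W} (hf : f ∈ trunc σ W) :
    ∃ B : ℤ, ∀ n, f n ≠ 0 → ∀ i, B ≤ n i := by
  cases nonempty_fintype σ
  choose B hB using mem_trunc.mp hf
  by_cases hσ : Nonempty σ
  · refine ⟨Finset.univ.inf' Finset.univ_nonempty B, fun n hn i => ?_⟩
    by_contra h
    refine hn (hB i n ?_)
    exact (not_le.mp h).trans_le (Finset.inf'_le _ (Finset.mem_univ i))
  · exact ⟨0, fun n _ i => (hσ ⟨i⟩).elim⟩

/-- The series with only finitely many monomials of each degree, with respect to a degree function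
on the exponents. -/
def finDeg {A : Type*} [AddCommGroup A] (W : Type*) [AddCommGroup W] [Module ℂ W]
    (δ : (σ → ℤ) →+ A) : Submodule (MvPolynomial σ ℂ) (Ser σ W) where
  carrier := {f | ∀ d, {n | δ n = d ∧ f n ≠ 0}.Finite}
  add_mem' := by
    intro f g hf hg d
    refine ((hf d).union (hg d)).subset ?_
    rintro n ⟨hn, h⟩
    by_cases hfn : f n = 0
    · exact Or.inr ⟨hn, fun hgn => h (by rw [Pi.add_apply, hfn, hgn, add_zero])⟩
    · exact Or.inl ⟨hn, hfn⟩
  zero_mem' := by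
    intro d
    simp
  smul_mem' := by
    intro p f hf d
    refine (p.support.finite_toSet.biUnion fun m _ =>
      (hf (d - δ (expo m))).image fun n => n + expo m).subset ?_
    rintro n ⟨hn, h⟩
    obtain ⟨m, hm, h⟩ := exists_of_smul_apply_ne_zero h
    refine Set.mem_biUnion (x := m) hm ⟨n - expo m, ⟨?_, h⟩, ?_⟩
    · rw [map_sub, hn]
    · simp

open Classical in
/-- The exponents of the monomial that is obtained by replacing each variable `i` by `π i`. -/
def push [Fintype σ] (π : σ → τ) : (σ → ℤ) →+ (τ → ℤ) where
  toFun n t := ∑ i with π i = t, n i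
  map_zero' := by
    funext t
    simp
  map_add' a b := by
    funext t
    simp [Finset.sum_add_distrib]

theorem push_apply [Fintype σ] [DecidableEq τ] (π : σ → τ) (n : σ → ℤ) (t : τ) :
    push π n t = ∑ i with π i = t, n i := by
  refine Finset.sum_congr ?_ fun _ _ => rfl
  ext i
  simp

theorem push_single [Fintype σ] [DecidableEq σ] [DecidableEq τ] (π : σ → τ) (i : σ) :
    push π (Pi.single i 1) = Pi.single (π i) 1 := by
  funext t
  rw [push_apply, Finset.sum_filter, Finset.sum_eq_single i]
  · by_cases h : π i = t
    · subst h; simp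
    · simp [h, Ne.symm h]
  · intro j _ hj
    simp [hj]
  · simp

theorem trunc_le_finDeg_push [Fintype σ] (π : σ → τ) :
    trunc σ W ≤ finDeg W (push π) := by
  classical
  intro f hf d
  obtain ⟨B, hB⟩ := exists_bound_of_mem_trunc hf
  refine (Set.finite_Icc (fun _ => B)
    (fun i => d (π i) - ∑ j ∈ (Finset.univ.filter fun j => π j = π i).erase i, B)).subset ?_
  rintro n ⟨hn, h⟩
  refine ⟨fun i => hB n h i, fun i => ?_⟩
  have h1 : d (π i) = ∑ j with π j = π i, n j := by rw [← hn, push_apply]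
  rw [← Finset.add_sum_erase _ _ (show i ∈ Finset.univ.filter fun j => π j = π i by simp)] at h1
  have h2 : ∑ j ∈ (Finset.univ.filter fun j => π j = π i).erase i, B ≤
      ∑ j ∈ (Finset.univ.filter fun j => π j = π i).erase i, n j :=
    Finset.sum_le_sum fun j _ => hB n h j
  simp only
  linarith

/-! ### Substitutions given by kernels -/

/-- The transformation of coefficient functions with the matrix `κ`. It is meaningful for those
`f` for which each of the sums is finite. -/
def kerSum {O A : Type*} (κ : O → A → ℤ) (f : A → W) : O → W := fun o => ∑ᶠ a, κ o a • f a

theorem kerSum_add {O A : Type*} {κ : O → A → ℤ} {f g : A → W} {o : O}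
    (hf : {a | κ o a ≠ 0 ∧ f a ≠ 0}.Finite) (hg : {a | κ o a ≠ 0 ∧ g a ≠ 0}.Finite) :
    kerSum κ (f + g) o = kerSum κ f o + kerSum κ g o := by
  have h : ∀ {f : A → W}, {a | κ o a ≠ 0 ∧ f a ≠ 0}.Finite →
      (Function.support fun a => κ o a • f a).Finite := by
    intro f hf
    refine hf.subset fun a ha => ⟨fun h0 => ha ?_, fun h0 => ha ?_⟩
    · simp [h0]
    · simp [h0]
  simp only [kerSum, Pi.add_apply, smul_add]
  exact finsum_add_distrib (h hf) (h hg)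

theorem kerSum_csmul {O A : Type*} (κ : O → A → ℤ) (c : ℂ) (f : A → W) :
    kerSum κ (c • f) = c • kerSum κ f := by
  funext o
  simp only [kerSum, Pi.smul_apply, smul_finsum]
  exact finsum_congr fun a => smul_comm _ _ _

/-- Two successive transformations, by exchange of the order of summation. -/
theorem kerSum_kerSum {P O A : Type*} (κ' : P → O → ℤ) (κ : O → A → ℤ) (f : A → W) (p : P)
    (h : {x : O × A | κ' p x.1 ≠ 0 ∧ κ x.1 x.2 ≠ 0 ∧ f x.2 ≠ 0}.Finite)
    (hfin : ∀ a, {o | κ' p o ≠ 0 ∧ κ o a ≠ 0}.Finite) :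
    kerSum κ' (kerSum κ f) p = ∑ᶠ a, (∑ᶠ o, κ' p o * κ o a) • f a := by
  classical
  have h1 : ∀ o, κ' p o • kerSum κ f o = ∑ᶠ a, (κ' p o * κ o a) • f a := by
    intro o
    by_cases ho : κ' p o = 0
    · simp [ho]
    · rw [kerSum, smul_finsum' _ ?_]
      · exact finsum_congr fun a => (mul_smul _ _ _).symm
      · refine (h.preimage (f := fun a => (o, a)) (fun _ _ _ _ e => (Prod.ext_iff.mp e).2)).subset ?_
        exact fun a ha => ⟨ho, fun h0 => ha (by simp [h0]), fun h0 => ha (by simp [h0])⟩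
  have h2 : ∀ a, (∑ᶠ o, κ' p o * κ o a) • f a = ∑ᶠ o, (κ' p o * κ o a) • f a := by
    intro a
    refine finsum_smul' ?_ _
    exact (hfin a).subset fun o ho => ⟨left_ne_zero_of_mul ho, right_ne_zero_of_mul ho⟩
  rw [kerSum, finsum_congr h1, finsum_congr h2]
  have hs : (Function.support fun x : O × A => (κ' p x.1 * κ x.1 x.2) • f x.2).Finite := by
    refine h.subset fun x hx => ⟨fun h0 => hx ?_, fun h0 => hx ?_, fun h0 => hx ?_⟩ <;>
      simp [h0]
  rw [← finsum_curry _ hs]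
  have hs' : (Function.support fun x : A × O => (κ' p x.2 * κ x.2 x.1) • f x.1).Finite :=
    (hs.preimage (Equiv.prodComm A O).injective.injOn)
  rw [← finsum_curry (fun x : A × O => (κ' p x.2 * κ x.2 x.1) • f x.1) hs']
  exact finsum_comp_equiv (Equiv.prodComm O A)
    (f := fun x : A × O => (κ' p x.2 * κ x.2 x.1) • f x.1)

end Ser

/-! ### Sums over injective families -/

theorem finsum_eq_finsum_comp {α β M : Type*} [AddCommMonoid M] {g : β → α}
    (hg : g.Injective) {F : α → M} (h : ∀ x, F x ≠ 0 → x ∈ Set.range g) :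
    ∑ᶠ x, F x = ∑ᶠ y, F (g y) := by
  rw [← finsum_mem_range hg, finsum_mem_def]
  refine finsum_congr fun x => ?_
  by_cases hx : F x = 0
  · rw [hx, eq_comm, Set.indicator_apply_eq_zero]
    exact fun _ => hx
  · rw [Set.indicator_of_mem (h x hx)]

/-! ### Binomial coefficients -/

/-- The binomial coefficient `a(a - 1)⋯(a - k + 1) / k!` for integers `a` and `k`, which is zero for
negative `k`. -/
def bin (a k : ℤ) : ℤ := if 0 ≤ k then Ring.choose a k.toNat else 0

theorem bin_natCast (a : ℤ) (k : ℕ) : bin a k = Ring.choose a k := by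
  simp [bin]

theorem bin_of_neg (a : ℤ) {k : ℤ} (hk : k < 0) : bin a k = 0 := if_neg (not_le.mpr hk)

@[simp] theorem bin_zero_right (a : ℤ) : bin a 0 = 1 := by
  simp [bin]

theorem bin_succ (a k : ℤ) : bin (a + 1) k = bin a (k - 1) + bin a k := by
  rcases lt_trichotomy k 0 with hk | rfl | hk
  · rw [bin_of_neg _ hk, bin_of_neg _ hk, bin_of_neg _ (by omega), add_zero]
  · rw [bin_zero_right, bin_zero_right, bin_of_neg _ (by norm_num), zero_add]
  · obtain ⟨m, rfl⟩ : ∃ m : ℕ, k = m + 1 := ⟨(k - 1).toNat, by omega⟩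
    rw [add_sub_cancel_right, ← Nat.cast_succ, bin_natCast, bin_natCast, bin_natCast]
    exact Ring.choose_succ_succ a m

/-- The Chu-Vandermonde identity for several summands. -/
theorem finsum_prod_bin {ι : Type*} [Fintype ι] (a : ι → ℤ) (c : ℤ) :
    ∑ᶠ k : ι → ℤ, (if ∑ i, k i = c then ∏ i, bin (a i) (k i) else 0) = bin (∑ i, a i) c := by
  classical
  have hinj : Function.Injective (Ser.expo : (ι →₀ ℕ) → ι → ℤ) := fun x y h => by
    ext i
    exact Int.ofNat_inj.mp (congrFun h i)
  rw [finsum_eq_finsum_comp hinj]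
  · rcases lt_or_ge c 0 with hc | hc
    · rw [bin_of_neg _ hc]
      refine finsum_eq_zero_of_forall_eq_zero fun l => if_neg fun h => ?_
      have : (0 : ℤ) ≤ ∑ i, Ser.expo l i := Finset.sum_nonneg fun i _ => by simp
      omega
    · obtain ⟨d, rfl⟩ := Int.eq_ofNat_of_zero_le hc
      have hB : ∀ s : Finset ι, PowerSeries.binomialSeries ℤ (∑ i ∈ s, a i) =
          ∏ i ∈ s, PowerSeries.binomialSeries ℤ (a i) := by
        intro s
        induction s using Finset.induction_on with
        | empty => simp
        | insert j s hj ih => rw [Finset.sum_insert hj, Finset.prod_insert hj,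
            PowerSeries.binomialSeries_add, ih]
      have h1 := congrArg (PowerSeries.coeff d) (hB Finset.univ)
      rw [PowerSeries.coeff_prod] at h1
      simp only [PowerSeries.binomialSeries_coeff, smul_eq_mul, mul_one] at h1
      rw [bin_natCast, h1, finsum_eq_sum_of_support_subset (s := Finset.finsuppAntidiag Finset.univ d)]
      · refine Finset.sum_congr rfl fun l hl => ?_
        have hl' := (Finset.mem_finsuppAntidiag.mp hl).1
        rw [if_pos (by simp only [Ser.expo_apply]; exact_mod_cast hl')]
        simp [bin_natCast]
      · intro l hl
        rw [Finset.mem_coe, Finset.mem_finsuppAntidiag]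
        refine ⟨?_, Finset.subset_univ _⟩
        by_contra h
        refine hl (if_neg fun h' => h ?_)
        simp only [Ser.expo_apply] at h'
        exact_mod_cast h'
  · intro k hk
    have hk0 : ∀ i, 0 ≤ k i := by
      intro i
      by_contra h
      refine hk ?_
      rw [Finset.prod_eq_zero (Finset.mem_univ i) (bin_of_neg _ (not_le.mp h)), ite_self]
    refine ⟨Finsupp.equivFunOnFinite.symm fun i => (k i).toNat, ?_⟩
    funext i
    simp [hk0 i]

namespace Ser

variable {σ τ ι W W' : Type*} [AddCommGroup W] [Module ℂ W] [AddCommGroup W'] [Module ℂ W']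

theorem kerSum_X_smul [DecidableEq σ] {O : Type*} (κ : O → (σ → ℤ) → ℤ) (i : σ) (f : Ser σ W)
    (o : O) : kerSum κ ((X i : MvPolynomial σ ℂ) • f) o =
      kerSum (fun o n => κ o (n + Pi.single i 1)) f o := by
  simp only [kerSum]
  rw [← finsum_comp_equiv (Equiv.addRight (Pi.single i (1 : ℤ)))]
  refine finsum_congr fun n => ?_
  rw [X_smul_apply]
  simp

theorem kerSum_add_left {O A : Type*} (κ κ' : O → A → ℤ) (f : A → W) {o : O}
    (h : {a | κ o a ≠ 0 ∧ f a ≠ 0}.Finite) (h' : {a | κ' o a ≠ 0 ∧ f a ≠ 0}.Finite) :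
    kerSum (fun o a => κ o a + κ' o a) f o = kerSum κ f o + kerSum κ' f o := by
  simp only [kerSum, add_smul]
  refine finsum_add_distrib (h.subset fun a ha => ⟨fun h0 => ha ?_, fun h0 => ha ?_⟩)
    (h'.subset fun a ha => ⟨fun h0 => ha ?_, fun h0 => ha ?_⟩) <;> simp [h0]

theorem kerSum_mapVal {O : Type*} (κ : O → (σ → ℤ) → ℤ) (L : W →ₗ[ℂ] W') (f : Ser σ W) {o : O}
    (h : {a | κ o a ≠ 0 ∧ f a ≠ 0}.Finite) :
    kerSum κ (mapVal L f) o = L (kerSum κ f o) := by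
  have hs : (Function.support fun a => κ o a • f a).Finite :=
    h.subset fun a ha => ⟨fun h0 => ha (by simp [h0]), fun h0 => ha (by simp [h0])⟩
  simp only [kerSum]
  refine Eq.trans (finsum_congr fun a => ?_) (L.toAddMonoidHom.map_finsum hs).symm
  exact (map_zsmul L _ _).symm

/-! ### Identification of variables -/

open Classical in
/-- The coefficients of the substitution of `π i` for each variable `i`. -/
def specKer [Fintype σ] (π : σ → τ) (o : τ → ℤ) (n : σ → ℤ) : ℤ := if push π n = o then 1 else 0

theorem specKer_of_eq [Fintype σ] {π : σ → τ} {o : τ → ℤ} {n : σ → ℤ} (h : push π n = o) :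
    specKer π o n = 1 := if_pos h

theorem specKer_of_ne [Fintype σ] {π : σ → τ} {o : τ → ℤ} {n : σ → ℤ} (h : push π n ≠ o) :
    specKer π o n = 0 := if_neg h

theorem push_eq_of_specKer_ne_zero [Fintype σ] {π : σ → τ} {o : τ → ℤ} {n : σ → ℤ}
    (h : specKer π o n ≠ 0) : push π n = o := by
  by_contra h'
  exact h (specKer_of_ne h')

/-- The series obtained from `f` by replacing each variable `i` by `π i`. -/
def spec [Fintype σ] (π : σ → τ) (f : Ser σ W) : Ser τ W := kerSum (specKer π) f

section Spec

variable [Fintype σ] {π : σ → τ}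

theorem spec_finite {f : Ser σ W} (hf : f ∈ finDeg W (push π)) (o : τ → ℤ) :
    {n | specKer π o n ≠ 0 ∧ f n ≠ 0}.Finite :=
  (hf o).subset fun _ hn => ⟨push_eq_of_specKer_ne_zero hn.1, hn.2⟩

theorem spec_apply (f : Ser σ W) (o : τ → ℤ) :
    spec π f o = ∑ᶠ n ∈ {n | push π n = o}, f n := by
  refine Eq.trans (finsum_congr fun n => ?_) (finsum_mem_def {n | push π n = o} fun n => f n).symm
  by_cases h : push π n = o
  · rw [specKer_of_eq h, one_smul, Set.indicator_of_mem (show n ∈ {n | push π n = o} from h)]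
  · rw [specKer_of_ne h, zero_smul, Set.indicator_of_notMem (show n ∉ {n | push π n = o} from h)]

theorem spec_add {f g : Ser σ W} (hf : f ∈ finDeg W (push π)) (hg : g ∈ finDeg W (push π)) :
    spec π (f + g) = spec π f + spec π g := by
  ext o
  exact kerSum_add (spec_finite hf o) (spec_finite hg o)

theorem spec_csmul (c : ℂ) (f : Ser σ W) : spec π (c • f) = c • spec π f := kerSum_csmul _ c f

theorem spec_smul (p : MvPolynomial σ ℂ) {f : Ser σ W} (hf : f ∈ finDeg W (push π)) :
    spec π (p • f) = rename π p • spec π f := by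
  classical
  refine map_smul_of_map_X (rename π : MvPolynomial σ ℂ →ₐ[ℂ] MvPolynomial τ ℂ).toRingHom
    (finDeg W (push π)) (spec π) (fun f hf g hg => spec_add hf hg) ?_ ?_ p hf
  · intro c f _
    change _ = rename π (C c) • _
    rw [rename_C, C_smul, C_smul, spec_csmul]
  · intro i f _
    change _ = rename π (X i) • _
    ext o
    rw [rename_X, X_smul_apply, spec, kerSum_X_smul]
    refine finsum_congr fun n => ?_
    simp only [specKer, map_add, push_single, eq_sub_iff_add_eq]

theorem spec_mapVal (L : W →ₗ[ℂ] W') {f : Ser σ W} (hf : f ∈ finDeg W (push π)) :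
    spec π (mapVal L f) = mapVal L (spec π f) := by
  ext o
  exact kerSum_mapVal _ L f (spec_finite hf o)

end Spec

/-! ### Taylor expansion -/

/-- The degree of a monomial in each of the pairs of variables `inl i`, `inr i`. -/
def pairDeg (ι : Type*) : (ι ⊕ ι → ℤ) →+ (ι → ℤ) where
  toFun n i := n (.inl i) + n (.inr i)
  map_zero' := by
    funext i
    simp
  map_add' a b := by
    funext i
    simp only [Pi.add_apply]
    ring

theorem pairDeg_apply (n : ι ⊕ ι → ℤ) (i : ι) : pairDeg ι n i = n (.inl i) + n (.inr i) := rfl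

theorem trunc_le_finDeg_pairDeg [Finite ι] : trunc (ι ⊕ ι) W ≤ finDeg W (pairDeg ι) := by
  classical
  cases nonempty_fintype ι
  intro f hf d
  obtain ⟨B, hB⟩ := exists_bound_of_mem_trunc hf
  refine (Set.finite_Icc (fun _ => B) (Sum.elim (fun i => d i - B) (fun i => d i - B))).subset ?_
  rintro n ⟨hn, h⟩
  have h1 : ∀ i, n (.inl i) + n (.inr i) = d i := fun i => congrFun hn i
  refine ⟨fun i => hB n h i, ?_⟩
  rintro (i | i)
  · have := hB n h (.inr i)
    have := h1 i
    simp only [Sum.elim_inl]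
    omega
  · have := hB n h (.inl i)
    have := h1 i
    simp only [Sum.elim_inr]
    omega

variable [Fintype ι]

open Classical in
/-- The coefficients of the substitution `x ↦ t + y` in each pair of variables. -/
def taylorKer (ι : Type*) [Fintype ι] (o n : ι ⊕ ι → ℤ) : ℤ :=
  if pairDeg ι n = pairDeg ι o then ∏ i, bin (n (.inl i)) (o (.inl i)) else 0

/-- The Taylor expansion `f(t + y, y)` in nonnegative powers of `t` of a series `f(x, y)`, where `x`,
`y` and `t` are families of variables indexed by `ι`. The variables `inl i` stand for `xᵢ` in `f`,
and for `tᵢ` in the expansion. -/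
def taylor (f : Ser (ι ⊕ ι) W) : Ser (ι ⊕ ι) W := kerSum (taylorKer ι) f

/-- The substitution `x ↦ t + y` in polynomials. -/
def taylorPoly (ι : Type*) : MvPolynomial (ι ⊕ ι) ℂ →ₐ[ℂ] MvPolynomial (ι ⊕ ι) ℂ :=
  aeval (Sum.elim (fun i => X (.inl i) + X (.inr i)) (fun i => X (.inr i)))

@[simp] theorem taylorPoly_X_inl (i : ι) :
    taylorPoly ι (X (.inl i)) = X (.inl i) + X (.inr i) := by
  simp [taylorPoly]

@[simp] theorem taylorPoly_X_inr (i : ι) : taylorPoly ι (X (.inr i)) = X (.inr i) := by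
  simp [taylorPoly]

theorem taylorPoly_injective : Function.Injective (taylorPoly ι) := by
  let g : MvPolynomial (ι ⊕ ι) ℂ →ₐ[ℂ] MvPolynomial (ι ⊕ ι) ℂ :=
    aeval (Sum.elim (fun i => X (.inl i) - X (.inr i)) (fun i => X (.inr i)))
  have h : g.comp (taylorPoly ι) = AlgHom.id ℂ _ := by
    ext i
    rcases i with i | i <;> simp [g]
  exact Function.LeftInverse.injective (g := g) fun p => DFunLike.congr_fun h p

theorem taylor_finite {f : Ser (ι ⊕ ι) W} (hf : f ∈ finDeg W (pairDeg ι)) (o : ι ⊕ ι → ℤ) :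
    {n | taylorKer ι o n ≠ 0 ∧ f n ≠ 0}.Finite :=
  (hf (pairDeg ι o)).subset fun n hn => ⟨by by_contra h; exact hn.1 (if_neg h), hn.2⟩

theorem taylorKer_add_inr [DecidableEq ι] (i : ι) (o n : ι ⊕ ι → ℤ) :
    taylorKer ι o (n + Pi.single (.inr i) 1) = taylorKer ι (o - Pi.single (.inr i) 1) n := by
  simp [taylorKer, eq_sub_iff_add_eq]

theorem taylorKer_add_inl [DecidableEq ι] (i : ι) (o n : ι ⊕ ι → ℤ) :
    taylorKer ι o (n + Pi.single (.inl i) 1) =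
      taylorKer ι (o - Pi.single (.inl i) 1) n + taylorKer ι (o - Pi.single (.inr i) 1) n := by
  have h : pairDeg ι (Pi.single (.inl i) 1) = pairDeg ι (Pi.single (.inr i) 1) := by
    funext j
    simp only [pairDeg_apply, Pi.single_apply]
    simp
  simp only [taylorKer, map_add, map_sub, h, eq_sub_iff_add_eq]
  split_ifs
  · rw [← Finset.mul_prod_erase _ _ (Finset.mem_univ i), ← Finset.mul_prod_erase _ _
      (Finset.mem_univ i), ← Finset.mul_prod_erase _ (fun j => bin (n (.inl j)) _)
      (Finset.mem_univ i)]
    have h1 : ∀ e : ι ⊕ ι → ℤ, ∀ e' : ι ⊕ ι → ℤ, (∀ j ≠ i, e (.inl j) = n (.inl j)) →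
        (∀ j ≠ i, e' (.inl j) = o (.inl j)) →
        ∏ j ∈ Finset.univ.erase i, bin (e (.inl j)) (e' (.inl j)) =
          ∏ j ∈ Finset.univ.erase i, bin (n (.inl j)) (o (.inl j)) := by
      intro e e' he he'
      refine Finset.prod_congr rfl fun j hj => ?_
      rw [he j (Finset.ne_of_mem_erase hj), he' j (Finset.ne_of_mem_erase hj)]
    rw [h1 _ _ (fun j hj => by simp [hj]) (fun j _ => rfl),
      h1 n (o - Pi.single (Sum.inl i) 1) (fun j _ => rfl) (fun j hj => by simp [hj]),
      h1 n (o - Pi.single (Sum.inr i) 1) (fun j _ => rfl) (fun j hj => by simp), ← add_mul]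
    simp [bin_succ]
  · simp

theorem taylor_add {f g : Ser (ι ⊕ ι) W} (hf : f ∈ finDeg W (pairDeg ι))
    (hg : g ∈ finDeg W (pairDeg ι)) : taylor (f + g) = taylor f + taylor g := by
  ext o
  exact kerSum_add (taylor_finite hf o) (taylor_finite hg o)

theorem taylor_csmul (c : ℂ) (f : Ser (ι ⊕ ι) W) : taylor (c • f) = c • taylor f :=
  kerSum_csmul _ c f

theorem taylor_smul (p : MvPolynomial (ι ⊕ ι) ℂ) {f : Ser (ι ⊕ ι) W}
    (hf : f ∈ finDeg W (pairDeg ι)) : taylor (p • f) = taylorPoly ι p • taylor f := by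
  classical
  refine map_smul_of_map_X (taylorPoly ι).toRingHom
    (finDeg W (pairDeg ι)) taylor (fun f hf g hg => taylor_add hf hg) ?_ ?_ p hf
  · intro c f _
    change _ = taylorPoly ι (C c) • _
    rw [← algebraMap_eq, AlgHom.commutes, algebraMap_eq, C_smul, C_smul, taylor_csmul]
  · rintro (i | i) f hf
    · change _ = taylorPoly ι (X _) • _
      ext o
      rw [taylorPoly_X_inl, add_smul, Pi.add_apply, X_smul_apply, X_smul_apply, taylor, kerSum_X_smul]
      simp only [taylorKer_add_inl]
      exact kerSum_add_left (fun o n => taylorKer ι (o - Pi.single (Sum.inl i) 1) n)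
        (fun o n => taylorKer ι (o - Pi.single (Sum.inr i) 1) n) f (o := o)
        (taylor_finite hf (o - Pi.single (Sum.inl i) 1))
        (taylor_finite hf (o - Pi.single (Sum.inr i) 1))
    · change _ = taylorPoly ι (X _) • _
      ext o
      rw [taylorPoly_X_inr, X_smul_apply, taylor, kerSum_X_smul]
      simp only [taylorKer_add_inr]
      rfl

theorem taylor_apply (f : Ser (ι ⊕ ι) W) (k l : ι → ℤ) :
    taylor f (Sum.elim k l) = ∑ᶠ a : ι → ℤ, (∏ i, bin (a i) (k i)) • f (Sum.elim a (k + l - a)) := by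
  have hinj : Function.Injective fun a : ι → ℤ => (Sum.elim a (k + l - a) : ι ⊕ ι → ℤ) := by
    intro a b h
    funext i
    exact congrFun h (.inl i)
  change ∑ᶠ n, taylorKer ι (Sum.elim k l) n • f n = _
  rw [finsum_eq_finsum_comp hinj]
  · refine finsum_congr fun a => ?_
    have h : pairDeg ι (Sum.elim a (k + l - a)) = pairDeg ι (Sum.elim k l) := by
      funext i
      simp [pairDeg_apply]
    simp [taylorKer, h]
  · intro n hn
    have h : pairDeg ι n = pairDeg ι (Sum.elim k l) := by
      by_contra h
      exact hn (by simp [taylorKer, h])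
    refine ⟨fun i => n (.inl i), ?_⟩
    funext i
    rcases i with i | i
    · rfl
    · have := congrFun h i
      simp only [pairDeg_apply, Sum.elim_inl, Sum.elim_inr] at this
      simp only [Sum.elim_inr, Pi.sub_apply, Pi.add_apply]
      omega

theorem taylor_eq_zero_of_neg (f : Ser (ι ⊕ ι) W) {o : ι ⊕ ι → ℤ} {i : ι} (hi : o (.inl i) < 0) :
    taylor f o = 0 := by
  refine finsum_eq_zero_of_forall_eq_zero fun n => ?_
  rw [taylorKer, Finset.prod_eq_zero (Finset.mem_univ i) (bin_of_neg _ hi), ite_self, zero_smul]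

/-- The map of variables `x ↦ x`, `y ↦ y` that identifies all the variables of each family. -/
def twoBlocks (ι : Type*) : ι ⊕ ι → Unit ⊕ Unit := Sum.map (fun _ => ()) (fun _ => ())

theorem push_twoBlocks_inl (n : ι ⊕ ι → ℤ) :
    push (twoBlocks ι) n (.inl ()) = ∑ i, n (.inl i) := by
  rw [push_apply, Finset.sum_filter, Fintype.sum_sum_type]
  simp [twoBlocks]

theorem push_twoBlocks_inr (n : ι ⊕ ι → ℤ) :
    push (twoBlocks ι) n (.inr ()) = ∑ i, n (.inr i) := by
  rw [push_apply, Finset.sum_filter, Fintype.sum_sum_type]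
  simp [twoBlocks]

theorem push_twoBlocks_eq_iff (n : ι ⊕ ι → ℤ) (p : Unit ⊕ Unit → ℤ) :
    push (twoBlocks ι) n = p ↔ ∑ i, n (.inl i) = p (.inl ()) ∧ ∑ i, n (.inr i) = p (.inr ()) := by
  rw [funext_iff, Sum.forall, ← push_twoBlocks_inl, ← push_twoBlocks_inr]
  exact ⟨fun h => ⟨h.1 (), h.2 ()⟩, fun h => ⟨fun _ => h.1, fun _ => h.2⟩⟩

/-- For each monomial, only finitely many terms of its Taylor expansion have a given degree. -/
theorem taylorKer_finite (p : Unit ⊕ Unit → ℤ) (n : ι ⊕ ι → ℤ) :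
    {o | push (twoBlocks ι) o = p ∧ taylorKer ι o n ≠ 0}.Finite := by
  classical
  refine (Set.finite_Icc (Sum.elim (fun _ => 0) fun i => pairDeg ι n i - p (.inl ()))
    (Sum.elim (fun _ => p (.inl ())) (pairDeg ι n))).subset ?_
  rintro o ⟨h, ho⟩
  have h0 : ∀ i, 0 ≤ o (.inl i) := by
    intro i
    by_contra hi
    refine ho ?_
    rw [taylorKer, Finset.prod_eq_zero (Finset.mem_univ i) (bin_of_neg _ (not_le.mp hi)), ite_self]
  have h1 : pairDeg ι n = pairDeg ι o := by
    by_contra h'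
    exact ho (if_neg h')
  have h2 : ∀ i, o (.inl i) ≤ p (.inl ()) := by
    intro i
    rw [← ((push_twoBlocks_eq_iff o p).mp h).1]
    exact Finset.single_le_sum (f := fun i => o (.inl i)) (fun j _ => h0 j) (Finset.mem_univ i)
  have h3 : ∀ i, pairDeg ι n i = o (.inl i) + o (.inr i) := fun i => congrFun h1 i
  constructor <;> rintro (i | i) <;> have := h0 i <;> have := h2 i <;> have := h3 i <;>
    simp only [Sum.elim_inl, Sum.elim_inr] <;> omega

/-- The coefficient identity behind `spec_taylor`: the Chu-Vandermonde identity. -/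
theorem taylor_spec_kernel (p : Unit ⊕ Unit → ℤ) (n : ι ⊕ ι → ℤ) :
    ∑ᶠ o, specKer (twoBlocks ι) p o * taylorKer ι o n =
      taylorKer Unit p (push (twoBlocks ι) n) := by
  have hinj : Function.Injective fun k : ι → ℤ => (Sum.elim k (pairDeg ι n - k) : ι ⊕ ι → ℤ) := by
    intro a b h
    funext i
    exact congrFun h (.inl i)
  rw [finsum_eq_finsum_comp hinj]
  · have h1 : ∀ k : ι → ℤ, pairDeg ι n = pairDeg ι (Sum.elim k (pairDeg ι n - k)) := by
      intro k
      funext i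
      simp [pairDeg_apply]
    have h2 : pairDeg Unit (push (twoBlocks ι) n) = pairDeg Unit p ↔
        ∑ i, pairDeg ι n i = p (.inl ()) + p (.inr ()) := by
      have h : (∀ t, pairDeg Unit (push (twoBlocks ι) n) t = pairDeg Unit p t) ↔
          pairDeg Unit (push (twoBlocks ι) n) () = pairDeg Unit p () :=
        ⟨fun h => h (), fun h _ => h⟩
      rw [funext_iff, h]
      simp only [pairDeg_apply, push_twoBlocks_inl, push_twoBlocks_inr, Finset.sum_add_distrib]
    have h3 : ∀ k : ι → ℤ, specKer (twoBlocks ι) p (Sum.elim k (pairDeg ι n - k)) *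
        taylorKer ι (Sum.elim k (pairDeg ι n - k)) n =
        if pairDeg Unit (push (twoBlocks ι) n) = pairDeg Unit p then
          (if ∑ i, k i = p (.inl ()) then ∏ i, bin (n (.inl i)) (k i) else 0) else 0 := by
      intro k
      rw [taylorKer, if_pos (h1 k)]
      simp only [specKer, h2, push_twoBlocks_eq_iff, Sum.elim_inl, Sum.elim_inr, Pi.sub_apply, Finset.sum_sub_distrib]
      by_cases hk : ∑ i, k i = p (.inl ())
      · by_cases hn : ∑ i, pairDeg ι n i = p (.inl ()) + p (.inr ())
        · simp [hk, hn]
        · have : ¬ (∑ i, pairDeg ι n i - p (.inl ()) = p (.inr ())) := by omega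
          simp [hk, hn, this]
      · simp [hk]
    rw [finsum_congr h3, taylorKer]
    split_ifs
    · rw [finsum_prod_bin, ← push_twoBlocks_inl]
      simp
    · exact finsum_eq_zero_of_forall_eq_zero fun _ => rfl
  · intro o ho
    have h : pairDeg ι n = pairDeg ι o := by
      by_contra h
      exact ho (by simp [taylorKer, h])
    refine ⟨fun i => o (.inl i), ?_⟩
    funext i
    rcases i with i | i
    · rfl
    · simp [h, pairDeg_apply]

/-- Taylor expansion in all pairs of variables, followed by the identification of the variables of
each family, is the Taylor expansion of the series with identified variables. -/
theorem spec_taylor {f : Ser (ι ⊕ ι) W} (hf : f ∈ trunc (ι ⊕ ι) W) :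
    spec (twoBlocks ι) (taylor f) = taylor (spec (twoBlocks ι) f) := by
  ext p
  have htot : {n | f n ≠ 0 ∧ ∑ i, pairDeg ι n i = p (.inl ()) + p (.inr ())}.Finite := by
    refine (trunc_le_finDeg_push (fun _ : ι ⊕ ι => ()) hf fun _ => p (.inl ()) + p (.inr ())).subset
      fun n hn => ⟨?_, hn.1⟩
    funext t
    rw [← hn.2, push_apply]
    simp [pairDeg_apply, Finset.sum_add_distrib]
  have hker : ∀ n, ∀ o, specKer (twoBlocks ι) p o ≠ 0 →
      taylorKer ι o n ≠ 0 → ∑ i, pairDeg ι n i = p (.inl ()) + p (.inr ()) := by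
    intro n o h1 h2
    have h3 := push_eq_of_specKer_ne_zero h1
    have h4 : pairDeg ι n = pairDeg ι o := by
      by_contra h
      exact h2 (if_neg h)
    rw [push_twoBlocks_eq_iff] at h3
    rw [h4, ← h3.1, ← h3.2, ← Finset.sum_add_distrib]
    rfl
  refine (kerSum_kerSum _ _ f p ?_ ?_).trans (Eq.trans ?_ (kerSum_kerSum _ _ f p ?_ ?_).symm)
  rotate_left 2
  · refine finsum_congr fun n => ?_
    rw [taylor_spec_kernel, finsum_eq_single _ (push (twoBlocks ι) n)]
    · simp [specKer]
    · intro o ho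
      simp [specKer, Ne.symm ho]
  · refine (htot.image fun n => (push (twoBlocks ι) n, n)).subset ?_
    rintro ⟨o, n⟩ ⟨h1, h2, h3⟩
    have h4 : push (twoBlocks ι) n = o := push_eq_of_specKer_ne_zero h2
    have h5 : pairDeg Unit o = pairDeg Unit p := by
      by_contra h
      exact h1 (if_neg h)
    refine ⟨n, ⟨h3, ?_⟩, Prod.ext h4 rfl⟩
    have h6 := congrFun h5 ()
    rw [pairDeg_apply, pairDeg_apply] at h6
    rw [← h6, ← h4, push_twoBlocks_inl, push_twoBlocks_inr, ← Finset.sum_add_distrib]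
    rfl
  · intro n
    refine (Set.finite_singleton (push (twoBlocks ι) n)).subset fun o ho => ?_
    exact (push_eq_of_specKer_ne_zero ho.2).symm
  · refine (htot.biUnion fun n _ => (taylorKer_finite p n).image fun o => (o, n)).subset ?_
    rintro ⟨o, n⟩ ⟨h1, h2, h3⟩
    refine Set.mem_biUnion (x := n) ⟨h3, hker n o h1 h2⟩
      ⟨o, ⟨push_eq_of_specKer_ne_zero h1, h2⟩, rfl⟩
  · intro n
    exact (taylorKer_finite p n).subset fun o ho => ⟨push_eq_of_specKer_ne_zero ho.1, ho.2⟩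

end Ser

namespace Ser

variable {W : Type*} [AddCommGroup W] [Module ℂ W]

/-! ### Series in two variables -/

/-- The exponents `a`, `b` of a monomial in two variables. -/
def pr (a b : ℤ) : Unit ⊕ Unit → ℤ := Sum.elim (fun _ => a) (fun _ => b)

@[simp] theorem pr_inl (a b : ℤ) (t : Unit) : pr a b (.inl t) = a := rfl
@[simp] theorem pr_inr (a b : ℤ) (t : Unit) : pr a b (.inr t) = b := rfl

theorem pr_eta (n : Unit ⊕ Unit → ℤ) : pr (n (.inl ())) (n (.inr ())) = n := by
  funext i
  rcases i with i | i <;> rfl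

theorem pr_sub_single_inl (a b : ℤ) (t : Unit) : pr a b - Pi.single (.inl t) 1 = pr (a - 1) b := by
  funext i
  rcases i with i | i <;> simp

theorem pr_sub_single_inr (a b : ℤ) (t : Unit) : pr a b - Pi.single (.inr t) 1 = pr a (b - 1) := by
  funext i
  rcases i with i | i <;> simp

/-- A series in two variables in the form of a family with two arguments. -/
def toSer (F : Series2 W) : Ser (Unit ⊕ Unit) W := fun n => F (n (.inl ())) (n (.inr ()))

/-- The names of the variables `x₁`, `x₂`. -/
def vars2 : Fin 2 → Unit ⊕ Unit := ![.inl (), .inr ()]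

theorem vars2_bijective : Function.Bijective vars2 := by
  refine ⟨?_, ?_⟩
  · intro i j h
    fin_cases i <;> fin_cases j <;> simp_all [vars2]
  · rintro (⟨⟩ | ⟨⟩)
    exacts [⟨0, rfl⟩, ⟨1, rfl⟩]

theorem toSer_polyMul2 (p : MvPolynomial (Fin 2) ℂ) (F : Series2 W) :
    toSer (polyMul2 p F) = rename vars2 p • toSer F := by
  ext n
  rw [rename_smul_apply vars2_bijective.injective, smul_apply]
  refine Finset.sum_congr rfl fun m _ => ?_
  have h0 : ∀ a : Fin 2 → ℤ, Function.extend vars2 a n (.inl ()) = a 0 := fun a =>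
    vars2_bijective.injective.extend_apply a n 0
  have h1 : ∀ a : Fin 2 → ℤ, Function.extend vars2 a n (.inr ()) = a 1 := fun a =>
    vars2_bijective.injective.extend_apply a n 1
  change _ = _ • toSer F (Function.extend vars2 _ n)
  unfold toSer
  rw [h0, h1]
  rfl

theorem toSer_injective : Function.Injective (toSer (W := W)) := by
  intro F G h
  funext a b
  exact congrFun h (pr a b)

theorem polyMul3_eq_iff (p : MvPolynomial (Fin 2) ℂ) (F G : Series3 W) :
    polyMul3 p F = polyMul3 p G ↔ ∀ c, rename vars2 p • toSer (F c) = rename vars2 p • toSer (G c) := by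
  rw [funext_iff]
  refine forall_congr' fun c => ?_
  rw [← toSer_polyMul2, ← toSer_polyMul2, toSer_injective.eq_iff]
  rfl

theorem taylor_pr (f : Ser (Unit ⊕ Unit) W) (k l : ℤ) :
    taylor f (pr k l) = ∑ᶠ a : ℤ, bin a k • f (pr a (k + l - a)) := by
  rw [pr, taylor_apply, ← finsum_comp_equiv (Equiv.funUnique Unit ℤ).symm]
  refine finsum_congr fun a => ?_
  simp only [Finset.univ_unique, Finset.prod_singleton]
  rfl

/-- Multiplication by a nonzero polynomial is injective on series of the form `M((x₂))((x₁))`: the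
coefficients of the lowest terms, first in `x₁` and then in `x₂`, cannot cancel. -/
theorem eq_zero_of_smul_eq_zero {p : MvPolynomial (Unit ⊕ Unit) ℂ} (hp : p ≠ 0)
    {f : Ser (Unit ⊕ Unit) W} (h1 : f ∈ truncIn W (Sum.inl () : Unit ⊕ Unit))
    (h2 : ∀ a, ∃ B : ℤ, ∀ b, b < B → f (pr a b) = 0) (h : p • f = 0) : f = 0 := by
  classical
  by_contra hf
  obtain ⟨n', hn'⟩ := Function.ne_iff.mp hf
  obtain ⟨B, hB⟩ := h1
  obtain ⟨a0, ⟨b', hb'⟩, ha0⟩ := Int.exists_least_of_bdd (P := fun a => ∃ b, f (pr a b) ≠ 0)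
    ⟨B, fun a ⟨b, hb⟩ => by
      by_contra hlt
      exact hb (hB _ (by simpa using hlt))⟩ ⟨_, _, by rw [pr_eta]; exact hn'⟩
  obtain ⟨B', hB'⟩ := h2 a0
  obtain ⟨b0, hb0, hb0'⟩ := Int.exists_least_of_bdd (P := fun b => f (pr a0 b) ≠ 0)
    ⟨B', fun b hb => by
      by_contra hlt
      exact hb (hB' b (not_le.mp hlt))⟩ ⟨b', hb'⟩
  obtain ⟨m, hm, hmin⟩ := p.support.exists_min_image
    (fun m => toLex (m (.inl ()), m (.inr ()))) (support_nonempty.mpr hp)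
  have h3 := congrFun h (pr a0 b0 + expo m)
  rw [smul_apply, Finset.sum_eq_single m] at h3
  · rw [add_sub_cancel_right, Pi.zero_apply, smul_eq_zero] at h3
    exact h3.elim (mem_support_iff.mp hm) hb0
  · intro m' hm' hne
    by_contra hz
    have hz' : f (pr a0 b0 + expo m - expo m') ≠ 0 := fun h0 => hz (by rw [h0, smul_zero])
    rw [← pr_eta (pr a0 b0 + expo m - expo m')] at hz'
    simp only [Pi.sub_apply, Pi.add_apply, pr_inl, pr_inr, expo_apply] at hz'
    have h4 := ha0 _ ⟨_, hz'⟩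
    have h5 := hmin m' hm'
    rw [Prod.Lex.toLex_le_toLex] at h5
    simp only at h5
    have h6 : m' (.inl ()) = m (.inl ()) := by omega
    rw [h6, add_sub_cancel_right] at hz'
    have h7 := hb0' _ hz'
    refine hne (Finsupp.ext ?_)
    rintro (i | i)
    · exact h6
    · change m' (.inr ()) = m (.inr ())
      omega
  · exact fun h => (h hm).elim

/-! ### The three formal delta functions -/

/-- `deltaMul12` for series indexed by exponents. -/
def delta12 (f : Ser (Unit ⊕ Unit) W) : ℤ → Ser (Unit ⊕ Unit) W :=
  fun c => toSer (deltaMul12 (fun a b => f (pr a b)) c)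

/-- `deltaMul21` for series indexed by exponents. -/
def delta21 (f : Ser (Unit ⊕ Unit) W) : ℤ → Ser (Unit ⊕ Unit) W :=
  fun c => toSer (deltaMul21 (fun a b => f (pr a b)) c)

/-- `deltaMul10` for series indexed by exponents. -/
def delta10 (f : Ser (Unit ⊕ Unit) W) : ℤ → Ser (Unit ⊕ Unit) W :=
  fun c => toSer (deltaMul10 (fun a b => f (pr a b)) c)

theorem delta12_apply (f : Ser (Unit ⊕ Unit) W) (c a b : ℤ) : delta12 f c (pr a b) =
    ∑ᶠ i : ℕ, ((-1 : ℤ) ^ i * Ring.choose (-c - 1) i) • f (pr (a - (-c - 1) + i) (b - i)) := rfl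

theorem delta21_apply (f : Ser (Unit ⊕ Unit) W) (c a b : ℤ) : delta21 f c (pr a b) =
    ∑ᶠ i : ℕ, ((Int.negOnePow (-c - 1) : ℤ) * ((-1 : ℤ) ^ i * Ring.choose (-c - 1) i)) •
      f (pr (a - i) (b - (-c - 1) + i)) := rfl

theorem delta10_apply (f : Ser (Unit ⊕ Unit) W) (c a b : ℤ) : delta10 f c (pr a b) =
    ∑ᶠ i : ℕ, ((-1 : ℤ) ^ i * Ring.choose (a + i) i) • f (pr (c - i) (b + (a + i) + 1)) := rfl

theorem X_inl_smul_pr (f : Ser (Unit ⊕ Unit) W) (a b : ℤ) :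
    ((X (.inl ()) : MvPolynomial (Unit ⊕ Unit) ℂ) • f) (pr a b) = f (pr (a - 1) b) := by
  rw [X_smul_apply, pr_sub_single_inl]

theorem X_inr_smul_pr (f : Ser (Unit ⊕ Unit) W) (a b : ℤ) :
    ((X (.inr ()) : MvPolynomial (Unit ⊕ Unit) ℂ) • f) (pr a b) = f (pr a (b - 1)) := by
  rw [X_smul_apply, pr_sub_single_inr]

theorem ext_pr {f g : Ser (Unit ⊕ Unit) W} (h : ∀ a b, f (pr a b) = g (pr a b)) : f = g := by
  ext n
  rw [← pr_eta n, h]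

theorem finite_support_of_forall_ge (B : ℕ) {M : Type*} [Zero M] {g : ℕ → M}
    (h : ∀ i, B ≤ i → g i = 0) : (Function.support g).Finite :=
  (Set.finite_Iio B).subset fun i hi => by
    by_contra hlt
    exact hi (h i (not_lt.mp hlt))

theorem delta12_support {f : Ser (Unit ⊕ Unit) W} (hf : f ∈ truncIn W (.inr ())) (r : ℕ → ℤ)
    (e : ℕ → ℤ) (b : ℤ) : (Function.support fun i : ℕ => r i • f (pr (e i) (b - i))).Finite := by
  obtain ⟨B, hB⟩ := hf
  refine finite_support_of_forall_ge (b - B + 1).toNat fun i hi => ?_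
  rw [hB _ (by rw [pr_inr]; omega), smul_zero]

theorem delta21_support {f : Ser (Unit ⊕ Unit) W} (hf : f ∈ truncIn W (.inl ())) (r : ℕ → ℤ)
    (e : ℕ → ℤ) (a : ℤ) : (Function.support fun i : ℕ => r i • f (pr (a - i) (e i))).Finite := by
  obtain ⟨B, hB⟩ := hf
  refine finite_support_of_forall_ge (a - B + 1).toNat fun i hi => ?_
  rw [hB _ (by rw [pr_inl]; omega), smul_zero]

theorem delta12_smul (p : MvPolynomial (Unit ⊕ Unit) ℂ) {f : Ser (Unit ⊕ Unit) W}
    (hf : f ∈ truncIn W (.inr ())) : delta12 (p • f) = p • delta12 f := by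
  refine map_smul_of_map_X (RingHom.id _) (truncIn W (.inr ())) delta12 ?_ ?_ ?_ p hf
  · intro f hf g hg
    ext c n
    rw [← pr_eta n, Pi.add_apply, Pi.add_apply, delta12_apply, delta12_apply, delta12_apply,
      ← finsum_add_distrib (delta12_support hf _ _ _) (delta12_support hg _ _ _)]
    simp only [Pi.add_apply, smul_add]
  · intro r f _
    ext c n
    rw [← pr_eta n, RingHom.id_apply, Pi.smul_apply, C_smul, C_smul, Pi.smul_apply, delta12_apply,
      delta12_apply, smul_finsum]
    exact finsum_congr fun i => (smul_comm _ _ _).symm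
  · rintro (⟨⟩ | ⟨⟩) f _
    · funext c
      refine ext_pr fun a b => ?_
      rw [RingHom.id_apply, Pi.smul_apply, X_inl_smul_pr, delta12_apply, delta12_apply]
      refine finsum_congr fun i => ?_
      rw [X_inl_smul_pr]
      congr 3
      ring
    · funext c
      refine ext_pr fun a b => ?_
      rw [RingHom.id_apply, Pi.smul_apply, X_inr_smul_pr, delta12_apply, delta12_apply]
      refine finsum_congr fun i => ?_
      rw [X_inr_smul_pr]
      congr 3
      ring

theorem delta21_smul (p : MvPolynomial (Unit ⊕ Unit) ℂ) {f : Ser (Unit ⊕ Unit) W}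
    (hf : f ∈ truncIn W (.inl ())) : delta21 (p • f) = p • delta21 f := by
  refine map_smul_of_map_X (RingHom.id _) (truncIn W (.inl ())) delta21 ?_ ?_ ?_ p hf
  · intro f hf g hg
    ext c n
    rw [← pr_eta n, Pi.add_apply, Pi.add_apply, delta21_apply, delta21_apply, delta21_apply,
      ← finsum_add_distrib (delta21_support hf _ _ _) (delta21_support hg _ _ _)]
    simp only [Pi.add_apply, smul_add]
  · intro r f _
    ext c n
    rw [← pr_eta n, RingHom.id_apply, Pi.smul_apply, C_smul, C_smul, Pi.smul_apply, delta21_apply,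
      delta21_apply, smul_finsum]
    exact finsum_congr fun i => (smul_comm _ _ _).symm
  · rintro (⟨⟩ | ⟨⟩) f _
    · funext c
      refine ext_pr fun a b => ?_
      rw [RingHom.id_apply, Pi.smul_apply, X_inl_smul_pr, delta21_apply, delta21_apply]
      refine finsum_congr fun i => ?_
      rw [X_inl_smul_pr]
      congr 3
      ring
    · funext c
      refine ext_pr fun a b => ?_
      rw [RingHom.id_apply, Pi.smul_apply, X_inr_smul_pr, delta21_apply, delta21_apply]
      refine finsum_congr fun i => ?_
      rw [X_inr_smul_pr]
      congr 3
      ring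

/-- A sum over `i` with `i` shifted by one, used in the form of summation by parts. -/
theorem finsum_shift {M : Type*} [AddCommGroup M] (r s : ℕ → ℤ) (g : ℕ → M)
    (h0 : r 0 = s 0) (hs : ∀ i, r (i + 1) = s (i + 1) + s i)
    (hg : (Function.support g).Finite) :
    ∑ᶠ i, r i • g i = ∑ᶠ i, s i • g i + ∑ᶠ i, s i • g (i + 1) := by
  obtain ⟨B, hB⟩ : ∃ B : ℕ, ∀ i, B ≤ i → g i = 0 := by
    obtain ⟨B, hB⟩ := hg.bddAbove
    refine ⟨B + 1, fun i hi => ?_⟩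
    by_contra h
    have := hB h
    omega
  have hsum : ∀ (t : ℕ → ℤ) (e : ℕ), ∑ᶠ i, t i • g (i + e) =
      ∑ i ∈ Finset.range (B + 1), t i • g (i + e) := by
    intro t e
    refine finsum_eq_sum_of_support_subset _ fun i hi => ?_
    by_contra h
    rw [Finset.mem_coe, Finset.mem_range] at h
    exact hi (by simp only; rw [hB _ (by omega), smul_zero])
  have e1 := hsum r 0
  have e2 := hsum s 0
  simp only [add_zero] at e1 e2
  rw [e1, e2, hsum s 1, Finset.sum_range_succ', Finset.sum_range_succ' (fun i => s i • g i),
    Finset.sum_range_succ (fun i => s i • g (i + 1)), hB (B + 1) (by omega), smul_zero, add_zero, h0]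
  simp only [hs, add_smul, Finset.sum_add_distrib]
  abel

/-- `p(x₁, x₂) x₂⁻¹ δ((x₁ - x₀) / x₂) = p(x₂ + x₀, x₂) x₂⁻¹ δ((x₁ - x₀) / x₂)`. -/
theorem delta10_smul (p : MvPolynomial (Unit ⊕ Unit) ℂ) {f : Ser (Unit ⊕ Unit) W}
    (hf : f ∈ truncIn W (.inl ())) : delta10 (taylorPoly Unit p • f) = p • delta10 f := by
  have hadd : ∀ f ∈ truncIn W (.inl ()), ∀ g ∈ truncIn W (.inl ()),
      delta10 (f + g) = delta10 f + delta10 g := by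
    intro f hf g hg
    ext c n
    rw [← pr_eta n, Pi.add_apply, Pi.add_apply, delta10_apply, delta10_apply, delta10_apply,
      ← finsum_add_distrib (delta21_support hf _ _ _) (delta21_support hg _ _ _)]
    simp only [Pi.add_apply, smul_add]
  induction p using MvPolynomial.induction_on generalizing f with
  | C r =>
    ext c n
    rw [← algebraMap_eq, AlgHom.commutes, algebraMap_eq, ← pr_eta n, Pi.smul_apply, C_smul, C_smul,
      Pi.smul_apply, delta10_apply, delta10_apply, smul_finsum]
    exact finsum_congr fun i => (smul_comm _ _ _).symm
  | add p q hp hq =>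
    rw [map_add, add_smul, hadd _ (Submodule.smul_mem _ _ hf) _ (Submodule.smul_mem _ _ hf), hp hf,
      hq hf, add_smul]
  | mul_X p i hp =>
    rw [map_mul, mul_smul, hp (Submodule.smul_mem _ _ hf), mul_smul]
    congr 1
    rcases i with ⟨⟩ | ⟨⟩
    · rw [taylorPoly_X_inl, add_smul,
        hadd _ (Submodule.smul_mem _ _ hf) _ (Submodule.smul_mem _ _ hf)]
      funext c
      refine ext_pr fun a b => ?_
      rw [Pi.add_apply, Pi.add_apply, Pi.smul_apply, X_inl_smul_pr, delta10_apply, delta10_apply,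
        delta10_apply]
      have h := finsum_shift (fun i : ℕ => (-1 : ℤ) ^ i * Ring.choose (a - 1 + i) i)
        (fun i : ℕ => (-1 : ℤ) ^ i * Ring.choose (a + i) i)
        (fun i => f (pr (c - i) (b + (a - 1 + i) + 1))) (by simp) ?_ ?_
      · rw [h, add_comm]
        congr 1
        · refine finsum_congr fun i => ?_
          rw [X_inr_smul_pr]
          congr 3
          ring
        · refine finsum_congr fun i => ?_
          rw [X_inl_smul_pr]
          push_cast
          congr 3 <;> ring
      · intro i
        have h1 : a + ((i + 1 : ℕ) : ℤ) = (a + i) + 1 := by push_cast; ring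
        have h2 : a - 1 + ((i + 1 : ℕ) : ℤ) = a + i := by push_cast; ring
        simp only [h1, h2]
        rw [Ring.choose_succ_succ]
        ring
      · have := delta21_support hf (fun _ => 1) (fun i => b + (a - 1 + i) + 1) c
        simpa using this
    · rw [taylorPoly_X_inr]
      funext c
      refine ext_pr fun a b => ?_
      rw [Pi.smul_apply, X_inr_smul_pr, delta10_apply, delta10_apply]
      refine finsum_congr fun i => ?_
      rw [X_inr_smul_pr]
      congr 3
      ring

/-- Multiplication by `x₁ - x₂` acts on the three delta functions as multiplication by `x₀`. -/
theorem delta12_pred {f : Ser (Unit ⊕ Unit) W} (hf : f ∈ truncIn W (.inr ())) (c : ℤ) :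
    delta12 f (c - 1) = (X (.inl ()) - X (.inr ()) : MvPolynomial (Unit ⊕ Unit) ℂ) • delta12 f c := by
  refine ext_pr fun a b => ?_
  rw [sub_smul, Pi.sub_apply, X_inl_smul_pr, X_inr_smul_pr, delta12_apply, delta12_apply,
    delta12_apply]
  have h := finsum_shift (fun i : ℕ => Ring.choose (-(c - 1) - 1) i)
    (fun i : ℕ => Ring.choose (-c - 1) i)
    (fun i => (-1 : ℤ) ^ i • f (pr (a - (-(c - 1) - 1) + i) (b - i))) (by simp) ?_ ?_
  · simp only [smul_smul] at h
    simp only [mul_comm ((-1 : ℤ) ^ _)]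
    rw [h, sub_eq_add_neg (G := W), ← finsum_neg_distrib]
    refine congrArg₂ (fun x y : W => x + y) (finsum_congr fun i => ?_) (finsum_congr fun i => ?_)
    · congr 3
      ring
    · rw [pow_succ, mul_neg_one, mul_neg, neg_smul]
      push_cast
      congr 4 <;> ring
  · intro i
    rw [show -(c - 1) - 1 = (-c - 1) + 1 by ring]
    simp only [Ring.choose_succ_succ]
    ring
  · exact delta12_support hf _ _ _

theorem delta21_pred {f : Ser (Unit ⊕ Unit) W} (hf : f ∈ truncIn W (.inl ())) (c : ℤ) :
    delta21 f (c - 1) = (X (.inl ()) - X (.inr ()) : MvPolynomial (Unit ⊕ Unit) ℂ) • delta21 f c := by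
  refine ext_pr fun a b => ?_
  rw [sub_smul, Pi.sub_apply, X_inl_smul_pr, X_inr_smul_pr, delta21_apply, delta21_apply,
    delta21_apply]
  have h := finsum_shift (fun i : ℕ => Ring.choose (-(c - 1) - 1) i)
    (fun i : ℕ => Ring.choose (-c - 1) i)
    (fun i => ((Int.negOnePow (-(c - 1) - 1) : ℤ) * (-1 : ℤ) ^ i) •
      f (pr (a - i) (b - (-(c - 1) - 1) + i))) (by simp) ?_ ?_
  · have hsgn : (Int.negOnePow (-(c - 1) - 1) : ℤ) = - (Int.negOnePow (-c - 1) : ℤ) := by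
      rw [show -(c - 1) - 1 = (-c - 1) + 1 by ring, Int.negOnePow_succ]
      simp
    simp only [smul_smul] at h
    have e1 : ∀ (x y z : ℤ), x * (y * z) = z * (x * y) := fun x y z => by ring
    simp only [e1 (Int.negOnePow _ : ℤ)]
    rw [h, add_comm, sub_eq_add_neg (G := W), ← finsum_neg_distrib]
    refine congrArg₂ (fun x y : W => x + y) (finsum_congr fun i => ?_) (finsum_congr fun i => ?_)
    · rw [pow_succ, hsgn, mul_neg_one, neg_mul_neg]
      push_cast
      congr 3 <;> ring
    · rw [hsgn, neg_mul, mul_neg, neg_smul]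
      congr 4
      ring
  · intro i
    rw [show -(c - 1) - 1 = (-c - 1) + 1 by ring]
    simp only [Ring.choose_succ_succ]
    ring
  · exact delta21_support hf _ _ _

theorem delta10_pred {f : Ser (Unit ⊕ Unit) W} (hf : f ∈ truncIn W (.inl ())) (c : ℤ) :
    delta10 f (c - 1) = (X (.inl ()) - X (.inr ()) : MvPolynomial (Unit ⊕ Unit) ℂ) • delta10 f c := by
  have h := congrFun (delta10_smul (X (.inl ()) - X (.inr ())) hf) c
  rw [map_sub, taylorPoly_X_inl, taylorPoly_X_inr, add_sub_cancel_right] at h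
  refine Eq.trans (ext_pr fun a b => ?_) h
  rw [delta10_apply, delta10_apply]
  refine finsum_congr fun i => ?_
  rw [X_inl_smul_pr]
  congr 3
  ring

/-- The coefficient of `x₁⁻¹` of `x₂⁻¹ δ((x₁ - x₀) / x₂) f(x₀, x₂)` is `f`. -/
theorem delta10_neg_one (f : Ser (Unit ⊕ Unit) W) (c b : ℤ) :
    delta10 f c (pr (-1) b) = f (pr c b) := by
  rw [delta10_apply, finsum_eq_single _ 0]
  · simp
  · intro i hi
    obtain ⟨j, rfl⟩ := Nat.exists_eq_succ_of_ne_zero hi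
    have : (-1 : ℤ) + ((j + 1 : ℕ) : ℤ) = (j : ℕ) := by push_cast; ring
    rw [this, Ring.choose_natCast, Nat.choose_eq_zero_of_lt (Nat.lt_succ_self j)]
    simp

/-! ### The delta function identity -/

theorem choose_neg_eq (r : ℤ) (n : ℕ) :
    Ring.choose (-r) n = (-1) ^ n * Ring.choose (r + n - 1) n := by
  rw [Ring.choose_neg, Units.smul_def, Int.coe_negOnePow_natCast, smul_eq_mul]

/-- The identity of coefficients behind the delta function identity: the expansions of
`(x₁ - x₂) ^ n` in the two directions differ by a multiple of the delta function. -/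
theorem choose_sub_choose_eq_bin (D c : ℤ) :
    (if 0 ≤ D - c then (-1) ^ (D - c).toNat * Ring.choose (-c - 1) (D - c).toNat else 0) -
      (if 0 ≤ -D - 1 then (Int.negOnePow (-c - 1) : ℤ) *
        ((-1) ^ (-D - 1).toNat * Ring.choose (-c - 1) (-D - 1).toNat) else 0) = bin D c := by
  have hsq : ∀ i : ℕ, (-1 : ℤ) ^ i * (-1) ^ i = 1 := fun i => by
    rw [← mul_pow]; simp
  rcases le_or_gt 0 c with hc | hc
  · obtain ⟨C, rfl⟩ := Int.eq_ofNat_of_zero_le hc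
    have hch : ∀ i : ℕ, (-1 : ℤ) ^ i * Ring.choose (-(C : ℤ) - 1) i = (C + i).choose C := by
      intro i
      rw [show -(C : ℤ) - 1 = -((C : ℤ) + 1) by ring, choose_neg_eq, ← mul_assoc, hsq, one_mul,
        show (C : ℤ) + 1 + i - 1 = ((C + i : ℕ) : ℤ) by push_cast; ring, Ring.choose_natCast,
        Nat.choose_symm_add]
    have hsgn : (Int.negOnePow (-(C : ℤ) - 1) : ℤ) = -(-1) ^ C := by
      rw [show -(C : ℤ) - 1 = -((C : ℤ) + 1) by ring, Int.negOnePow_neg, Int.negOnePow_succ]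
      simp [Int.coe_negOnePow_natCast]
    rw [hch, hch, hsgn, bin_natCast]
    rcases lt_or_ge D 0 with hD | hD
    · rw [if_neg (by omega), if_pos (by omega)]
      obtain ⟨i, rfl⟩ : ∃ i : ℕ, D = -(i + 1) := ⟨(-D - 1).toNat, by omega⟩
      rw [show (-(-((i : ℤ) + 1)) - 1).toNat = i by omega, choose_neg_eq,
        show (i : ℤ) + 1 + C - 1 = ((C + i : ℕ) : ℤ) by push_cast; ring, Ring.choose_natCast]
      simp
    · obtain ⟨D, rfl⟩ := Int.eq_ofNat_of_zero_le hD
      rw [if_neg (show ¬ (0 ≤ -(D : ℤ) - 1) by omega), Ring.choose_natCast, sub_zero]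
      split_ifs with h
      · rw [show C + ((D : ℤ) - C).toNat = D by omega]
      · rw [Nat.choose_eq_zero_of_lt (by omega)]
        rfl
  · rw [bin_of_neg _ hc]
    obtain ⟨E, rfl⟩ : ∃ E : ℕ, c = -E - 1 := ⟨(-c - 1).toNat, by omega⟩
    rw [show -(-(E : ℤ) - 1) - 1 = E by ring, Ring.choose_natCast, Ring.choose_natCast,
      Int.coe_negOnePow_natCast, sub_eq_zero]
    split_ifs with h1 h2 h2
    · obtain ⟨i, hi⟩ := Int.eq_ofNat_of_zero_le h1
      obtain ⟨j, hj⟩ := Int.eq_ofNat_of_zero_le h2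
      have hE : E = i + j := by omega
      have ei : (D - (-(E : ℤ) - 1)).toNat = i := by omega
      have ej : (-D - 1).toNat = j := by omega
      rw [ei, ej, hE, Nat.choose_symm_add, pow_add, ← mul_assoc, mul_assoc ((-1) ^ i), hsq, mul_one]
    · rw [Nat.choose_eq_zero_of_lt (by omega)]
      simp
    · rw [Nat.choose_eq_zero_of_lt (by omega)]
      simp
    · rfl

/-- The convolution of the coefficients of `(1 + x) ^ (-m - 1)` and `(1 + x) ^ a`. -/
theorem finsum_choose_mul_bin (a m c : ℤ) :
    ∑ᶠ i : ℕ, ((-1) ^ i * Ring.choose (m + i) i) * bin a (c - i) = bin (a - m - 1) c := by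
  have h1 : ∀ i : ℕ, (-1 : ℤ) ^ i * Ring.choose (m + i) i = Ring.choose (-(m + 1)) i := by
    intro i
    rw [choose_neg_eq, show m + 1 + i - 1 = m + i by ring]
  simp only [h1]
  rcases lt_or_ge c 0 with hc | hc
  · rw [bin_of_neg _ hc]
    exact finsum_eq_zero_of_forall_eq_zero fun i => by rw [bin_of_neg _ (by omega), mul_zero]
  · obtain ⟨C, rfl⟩ := Int.eq_ofNat_of_zero_le hc
    rw [bin_natCast, show a - m - 1 = -(m + 1) + a by ring,
      Ring.add_choose_eq C (Commute.all _ _), Finset.Nat.sum_antidiagonal_eq_sum_range_succ_mk,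
      finsum_eq_sum_of_support_subset (s := Finset.range C.succ)]
    · refine Finset.sum_congr rfl fun i hi => ?_
      have hi' : i < C + 1 := Finset.mem_range.mp hi
      rw [show (C : ℤ) - i = ((C - i : ℕ) : ℤ) by omega, bin_natCast]
    · intro i hi
      rw [Finset.mem_coe, Finset.mem_range]
      by_contra h
      exact hi (by simp only; rw [bin_of_neg _ (by omega), mul_zero])

/-- The delta function identity
`x₀⁻¹ δ((x₁ - x₂) / x₀) f - x₀⁻¹ δ((x₂ - x₁) / (-x₀)) f = x₂⁻¹ δ((x₁ - x₀) / x₂) f(x₂ + x₀, x₂)`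
for series `f(x₁, x₂)` with powers bounded below. -/
theorem delta12_sub_delta21 {f : Ser (Unit ⊕ Unit) W} (hf : f ∈ trunc (Unit ⊕ Unit) W) :
    delta12 f - delta21 f = delta10 (taylor f) := by
  funext c
  refine ext_pr fun m b => ?_
  set d : ℤ := c + m + b + 1 with hd
  set g : ℤ → W := fun a => f (pr a (d - a)) with hg
  have hfin : {a | g a ≠ 0}.Finite := by
    refine ((trunc_le_finDeg_pairDeg hf fun _ => d).image fun n => n (.inl ())).subset fun a ha =>
      ⟨pr a (d - a), ⟨?_, ha⟩, rfl⟩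
    funext t
    simp [pairDeg_apply]
  have h1 : delta12 f c (pr m b) = ∑ᶠ a, (if 0 ≤ (a - m - 1) - c then (-1 : ℤ) ^
      ((a - m - 1) - c).toNat * Ring.choose (-c - 1) ((a - m - 1) - c).toNat else 0) • g a := by
    have hinj : Function.Injective fun i : ℕ => m - (-c - 1) + (i : ℤ) := fun i j h => by
      simpa using h
    rw [delta12_apply, finsum_eq_finsum_comp hinj]
    · refine finsum_congr fun i => ?_
      have e : m - (-c - 1) + (i : ℤ) - m - 1 - c = i := by ring
      simp only [e, hg]
      rw [if_pos (by omega), Int.toNat_natCast, show d - (m - (-c - 1) + (i : ℤ)) = b - i by omega]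
    · intro a ha
      by_contra h
      refine ha ?_
      rw [if_neg, zero_smul]
      intro h'
      exact h ⟨(a - m - 1 - c).toNat, by simp only; omega⟩
  have h2 : delta21 f c (pr m b) = ∑ᶠ a, (if 0 ≤ -(a - m - 1) - 1 then
      (Int.negOnePow (-c - 1) : ℤ) * ((-1) ^ (-(a - m - 1) - 1).toNat *
        Ring.choose (-c - 1) (-(a - m - 1) - 1).toNat) else 0) • g a := by
    have hinj : Function.Injective fun i : ℕ => m - (i : ℤ) := fun i j h => by
      simpa using h
    rw [delta21_apply, finsum_eq_finsum_comp hinj]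
    · refine finsum_congr fun i => ?_
      have e : -(m - (i : ℤ) - m - 1) - 1 = i := by ring
      simp only [e, hg]
      rw [if_pos (by omega), Int.toNat_natCast, show d - (m - (i : ℤ)) = b - (-c - 1) + i by omega]
    · intro a ha
      by_contra h
      refine ha ?_
      rw [if_neg, zero_smul]
      intro h'
      exact h ⟨(-(a - m - 1) - 1).toNat, by simp only; omega⟩
  have h3 : delta10 (taylor f) c (pr m b) = ∑ᶠ a, bin (a - m - 1) c • g a := by
    have e1 : delta10 (taylor f) c (pr m b) =
        kerSum (fun (_ : Unit) (i : ℕ) => (-1 : ℤ) ^ i * Ring.choose (m + i) i)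
          (kerSum (fun (i : ℕ) (a : ℤ) => bin a (c - i)) g) () := by
      rw [delta10_apply]
      refine finsum_congr fun i => ?_
      rw [taylor_pr]
      congr 1
      refine finsum_congr fun a => ?_
      rw [show c - (i : ℤ) + (b + (m + i) + 1) - a = d - a by omega]
    have hbin : ∀ {a : ℤ} {i : ℕ}, bin a (c - i) ≠ 0 → i ≤ c.toNat := by
      intro a i h
      by_contra hlt
      exact h (bin_of_neg _ (by omega))
    rw [e1, kerSum_kerSum]
    · exact finsum_congr fun a => by rw [finsum_choose_mul_bin]
    · exact ((Set.finite_Iic c.toNat).prod hfin).subset fun x hx => ⟨hbin hx.2.1, hx.2.2⟩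
    · exact fun a => (Set.finite_Iic c.toNat).subset fun i hi => hbin hi.2
  have hs : ∀ r : ℤ → ℤ, (Function.support fun a => r a • g a).Finite := fun r =>
    hfin.subset fun a ha => fun h0 => ha (by simp [h0])
  rw [Pi.sub_apply, Pi.sub_apply, h1, h2, h3, ← finsum_sub_distrib (hs _) (hs _)]
  refine finsum_congr fun a => ?_
  rw [← sub_smul, choose_sub_choose_eq_bin]

end Ser

open Ser

/-! ### Products and iterates of vertex operators -/

section Iterate

variable {V W : Type*} [AddCommGroup V] [Module ℂ V] [AddCommGroup W] [Module ℂ W]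

theorem exists_coeff_eq_zero (a : VertexOperator ℂ W) (w : W) :
    ∃ B : ℤ, ∀ n, n < B → HVertexOperator.coeff a n w = 0 :=
  ⟨_, fun n hn => VertexOperator.coeff_eq_zero_of_lt_order a n w hn⟩

/-- The series `a(x₁) b(x₂) w`. -/
def cor12 (a b : VertexOperator ℂ W) (w : W) : Ser (Unit ⊕ Unit) W := toSer (prod12 a b w)

/-- The series `b(x₂) a(x₁) w`. -/
def cor21 (a b : VertexOperator ℂ W) (w : W) : Ser (Unit ⊕ Unit) W := toSer (prod21 a b w)

/-- The series `Y_W(Y(u, x₀) v, x₂) w`, where the first variable stands for `x₀`. -/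
def iter (A : VertexData V) (YW : V →ₗ[ℂ] VertexOperator ℂ W) (u v : V) (w : W) :
    Ser (Unit ⊕ Unit) W :=
  toSer fun c b => HVertexOperator.coeff (YW (HVertexOperator.coeff (A.Y u) c v)) b w

theorem cor12_pr (a b : VertexOperator ℂ W) (w : W) (m n : ℤ) : cor12 a b w (pr m n) =
    HVertexOperator.coeff a m (HVertexOperator.coeff b n w) := rfl

theorem cor21_pr (a b : VertexOperator ℂ W) (w : W) (m n : ℤ) : cor21 a b w (pr m n) =
    HVertexOperator.coeff b n (HVertexOperator.coeff a m w) := rfl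

theorem iter_pr (A : VertexData V) (YW : V →ₗ[ℂ] VertexOperator ℂ W) (u v : V) (w : W)
    (c b : ℤ) : iter A YW u v w (pr c b) =
      HVertexOperator.coeff (YW (HVertexOperator.coeff (A.Y u) c v)) b w := rfl

theorem cor12_mem_truncIn (a b : VertexOperator ℂ W) (w : W) :
    cor12 a b w ∈ truncIn W (.inr ()) := by
  obtain ⟨B, hB⟩ := exists_coeff_eq_zero b w
  refine ⟨B, fun n hn => ?_⟩
  rw [← pr_eta n, cor12_pr, hB _ hn, map_zero]

theorem cor21_mem_truncIn (a b : VertexOperator ℂ W) (w : W) :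
    cor21 a b w ∈ truncIn W (.inl ()) := by
  obtain ⟨B, hB⟩ := exists_coeff_eq_zero a w
  refine ⟨B, fun n hn => ?_⟩
  rw [← pr_eta n, cor21_pr, hB _ hn, map_zero]

variable {A : VertexData V} {YW : V →ₗ[ℂ] VertexOperator ℂ W} {u v : V} {w : W}

theorem iter_mem_truncIn : iter A YW u v w ∈ truncIn W (.inl ()) := by
  obtain ⟨B, hB⟩ := exists_coeff_eq_zero (A.Y u) v
  refine ⟨B, fun n hn => ?_⟩
  rw [← pr_eta n, iter_pr, hB _ hn, map_zero, map_zero]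
  rfl

theorem iter_trunc (A : VertexData V) (YW : V →ₗ[ℂ] VertexOperator ℂ W) (u v : V) (w : W)
    (a : ℤ) : ∃ B : ℤ, ∀ b, b < B → iter A YW u v w (pr a b) = 0 := by
  simp only [iter_pr]
  exact exists_coeff_eq_zero _ w

/-- If the powers of `x₂` in `f` and those of `x₁` in `g` are bounded below and `p f = p g`, then all
powers in this series are bounded below. -/
theorem mem_trunc_of_smul_eq {p : MvPolynomial (Unit ⊕ Unit) ℂ} {f g : Ser (Unit ⊕ Unit) W}
    (hf : f ∈ truncIn W (.inr ())) (hg : g ∈ truncIn W (.inl ())) (h : p • f = p • g) :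
    p • f ∈ trunc (Unit ⊕ Unit) W := by
  rw [mem_trunc]
  rintro (⟨⟩ | ⟨⟩)
  · rw [h]
    exact Submodule.smul_mem _ _ hg
  · exact Submodule.smul_mem _ _ hf

theorem toSer_jacobiLeft (YW : V →ₗ[ℂ] VertexOperator ℂ W) (u v : V) (w : W) (c : ℤ) :
    toSer (jacobiLeft YW u v w c) =
      delta12 (cor12 (YW u) (YW v) w) c - delta21 (cor21 (YW u) (YW v) w) c := rfl

theorem toSer_jacobiRight (A : VertexData V) (YW : V →ₗ[ℂ] VertexOperator ℂ W) (u v : V) (w : W)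
    (c : ℤ) : toSer (jacobiRight A YW u v w c) = delta10 (iter A YW u v w) c := rfl

/-- Locality and the Jacobi identity up to polynomial factors imply associativity up to a
polynomial factor: `q(x₁, x₂) Y_W(u, x₁) Y_W(v, x₂) w` becomes
`q(x₂ + x₀, x₂) Y_W(Y(u, x₀) v, x₂) w` under the substitution `x₁ = x₂ + x₀`. -/
theorem taylor_eq_of_quasiJacobi {p q : MvPolynomial (Unit ⊕ Unit) ℂ} (hp : p ≠ 0)
    (hJ : ∀ c, p • toSer (jacobiLeft YW u v w c) = p • toSer (jacobiRight A YW u v w c))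
    (hq : q • cor12 (YW u) (YW v) w = q • cor21 (YW u) (YW v) w) :
    taylor (q • cor12 (YW u) (YW v) w) = taylorPoly Unit q • iter A YW u v w := by
  have hH := mem_trunc_of_smul_eq (cor12_mem_truncIn _ _ _) (cor21_mem_truncIn _ _ _) hq
  set H := q • cor12 (YW u) (YW v) w with hHdef
  have hT : taylor H ∈ truncIn W (.inl ()) := ⟨0, fun n hn => taylor_eq_zero_of_neg _ hn⟩
  have h1 : p • delta10 (taylor H) = p • delta10 (taylorPoly Unit q • iter A YW u v w) := by
    rw [delta10_smul _ iter_mem_truncIn, ← delta12_sub_delta21 hH]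
    nth_rw 2 [hq]
    rw [hHdef, delta12_smul _ (cor12_mem_truncIn _ _ _), delta21_smul _ (cor21_mem_truncIn _ _ _),
      ← smul_sub, smul_comm p q, smul_comm p q]
    congr 1
    funext c
    exact hJ c
  rw [← delta10_smul _ hT, ← delta10_smul _ (Submodule.smul_mem _ _ iter_mem_truncIn)] at h1
  have h2 : taylorPoly Unit p • taylor H = taylorPoly Unit p • taylorPoly Unit q • iter A YW u v w :=
    ext_pr fun c b => by
      have h2 := congrFun (congrFun h1 c) (pr (-1) b)
      rwa [delta10_neg_one, delta10_neg_one] at h2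
  rw [← sub_eq_zero, ← smul_sub] at h2
  refine sub_eq_zero.mp (eq_zero_of_smul_eq_zero ?_ (Submodule.sub_mem _ hT
    (Submodule.smul_mem _ _ iter_mem_truncIn)) (fun a => ?_) h2)
  · rw [Ne, map_eq_zero_iff _ taylorPoly_injective]
    exact hp
  · have h3 : ∃ B : ℤ, ∀ b, b < B → taylor H (pr a b) = 0 := by
      obtain ⟨B, hB⟩ := exists_bound_of_mem_trunc hH
      refine ⟨2 * B - a, fun b hb => ?_⟩
      rw [taylor_pr]
      refine finsum_eq_zero_of_forall_eq_zero fun i => ?_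
      by_contra h
      have h0 : H (pr i (a + b - i)) ≠ 0 := fun h0 => h (by rw [h0, smul_zero])
      have e1 := hB _ h0 (.inl ())
      have e2 := hB _ h0 (.inr ())
      simp only [pr_inl, pr_inr] at e1 e2
      omega
    have h4 : ∃ B : ℤ, ∀ b, b < B → (taylorPoly Unit q • iter A YW u v w) (pr a b) = 0 := by
      obtain ⟨Ba, hBa⟩ := iter_mem_truncIn (A := A) (YW := YW) (u := u) (v := v) (w := w)
      choose B hB using iter_trunc A YW u v w
      obtain ⟨M, hM⟩ : ∃ M : ℤ, ∀ i, Ba ≤ i → i ≤ a → M ≤ B i := by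
        obtain ⟨M, hM⟩ := ((Set.finite_Icc Ba a).image B).bddBelow
        exact ⟨M, fun i h1 h2 => hM ⟨i, ⟨h1, h2⟩, rfl⟩⟩
      refine ⟨M, fun b hb => ?_⟩
      by_contra h
      obtain ⟨m, -, hm⟩ := exists_of_smul_apply_ne_zero h
      rw [← pr_eta (pr a b - expo m)] at hm
      simp only [Pi.sub_apply, pr_inl, pr_inr, expo_apply] at hm
      refine hm (hB _ _ ?_)
      have := hM (a - m (.inl ())) (by
        by_contra hlt
        exact hm (hBa _ (by rw [pr_inl]; omega))) (by omega)
      omega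
    obtain ⟨B, hB⟩ := h3
    obtain ⟨B', hB'⟩ := h4
    refine ⟨min B B', fun b hb => ?_⟩
    rw [Pi.sub_apply, hB b (hb.trans_le (min_le_left _ _)),
      hB' b (hb.trans_le (min_le_right _ _)), sub_zero]

/-- Locality and associativity up to a polynomial factor imply the Jacobi identity up to the same
factor. -/
theorem quasiJacobi_of_taylor_eq {q : MvPolynomial (Unit ⊕ Unit) ℂ}
    (hq : q • cor12 (YW u) (YW v) w = q • cor21 (YW u) (YW v) w)
    (hT : taylor (q • cor12 (YW u) (YW v) w) = taylorPoly Unit q • iter A YW u v w) (c : ℤ) :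
    q • toSer (jacobiLeft YW u v w c) = q • toSer (jacobiRight A YW u v w c) := by
  have hH := mem_trunc_of_smul_eq (cor12_mem_truncIn _ _ _) (cor21_mem_truncIn _ _ _) hq
  have h1 := delta12_sub_delta21 hH
  rw [hT, delta10_smul _ iter_mem_truncIn] at h1
  nth_rw 2 [hq] at h1
  rw [delta12_smul _ (cor12_mem_truncIn _ _ _), delta21_smul _ (cor21_mem_truncIn _ _ _),
    ← smul_sub] at h1
  exact congrFun h1 c

/-- The pair `u`, `v` is local and associative up to the polynomial factor `q`. -/
def IsIterateWith (A : VertexData V) (YW : V →ₗ[ℂ] VertexOperator ℂ W) (u v : V)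
    (q : MvPolynomial (Unit ⊕ Unit) ℂ) : Prop :=
  ∀ w, q • cor12 (YW u) (YW v) w = q • cor21 (YW u) (YW v) w ∧
    taylor (q • cor12 (YW u) (YW v) w) = taylorPoly Unit q • iter A YW u v w

theorem IsIterateWith.mul {q : MvPolynomial (Unit ⊕ Unit) ℂ} (h : IsIterateWith A YW u v q)
    (r : MvPolynomial (Unit ⊕ Unit) ℂ) : IsIterateWith A YW u v (r * q) := by
  intro w
  obtain ⟨h1, h2⟩ := h w
  have hH := mem_trunc_of_smul_eq (cor12_mem_truncIn _ _ _) (cor21_mem_truncIn _ _ _) h1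
  exact ⟨by rw [mul_smul, mul_smul, h1], by
    rw [mul_smul, taylor_smul _ (trunc_le_finDeg_pairDeg hH), h2, map_mul, mul_smul]⟩

/-- The names of the variables `x₁`, `x₂`, as an equivalence. -/
def vars2Equiv : Fin 2 ≃ Unit ⊕ Unit := Equiv.ofBijective vars2 vars2_bijective

theorem exists_rename_vars2 (q : MvPolynomial (Unit ⊕ Unit) ℂ) :
    ∃ p : MvPolynomial (Fin 2) ℂ, rename vars2 p = q :=
  ⟨rename vars2Equiv.symm q, by
    rw [rename_rename]
    have : vars2 ∘ vars2Equiv.symm = id := funext vars2Equiv.apply_symm_apply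
    rw [this, rename_id_apply]⟩

theorem IsIterateWith.quasiJacobi {q : MvPolynomial (Unit ⊕ Unit) ℂ}
    (h : IsIterateWith A YW u v q) (hq : q ≠ 0) : ∃ p : MvPolynomial (Fin 2) ℂ, p ≠ 0 ∧ ∀ w : W,
      polyMul3 p (jacobiLeft YW u v w) = polyMul3 p (jacobiRight A YW u v w) := by
  obtain ⟨p, rfl⟩ := exists_rename_vars2 q
  refine ⟨p, fun h0 => hq (by rw [h0, map_zero]), fun w => ?_⟩
  rw [polyMul3_eq_iff]
  exact quasiJacobi_of_taylor_eq (h w).1 (h w).2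

theorem rename_vars2_ne_zero {p : MvPolynomial (Fin 2) ℂ} (hp : p ≠ 0) : rename vars2 p ≠ 0 := by
  rwa [Ne, map_eq_zero_iff _ (rename_injective _ vars2_bijective.injective)]

theorem isIterateWith_of_quasiJacobi {q : MvPolynomial (Unit ⊕ Unit) ℂ}
    {p : MvPolynomial (Fin 2) ℂ} (hp : p ≠ 0)
    (hJ : ∀ w, polyMul3 p (jacobiLeft YW u v w) = polyMul3 p (jacobiRight A YW u v w))
    (hq : ∀ w, q • cor12 (YW u) (YW v) w = q • cor21 (YW u) (YW v) w) :
    IsIterateWith A YW u v q :=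
  fun w => ⟨hq w, taylor_eq_of_quasiJacobi (rename_vars2_ne_zero hp)
    ((polyMul3_eq_iff p _ _).mp (hJ w)) (hq w)⟩

/-- The polynomial `x₁ - α x₂`. -/
def linPoly (α : ℂ) : MvPolynomial (Unit ⊕ Unit) ℂ := X (.inl ()) - C α * X (.inr ())

theorem linPoly_one : linPoly 1 = X (.inl ()) - X (.inr ()) := by
  simp [linPoly]

theorem linPoly_ne_zero (α : ℂ) : linPoly α ≠ 0 := by
  intro h
  have := congrArg (eval (Sum.elim (fun _ => 1) (fun _ => 0))) h
  simp [linPoly] at this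

/-- Locality and associativity up to a power of `x₁ - x₂` imply the Jacobi identity. -/
theorem jacobi_of_isIterateWith {k : ℕ} (h : IsIterateWith A YW u v (linPoly 1 ^ k)) (w : W) :
    jacobiLeft YW u v w = jacobiRight A YW u v w := by
  obtain ⟨h1, h2⟩ := h w
  have hF := cor12_mem_truncIn (YW u) (YW v) w
  have hG := cor21_mem_truncIn (YW u) (YW v) w
  have hK := iter_mem_truncIn (A := A) (YW := YW) (u := u) (v := v) (w := w)
  have hsub : ∀ (k : ℕ) (c : ℤ),
      toSer (jacobiLeft YW u v w (c - k)) - toSer (jacobiRight A YW u v w (c - k)) =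
      linPoly 1 ^ k • (toSer (jacobiLeft YW u v w c) - toSer (jacobiRight A YW u v w c)) := by
    intro k c
    induction k with
    | zero => simp
    | succ k ih =>
      rw [pow_succ', mul_smul, ← ih, Nat.cast_succ, ← sub_sub, toSer_jacobiLeft, toSer_jacobiRight,
        toSer_jacobiLeft, toSer_jacobiRight, delta12_pred hF, delta21_pred hG, delta10_pred hK,
        linPoly_one, smul_sub, smul_sub]
  funext c
  refine toSer_injective (sub_eq_zero.mp ?_)
  have h3 := hsub k (c + k)
  rw [add_sub_cancel_right, smul_sub, quasiJacobi_of_taylor_eq h1 h2, sub_self] at h3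
  exact h3

theorem delta12_neg_one (f : Ser (Unit ⊕ Unit) W) : delta12 f (-1) = f := by
  refine ext_pr fun a b => ?_
  rw [delta12_apply, finsum_eq_single _ 0]
  · simp
  · intro i hi
    simp [Ring.choose_zero_pos ℤ (Nat.pos_of_ne_zero hi)]

theorem delta21_neg_one (f : Ser (Unit ⊕ Unit) W) : delta21 f (-1) = f := by
  refine ext_pr fun a b => ?_
  rw [delta21_apply, finsum_eq_single _ 0]
  · simp
  · intro i hi
    simp [Ring.choose_zero_pos ℤ (Nat.pos_of_ne_zero hi)]

/-- The Jacobi identity implies locality: the coefficient of `x₀ ^ (-k - 1)`. -/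
theorem local_of_jacobi {k : ℕ} (hk : ∀ c : ℤ, c < -k → HVertexOperator.coeff (A.Y u) c v = 0)
    (hJ : jacobiLeft YW u v w = jacobiRight A YW u v w) :
    linPoly 1 ^ k • cor12 (YW u) (YW v) w = linPoly 1 ^ k • cor21 (YW u) (YW v) w := by
  have hF := cor12_mem_truncIn (YW u) (YW v) w
  have hG := cor21_mem_truncIn (YW u) (YW v) w
  have h12 : ∀ k : ℕ, delta12 (cor12 (YW u) (YW v) w) (-1 - k) =
      linPoly 1 ^ k • cor12 (YW u) (YW v) w := by
    intro k
    induction k with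
    | zero => simp [delta12_neg_one]
    | succ k ih => rw [pow_succ', mul_smul, ← ih, Nat.cast_succ, ← sub_sub, delta12_pred hF,
        linPoly_one]
  have h21 : ∀ k : ℕ, delta21 (cor21 (YW u) (YW v) w) (-1 - k) =
      linPoly 1 ^ k • cor21 (YW u) (YW v) w := by
    intro k
    induction k with
    | zero => simp [delta21_neg_one]
    | succ k ih => rw [pow_succ', mul_smul, ← ih, Nat.cast_succ, ← sub_sub, delta21_pred hG,
        linPoly_one]
  have h10 : delta10 (iter A YW u v w) (-1 - k) = 0 := by
    refine ext_pr fun a b => ?_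
    rw [delta10_apply]
    refine finsum_eq_zero_of_forall_eq_zero fun i => ?_
    rw [iter_pr, hk _ (by omega), map_zero, map_zero]
    simp
  have h := congrArg toSer (congrFun hJ (-1 - k))
  rw [toSer_jacobiLeft, toSer_jacobiRight, h12, h21, h10, sub_eq_zero] at h
  exact h

theorem exists_isIterateWith_of_jacobi (u v : V)
    (hJ : ∀ w, jacobiLeft YW u v w = jacobiRight A YW u v w) :
    ∃ k : ℕ, IsIterateWith A YW u v (linPoly 1 ^ k) := by
  obtain ⟨B, hB⟩ := exists_coeff_eq_zero (A.Y u) v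
  refine ⟨(-B).toNat, isIterateWith_of_quasiJacobi (p := 1) one_ne_zero (fun w => by rw [hJ w])
    fun w => local_of_jacobi (fun c hc => hB c (by omega)) (hJ w)⟩

/-- If `(x₁ - x₂) f = (x₁ - x₂) g` vanishes at `x₁ = x₂`, where the powers of `x₂` in `f` and those
of `x₁` in `g` are bounded below, then `f = g`: on each antidiagonal, the difference is constant, and
the sum of the coefficients of the product telescopes to a coefficient of `f` at which `g`
vanishes. -/
theorem eq_of_linPoly_one_smul_eq {f g : Ser (Unit ⊕ Unit) W} (hf : f ∈ truncIn W (.inr ()))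
    (hg : g ∈ truncIn W (.inl ())) (h : linPoly 1 • f = linPoly 1 • g)
    (h0 : ∀ b, taylor (linPoly 1 • f) (pr 0 b) = 0) : f = g := by
  have hd : ∀ (f : Ser (Unit ⊕ Unit) W) a b,
      (linPoly 1 • f) (pr a b) = f (pr (a - 1) b) - f (pr a (b - 1)) := by
    intro f a b
    rw [linPoly_one, sub_smul, Pi.sub_apply, X_inl_smul_pr, X_inr_smul_pr]
  obtain ⟨B1, hB1⟩ := hf
  obtain ⟨B0, hB0⟩ := hg
  refine ext_pr fun a b => ?_
  set d := a + b with hdd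
  set φ : ℤ → W := fun i => f (pr i (d - i)) with hφ
  set γ : ℤ → W := fun i => g (pr i (d - i)) with hγ
  have hstep : ∀ i, (linPoly 1 • f) (pr i (d + 1 - i)) = φ (i - 1) - φ i := by
    intro i
    rw [hd, show d + 1 - i = d - (i - 1) by ring, show d - (i - 1) - 1 = d - i by ring]
  have hstep' : ∀ i, (linPoly 1 • f) (pr i (d + 1 - i)) = γ (i - 1) - γ i := by
    intro i
    rw [h, hd, show d + 1 - i = d - (i - 1) by ring, show d - (i - 1) - 1 = d - i by ring]
  have hφ0 : ∀ i, d - B1 < i → φ i = 0 := fun i hi => hB1 _ (by rw [pr_inr]; omega)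
  have hγ0 : ∀ i, i < B0 → γ i = 0 := fun i hi => hB0 _ (by rw [pr_inl]; omega)
  have hinj : Function.Injective fun i : ℕ => B0 + (i : ℤ) := fun i j h => by simpa using h
  have hsum : φ (B0 - 1) = 0 := by
    have h1 := h0 (d + 1)
    simp only [taylor_pr, zero_add, bin_zero_right, one_smul] at h1
    rw [finsum_eq_finsum_comp hinj, finsum_eq_sum_of_support_subset
      (s := Finset.range (d - B1 - B0 + 2).toNat)] at h1
    · have h2 : ∀ i : ℕ, (linPoly 1 • f) (pr (B0 + (i : ℤ)) (d + 1 - (B0 + (i : ℤ)))) =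
          φ (B0 + (i : ℤ) - 1) - φ (B0 + ((i + 1 : ℕ) : ℤ) - 1) := by
        intro i
        rw [hstep]
        push_cast
        congr 2
        ring
      simp only [h2] at h1
      rw [Finset.sum_range_sub' (fun i : ℕ => φ (B0 + (i : ℤ) - 1)), hφ0 (B0 + ((d - B1 - B0 + 2).toNat : ℤ) - 1) (by omega), sub_zero] at h1
      simpa using h1
    · intro i hi
      rw [Finset.mem_coe, Finset.mem_range]
      by_contra hlt
      refine hi ?_
      simp only
      rw [hstep, hφ0 _ (by omega), hφ0 _ (by omega), sub_zero]
    · intro i hi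
      by_contra hlt
      refine hi ?_
      rw [hstep', hγ0 _ ?_, hγ0 _ ?_, sub_zero]
      all_goals
        by_contra hge
        exact hlt ⟨(i - B0).toNat, by simp only; omega⟩
  have hconst : ∀ i, φ i - γ i = φ (i - 1) - γ (i - 1) := by
    intro i
    have := (hstep i).symm.trans (hstep' i)
    rw [sub_eq_sub_iff_add_eq_add] at this ⊢
    rw [add_comm, ← this, add_comm]
  have hall : ∀ i, φ i - γ i = 0 := by
    have hbase : φ (B0 - 1) - γ (B0 - 1) = 0 := by rw [hsum, hγ0 _ (by omega), sub_zero]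
    intro i
    refine Int.inductionOn' i (B0 - 1) hbase (fun k _ ih => ?_) fun k _ ih => ?_
    · rw [hconst, add_sub_cancel_right, ih]
    · rw [← hconst, ih]
  have := sub_eq_zero.mp (hall a)
  simpa [hφ, hγ, hdd] using this

end Iterate

/-! ### Grading operators and single-position tensors -/

namespace GradedVertexAlgebra

variable {V : Type*} [AddCommGroup V] [Module ℂ V] (A : GradedVertexAlgebra V)

theorem powL0_coeff (c : ℂˣ) (n : ℤ) (u v : V) :
    A.powL0 c (HVertexOperator.coeff (A.Y u) n v) =
      ((c ^ n : ℂˣ) : ℂ) • HVertexOperator.coeff (A.Y (A.powL0 c u)) n (A.powL0 c v) := by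
  have htop := A.isInternal.submodule_iSup_eq_top
  have hu : u ∈ ⨆ i, A.grading i := htop ▸ Submodule.mem_top
  have hv : v ∈ ⨆ i, A.grading i := htop ▸ Submodule.mem_top
  induction hu using Submodule.iSup_induction' with
  | zero => simp
  | add x y _ _ hx hy => simp only [map_add, Pi.add_apply, LinearMap.add_apply, hx, hy, smul_add]
  | mem m u hu =>
    induction hv using Submodule.iSup_induction' with
    | zero => simp
    | add x y _ _ hx hy => simp only [map_add, hx, hy, smul_add]
    | mem p v hv =>
      have h := A.mode_mem m p (-n - 1) u v hu hv
      have h' : HVertexOperator.coeff (A.Y u) n v ∈ A.grading (m + p + n) := by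
        rw [VertexOperator.ncoeff_apply] at h
        convert h using 3 <;> ring
      rw [A.powL0_of_mem c h', A.powL0_of_mem c hu, A.powL0_of_mem c hv]
      simp only [map_smul, Pi.smul_apply, LinearMap.smul_apply, smul_smul,
        ← Units.val_mul, ← zpow_add]
      congr 3
      ring

theorem powL0_inv_apply (c : ℂˣ) (v : V) : A.powL0 c (A.powL0 c⁻¹ v) = v := by
  rw [← Module.End.mul_apply, ← powL0_mul, mul_inv_cancel, powL0_one, Module.End.one_apply]

/-- The vacuum vector has degree `0`. -/
theorem powL0_vac (c : ℂˣ) : A.powL0 c A.vac = A.vac := by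
  have h := A.powL0_coeff c 0 A.vac (A.powL0 c⁻¹ A.vac)
  rw [powL0_inv_apply, A.isVertexAlgebra.creation_zero, A.isVertexAlgebra.vacuum] at h
  simpa [powL0_inv_apply] using h.symm

variable {N : ℕ}

/-- The vector with `v` in position `i` and the vacuum in all other positions. -/
def atPos (i : Fin N) : V →ₗ[ℂ] ⨂[ℂ] _ : Fin N, V :=
  (PiTensorProduct.tprod ℂ).toLinearMap (fun _ : Fin N => A.vac) i

theorem atPos_apply (i : Fin N) (u : V) :
    A.atPos i u = ⨂ₜ[ℂ] j, Function.update (fun _ : Fin N => A.vac) i u j := rfl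

theorem firstFactor_apply [NeZero N] (u : V) : A.firstFactor N u = A.atPos 0 u := rfl

theorem atPos_vac (i : Fin N) : A.atPos i A.vac = ⨂ₜ[ℂ] _, A.vac := by
  rw [atPos_apply, Function.update_eq_self_iff.mpr rfl]

theorem coeff_tensorY_atPos (i : Fin N) (u : V) (v : Fin N → V) (c : ℤ) :
    HVertexOperator.coeff (tensorY A.Y (A.atPos i u)) c (⨂ₜ[ℂ] j, v j) =
      ⨂ₜ[ℂ] j, Function.update v i (HVertexOperator.coeff (A.Y u) c (v i)) j := by
  rw [atPos_apply, tensorY_tprod, finsum_eq_single _ (Pi.single i c)]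
  · have h : Pi.single i c ∈ {k : Fin N → ℤ | ∑ i, k i = c} := by simp
    rw [finsum_eq_if, if_pos h]
    congr 1
    funext j
    by_cases hj : j = i
    · subst hj
      simp
    · rw [Function.update_of_ne hj, Function.update_of_ne hj, Pi.single_eq_of_ne hj,
        A.isVertexAlgebra.vacuum, if_pos rfl, LinearMap.id_apply]
  · intro k hk
    rw [finsum_eq_if]
    split_ifs with hs
    swap
    · rfl
    have hs' : ∑ i, k i = c := hs
    obtain ⟨j, hj, hkj⟩ : ∃ j, j ≠ i ∧ k j ≠ 0 := by
      by_contra! hall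
      refine hk (funext fun j => ?_)
      by_cases hj : j = i
      · subst hj
        rw [Pi.single_eq_same, ← hs', Finset.sum_eq_single j (fun l _ hl => hall l hl) (by simp)]
      · rw [Pi.single_eq_of_ne hj, hall j hj]
    refine (PiTensorProduct.tprod ℂ).map_coord_zero j ?_
    rw [Function.update_of_ne hj, A.isVertexAlgebra.vacuum, if_neg hkj, LinearMap.zero_apply]

theorem coeff_tensorY_atPos_atPos (i : Fin N) (u v : V) (c : ℤ) :
    HVertexOperator.coeff (tensorY A.Y (A.atPos i u)) c (A.atPos i v) =
      A.atPos i (HVertexOperator.coeff (A.Y u) c v) := by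
  rw [A.atPos_apply i v, coeff_tensorY_atPos, atPos_apply]
  simp

theorem coeff_tensorY_atPos_of_neg (i : Fin N) (u : V) {v : Fin N → V} (hv : v i = A.vac)
    {c : ℤ} (hc : c < 0) :
    HVertexOperator.coeff (tensorY A.Y (A.atPos i u)) c (⨂ₜ[ℂ] j, v j) = 0 := by
  rw [coeff_tensorY_atPos, hv, A.isVertexAlgebra.creation_neg _ _ hc]
  exact (PiTensorProduct.tprod ℂ).map_coord_zero i (by simp)

theorem coeff_tensorY_atPos_zero (i : Fin N) (u : V) {v : Fin N → V} (hv : v i = A.vac) :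
    HVertexOperator.coeff (tensorY A.Y (A.atPos i u)) 0 (⨂ₜ[ℂ] j, v j) =
      ⨂ₜ[ℂ] j, Function.update v i u j := by
  rw [coeff_tensorY_atPos, hv, A.isVertexAlgebra.creation_zero]

variable [NeZero N]

theorem tensorR_tprod (g : CycleGroup N) (v : Fin N → V) :
    (A.tensorR N g : (⨂[ℂ] _ : Fin N, V) →ₗ[ℂ] _) (⨂ₜ[ℂ] j, v j) =
      ⨂ₜ[ℂ] j, A.powL0 (cycleChar N g)⁻¹ (v ((g : Equiv.Perm (Fin N)).symm j)) := by
  change A.tensorPowL0 N (cycleChar N g)⁻¹ (permAction N V g (⨂ₜ[ℂ] j, v j)) = _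
  have h : permAction N V g (⨂ₜ[ℂ] j, v j) = ⨂ₜ[ℂ] j, v ((g : Equiv.Perm (Fin N)).symm j) :=
    PiTensorProduct.reindex_tprod (R := ℂ) (s := fun _ => V) (g : Equiv.Perm (Fin N)) v
  rw [h, tensorPowL0, PiTensorProduct.map_tprod]

theorem tensorR_atPos (g : CycleGroup N) (i : Fin N) (u : V) :
    (A.tensorR N g : (⨂[ℂ] _ : Fin N, V) →ₗ[ℂ] _) (A.atPos i u) =
      A.atPos ((g : Equiv.Perm (Fin N)) i) (A.powL0 (cycleChar N g)⁻¹ u) := by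
  rw [atPos_apply, tensorR_tprod, atPos_apply]
  congr 1
  funext j
  by_cases hj : j = (g : Equiv.Perm (Fin N)) i
  · subst hj
    simp
  · have : (g : Equiv.Perm (Fin N)).symm j ≠ i := fun h => hj (by rw [← h, Equiv.apply_symm_apply])
    rw [Function.update_of_ne this, Function.update_of_ne hj, powL0_vac]

end GradedVertexAlgebra

section Position

variable (N : ℕ) [NeZero N]

/-- The value `exp(-2πi j / N)` of the character `φ` at the group elements that move the first
position to the position `j`. -/
def posChar (j : Fin N) : ℂˣ := (rootUnit N ^ (j : ℕ))⁻¹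

theorem isPrimitiveRoot_rootUnit : IsPrimitiveRoot (rootUnit N) N := by
  have h := Complex.isPrimitiveRoot_exp N (NeZero.ne N)
  rw [← IsPrimitiveRoot.coe_units_iff]
  exact h

@[simp] theorem posChar_zero : posChar N 0 = 1 := by simp [posChar]

theorem posChar_injective : Function.Injective (posChar N) := by
  intro i j h
  exact Fin.ext ((isPrimitiveRoot_rootUnit N).pow_inj i.2 j.2 (inv_injective h))

theorem posChar_finRotate (j : Fin N) : posChar N (finRotate N j) = (rootUnit N)⁻¹ * posChar N j := by
  have h1 := (isPrimitiveRoot_rootUnit N).pow_eq_one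
  obtain ⟨n, rfl⟩ : ∃ n, N = n + 1 := ⟨N - 1, by have := NeZero.pos N; omega⟩
  rw [posChar, posChar, ← mul_inv, ← pow_succ', inv_inj, finRotate_apply, Fin.val_add,
    Fin.val_one', Nat.add_mod_mod]
  conv_rhs => rw [← Nat.mod_add_div ((j : ℕ) + 1) (n + 1), pow_add, pow_mul, h1, one_pow, mul_one]

theorem cycleChar_gen : cycleChar N (cycleGen N) = rootUnit N := by
  simp [cycleChar, monoidHomOfForallMemZpowers_apply_gen]

theorem posChar_apply (g : CycleGroup N) (j : Fin N) :
    posChar N ((g : Equiv.Perm (Fin N)) j) = cycleChar N g * posChar N j := by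
  have hgen : ∀ j, posChar N ((cycleGen N : Equiv.Perm (Fin N)) j) =
      cycleChar N (cycleGen N) * posChar N j := by
    intro j
    have h := posChar_finRotate N ((finRotate N).symm j)
    rw [Equiv.apply_symm_apply] at h
    rw [cycleChar_gen, h, mul_inv_cancel_left]
    rfl
  obtain ⟨k, rfl⟩ := Subgroup.mem_zpowers_iff.mp (mem_zpowers_cycleGen N g)
  induction k generalizing j with
  | zero => simp
  | succ k ih =>
    rw [zpow_add_one, Subgroup.coe_mul, Equiv.Perm.mul_apply, ih, hgen, map_mul, mul_assoc]
  | pred k ih =>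
    have h := hgen (((cycleGen N)⁻¹ : CycleGroup N).1 j)
    rw [← Equiv.Perm.mul_apply, ← Subgroup.coe_mul, mul_inv_cancel, Subgroup.coe_one,
      Equiv.Perm.one_apply] at h
    rw [zpow_sub_one, Subgroup.coe_mul, Equiv.Perm.mul_apply, ih, map_mul, mul_assoc, h, map_inv,
      inv_mul_cancel_left]

theorem cycleChar_eq_posChar (g : CycleGroup N) :
    cycleChar N g = posChar N ((g : Equiv.Perm (Fin N)) 0) := by
  rw [posChar_apply, posChar_zero, mul_one]

theorem exists_apply_zero_eq (j : Fin N) : ∃ g : CycleGroup N, (g : Equiv.Perm (Fin N)) 0 = j := by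
  refine ⟨(cycleGen N)⁻¹ ^ (j : ℕ), posChar_injective N ?_⟩
  rw [← cycleChar_eq_posChar, map_pow, map_inv, cycleChar_gen, posChar, inv_pow]

theorem posChar_mem_range (j : Fin N) : posChar N j ∈ (cycleChar N).range := by
  obtain ⟨g, hg⟩ := exists_apply_zero_eq N j
  exact ⟨g, by rw [cycleChar_eq_posChar, hg]⟩

end Position

section Local

variable {V W : Type*} [AddCommGroup V] [Module ℂ V] [AddCommGroup W] [Module ℂ W]

theorem rename_prod_linear (α : List ℂˣ) : rename vars2
    (α.map fun a => (X 0 - C (a : ℂ) * X 1 : MvPolynomial (Fin 2) ℂ)).prod =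
      (α.map fun a : ℂˣ => linPoly (a : ℂ)).prod := by
  -- `a : ℂ` in the product refers to the list `α` with all its entries coerced at once.
  have h : (do let a ← α; pure (a : ℂ)) = α.map fun a : ℂˣ => (a : ℂ) := by
    simp [List.map_eq_flatMap]
  rw [h, map_list_prod, List.map_map, List.map_map]
  refine congrArg List.prod (List.map_congr_left fun a _ => ?_)
  simp [linPoly, vars2]

theorem polyMul2_prod_eq_zero_iff (α : List ℂˣ) (a b : VertexOperator ℂ W) (w : W) :
    polyMul2 (α.map fun a => X 0 - C (a : ℂ) * X 1).prod (prod12 a b w - prod21 a b w) = 0 ↔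
      (α.map fun a : ℂˣ => linPoly (a : ℂ)).prod • cor12 a b w =
        (α.map fun a : ℂˣ => linPoly (a : ℂ)).prod • cor21 a b w := by
  rw [← toSer_injective.eq_iff, toSer_polyMul2, rename_prod_linear]
  rw [← sub_eq_zero (b := _ • cor21 a b w), ← smul_sub]
  rfl

theorem prod_linPoly_ne_zero (α : List ℂˣ) : (α.map fun a : ℂˣ => linPoly (a : ℂ)).prod ≠ 0 :=
  List.prod_ne_zero fun h => by
    obtain ⟨a, -, ha⟩ := List.mem_map.mp h
    exact linPoly_ne_zero _ ha

theorem IsGammaQuasimodule.exists_isIterateWith {Γ : Type*} [Group Γ] {B : GammaVertexData Γ V}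
    {YW : V →ₗ[ℂ] VertexOperator ℂ W} (h : B.IsGammaQuasimodule YW) (u v : V) :
    ∃ q, q ≠ 0 ∧ IsIterateWith B.toVertexData YW u v q := by
  obtain ⟨α, -, hα⟩ := h.gammaLocal u v
  obtain ⟨p, hp, hJ⟩ := h.isQuasimodule.quasiJacobi u v
  exact ⟨_, prod_linPoly_ne_zero α, isIterateWith_of_quasiJacobi hp hJ fun w =>
    (polyMul2_prod_eq_zero_iff α _ _ w).mp (hα w)⟩

/-- Two associative pairs with the same products have the same iterates. -/
theorem iter_eq_of_cor12_eq {A : VertexData V} {Y₁ Y₂ : V →ₗ[ℂ] VertexOperator ℂ W} {u v : V}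
    {q₁ q₂ : MvPolynomial (Unit ⊕ Unit) ℂ} (hq₁ : q₁ ≠ 0) (hq₂ : q₂ ≠ 0)
    (h₁ : IsIterateWith A Y₁ u v q₁) (h₂ : IsIterateWith A Y₂ u v q₂) (hu : Y₁ u = Y₂ u)
    (hv : Y₁ v = Y₂ v) (w : W) : iter A Y₁ u v w = iter A Y₂ u v w := by
  have e1 := (h₁.mul q₂ w).2
  have e2 := (h₂.mul q₁ w).2
  rw [mul_comm q₁, ← hu, ← hv, e1, ← sub_eq_zero, ← smul_sub] at e2
  refine sub_eq_zero.mp (eq_zero_of_smul_eq_zero ?_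
    (Submodule.sub_mem _ iter_mem_truncIn iter_mem_truncIn) (fun a => ?_) e2)
  · rw [Ne, map_eq_zero_iff _ taylorPoly_injective]
    exact mul_ne_zero hq₂ hq₁
  · obtain ⟨B, hB⟩ := iter_trunc A Y₁ u v w a
    obtain ⟨B', hB'⟩ := iter_trunc A Y₂ u v w a
    refine ⟨min B B', fun b hb => ?_⟩
    rw [Pi.sub_apply, hB b (hb.trans_le (min_le_left _ _)),
      hB' b (hb.trans_le (min_le_right _ _)), sub_zero]

/-- The series `f(α x₁, β x₂)`. -/
def scale (α β : ℂˣ) (f : Ser (Unit ⊕ Unit) W) : Ser (Unit ⊕ Unit) W :=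
  fun n => ((α ^ n (.inl ()) * β ^ n (.inr ()) : ℂˣ) : ℂ) • f n

/-- The polynomial `p(α x₁, β x₂)`. -/
def scalePoly (α β : ℂˣ) : MvPolynomial (Unit ⊕ Unit) ℂ →ₐ[ℂ] MvPolynomial (Unit ⊕ Unit) ℂ :=
  aeval (Sum.elim (fun _ => C (α : ℂ) * X (.inl ())) fun _ => C (β : ℂ) * X (.inr ()))

theorem scale_pr (α β : ℂˣ) (f : Ser (Unit ⊕ Unit) W) (a b : ℤ) :
    scale α β f (pr a b) = ((α ^ a * β ^ b : ℂˣ) : ℂ) • f (pr a b) := rfl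

theorem scale_smul (α β : ℂˣ) (p : MvPolynomial (Unit ⊕ Unit) ℂ) (f : Ser (Unit ⊕ Unit) W) :
    scale α β (p • f) = scalePoly α β p • scale α β f := by
  refine map_smul_of_map_X (scalePoly α β).toRingHom ⊤ (scale α β) (fun f _ g _ => ?_)
    (fun c f _ => ?_) (fun i f _ => ?_) p trivial
  · funext n
    exact smul_add _ _ _
  · funext n
    simp only [scale, C_smul, AlgHom.toRingHom_eq_coe, RingHom.coe_coe, algHom_C, algebraMap_eq,
      Pi.smul_apply]
    exact smul_comm _ _ _
  · refine ext_pr fun a b => ?_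
    obtain (⟨⟩ | ⟨⟩) := i
    · simp only [scalePoly, AlgHom.toRingHom_eq_coe, RingHom.coe_coe, aeval_X, Sum.elim_inl]
      rw [mul_smul, C_smul, Pi.smul_apply, X_inl_smul_pr, scale_pr, scale_pr, X_inl_smul_pr,
        smul_smul, ← Units.val_mul, ← mul_assoc, ← zpow_one_add, add_sub_cancel]
    · simp only [scalePoly, AlgHom.toRingHom_eq_coe, RingHom.coe_coe, aeval_X, Sum.elim_inr]
      rw [mul_smul, C_smul, Pi.smul_apply, X_inr_smul_pr, scale_pr, scale_pr, X_inr_smul_pr,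
        smul_smul, ← Units.val_mul, mul_left_comm, ← zpow_one_add, add_sub_cancel]

theorem scale_injective (α β : ℂˣ) : Function.Injective (scale (W := W) α β) := by
  intro f g h
  funext n
  exact smul_right_injective W (Units.ne_zero (α ^ n (.inl ()) * β ^ n (.inr ()))) (congrFun h n)

theorem taylor_scale (α : ℂˣ) (f : Ser (Unit ⊕ Unit) W) :
    taylor (scale α α f) = scale α α (taylor f) := by
  refine ext_pr fun a b => ?_
  rw [scale_pr, taylor_pr, taylor_pr, smul_finsum]
  refine finsum_congr fun i => ?_
  rw [scale_pr, ← zpow_add, ← zpow_add, smul_comm, show i + (a + b - i) = a + b by ring]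

theorem taylorPoly_linPoly_one : taylorPoly Unit (linPoly 1) = X (.inl ()) := by
  rw [linPoly_one, map_sub, taylorPoly_X_inl, taylorPoly_X_inr, add_sub_cancel_right]

theorem scale_mem_truncIn (α β : ℂˣ) (i : Unit ⊕ Unit) {f : Ser (Unit ⊕ Unit) W}
    (hf : f ∈ truncIn W i) : scale α β f ∈ truncIn W i := by
  obtain ⟨B, hB⟩ := hf
  exact ⟨B, fun n hn => by rw [scale, hB n hn, smul_zero]⟩

/-- If `Y_W(u', x) = Y_W(u, α x)` and `u'ₖ v = 0` for `k ≥ 0`, then the locality of `u` and `v`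
does not require the factor `x₁ - α x₂`. -/
theorem local_of_linPoly_mul {A : VertexData V} {YW : V →ₗ[ℂ] VertexOperator ℂ W} {u u' v : V}
    {α : ℂˣ} (hu : ∀ n, HVertexOperator.coeff (YW u') n =
      ((α ^ n : ℂˣ) : ℂ) • HVertexOperator.coeff (YW u) n)
    (hv : ∀ c < 0, HVertexOperator.coeff (A.Y u') c v = 0)
    {p : MvPolynomial (Fin 2) ℂ} (hp : p ≠ 0)
    (hJ : ∀ w, polyMul3 p (jacobiLeft YW u' v w) = polyMul3 p (jacobiRight A YW u' v w))
    {q : MvPolynomial (Unit ⊕ Unit) ℂ}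
    (hq : ∀ w, (linPoly α * q) • cor12 (YW u) (YW v) w = (linPoly α * q) • cor21 (YW u) (YW v) w)
    (w : W) : q • cor12 (YW u) (YW v) w = q • cor21 (YW u) (YW v) w := by
  have h12 : ∀ w, cor12 (YW u') (YW v) w = scale α 1 (cor12 (YW u) (YW v) w) := by
    intro w
    refine ext_pr fun a b => ?_
    rw [scale_pr, cor12_pr, cor12_pr, hu, one_zpow, mul_one, LinearMap.smul_apply]
  have h21 : ∀ w, cor21 (YW u') (YW v) w = scale α 1 (cor21 (YW u) (YW v) w) := by
    intro w
    refine ext_pr fun a b => ?_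
    rw [scale_pr, cor21_pr, cor21_pr, hu, one_zpow, mul_one, LinearMap.smul_apply, map_smul]
  have hlin : scalePoly α 1 (linPoly α) = C (α : ℂ) * linPoly 1 := by
    simp only [linPoly, scalePoly, map_sub, map_mul, aeval_X, Sum.elim_inl, Sum.elim_inr, algHom_C,
      algebraMap_eq, C_1, one_mul, Units.val_one]
    ring
  have hq' : ∀ w, (linPoly 1 * scalePoly α 1 q) • cor12 (YW u') (YW v) w =
      (linPoly 1 * scalePoly α 1 q) • cor21 (YW u') (YW v) w := by
    intro w
    have h := congrArg (scale α 1) (hq w)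
    rw [scale_smul, scale_smul, map_mul, hlin, mul_assoc, mul_smul, C_smul, mul_smul (C _), C_smul,
      ← h12, ← h21] at h
    have h' := congrArg (((α⁻¹ : ℂˣ) : ℂ) • ·) h
    simpa [smul_smul] using h'
  refine scale_injective α 1 ?_
  rw [scale_smul, scale_smul]
  refine eq_of_linPoly_one_smul_eq
    (Submodule.smul_mem _ _ (scale_mem_truncIn _ _ _ (cor12_mem_truncIn _ _ _)))
    (Submodule.smul_mem _ _ (scale_mem_truncIn _ _ _ (cor21_mem_truncIn _ _ _))) ?_ fun b => ?_
  · rw [← h12, ← h21, ← mul_smul, ← mul_smul]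
    exact hq' w
  · rw [← h12, ← mul_smul, (isIterateWith_of_quasiJacobi hp hJ hq' w).2, map_mul, mul_smul,
      taylorPoly_linPoly_one, X_inl_smul_pr]
    by_contra h
    obtain ⟨m, -, hm⟩ := exists_of_smul_apply_ne_zero h
    refine hm ?_
    rw [← pr_eta (pr (0 - 1) b - expo m), iter_pr, hv, map_zero]
    · rfl
    · rw [Pi.sub_apply, pr_inl, expo_apply]
      omega

end Local

/-! ### Restriction to the first tensor factor -/

namespace GradedVertexAlgebra

variable {V W : Type*} [AddCommGroup V] [Module ℂ V] [AddCommGroup W] [Module ℂ W]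
  (A : GradedVertexAlgebra V) {N : ℕ} [NeZero N]
  {Ybar : (⨂[ℂ] _ : Fin N, V) →ₗ[ℂ] VertexOperator ℂ W}

/-- In a quasimodule, the fields of two vectors in the first position are local up to a power of
`x₁ - x₂`: the factors `x₁ - φ(g) x₂` for which `g` moves the first position can be dropped, as the
nonnegative modes of a vector in another position kill the vectors in the first position. -/
theorem exists_linPoly_one_pow_local (h : (A.tensorPowerGamma N).IsGammaQuasimodule Ybar) (u v : V)
    (L : List ℂˣ) (hL : ∀ a ∈ L, a ∈ (cycleChar N).range) (k : ℕ)
    (hloc : ∀ w, ((L.map fun a : ℂˣ => linPoly (a : ℂ)).prod * linPoly 1 ^ k) •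
        cor12 (Ybar (A.atPos 0 u)) (Ybar (A.atPos 0 v)) w =
      ((L.map fun a : ℂˣ => linPoly (a : ℂ)).prod * linPoly 1 ^ k) •
        cor21 (Ybar (A.atPos 0 u)) (Ybar (A.atPos 0 v)) w) :
    ∃ k : ℕ, ∀ w, linPoly 1 ^ k • cor12 (Ybar (A.atPos 0 u)) (Ybar (A.atPos 0 v)) w =
      linPoly 1 ^ k • cor21 (Ybar (A.atPos 0 u)) (Ybar (A.atPos 0 v)) w := by
  induction L generalizing k with
  | nil => exact ⟨k, fun w => by simpa using hloc w⟩
  | cons α L ih =>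
    have hL' : ∀ a ∈ L, a ∈ (cycleChar N).range := fun a ha => hL a (List.mem_cons_of_mem _ ha)
    have hP : ((α :: L).map fun a : ℂˣ => linPoly (a : ℂ)).prod =
        linPoly (α : ℂ) * (L.map fun a : ℂˣ => linPoly (a : ℂ)).prod := by
      rw [List.map_cons, List.prod_cons]
    rw [hP] at hloc
    by_cases hα : α = 1
    · subst hα
      refine ih hL' (k + 1) fun w => ?_
      have := hloc w
      rwa [Units.val_one, mul_comm (linPoly 1), mul_assoc, ← pow_succ'] at this
    · obtain ⟨g, rfl⟩ := hL α List.mem_cons_self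
      have hg : (g : Equiv.Perm (Fin N)) 0 ≠ 0 := fun h0 => hα (by
        rw [cycleChar_eq_posChar, h0, posChar_zero])
      have hu : ∀ n, HVertexOperator.coeff (Ybar (A.atPos ((g : Equiv.Perm (Fin N)) 0)
          (A.powL0 (cycleChar N g)⁻¹ u))) n =
            ((cycleChar N g ^ n : ℂˣ) : ℂ) • HVertexOperator.coeff (Ybar (A.atPos 0 u)) n := by
        intro n
        rw [← tensorR_atPos]
        exact h.equivariant g (A.atPos 0 u) n
      obtain ⟨p, hp, hJ⟩ := h.isQuasimodule.quasiJacobi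
        (A.atPos ((g : Equiv.Perm (Fin N)) 0) (A.powL0 (cycleChar N g)⁻¹ u)) (A.atPos 0 v)
      exact ih hL' k (local_of_linPoly_mul (A := (A.tensorPowerGamma N).toVertexData)
        (v := A.atPos 0 v)
        (α := cycleChar N g) hu
        (fun c hc => A.coeff_tensorY_atPos_of_neg _ _ (Function.update_of_ne hg _ _) hc) hp hJ
        fun w => by simpa only [mul_assoc] using hloc w)

/-- A quasimodule for the tensor power restricts to a module along the first tensor factor. -/
theorem isModule_comp_firstFactor (h : (A.tensorPowerGamma N).IsGammaQuasimodule Ybar) :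
    A.toVertexData.IsModule (Ybar ∘ₗ A.firstFactor N) where
  vacuum := by
    rw [LinearMap.comp_apply, firstFactor_apply, atPos_vac]
    exact h.isQuasimodule.vacuum
  jacobi u v w := by
    obtain ⟨α, hα, hloc⟩ := h.gammaLocal (A.atPos 0 u) (A.atPos 0 v)
    obtain ⟨p, hp, hJ⟩ := h.isQuasimodule.quasiJacobi (A.atPos 0 u) (A.atPos 0 v)
    obtain ⟨k, hk⟩ := A.exists_linPoly_one_pow_local h u v α hα 0 fun w => by
      simpa using (polyMul2_prod_eq_zero_iff α _ _ w).mp (hloc w)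
    have hiter : ∀ w, iter (A.tensorPowerGamma N).toVertexData Ybar (A.atPos 0 u) (A.atPos 0 v) w =
        iter A.toVertexData (Ybar ∘ₗ A.firstFactor N) u v w := by
      intro w
      refine ext_pr fun c b => ?_
      rw [iter_pr, iter_pr, LinearMap.comp_apply, firstFactor_apply, ← coeff_tensorY_atPos_atPos]
      rfl
    refine jacobi_of_isIterateWith (k := k) (fun w => ?_) w
    have := isIterateWith_of_quasiJacobi hp hJ hk w
    rw [hiter] at this
    exact this

/-! ### Uniqueness of the extension -/

/-- Equivariance expresses the field of a vector in any position by that of a vector in the first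
position. -/
theorem coeff_atPos (h : (A.tensorPowerGamma N).IsGammaQuasimodule Ybar) (i : Fin N) (u : V)
    (n : ℤ) : HVertexOperator.coeff (Ybar (A.atPos i u)) n =
      ((posChar N i ^ n : ℂˣ) : ℂ) •
        HVertexOperator.coeff (Ybar (A.atPos 0 (A.powL0 (posChar N i) u))) n := by
  obtain ⟨g, rfl⟩ := exists_apply_zero_eq N i
  rw [← cycleChar_eq_posChar]
  refine Eq.trans ?_ (h.equivariant g (A.atPos 0 (A.powL0 (cycleChar N g) u)) n)
  have h1 := A.tensorR_atPos g 0 (A.powL0 (cycleChar N g) u)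
  have h2 := A.powL0_inv_apply (cycleChar N g)⁻¹ u
  rw [inv_inv] at h2
  rw [h2] at h1
  rw [← h1]
  rfl

/-- A quasimodule for the tensor power is determined by its restriction to the first tensor factor, by
induction on the positions of the factors other than the vacuum. -/
theorem eq_of_comp_firstFactor_eq {Y₁ Y₂ : (⨂[ℂ] _ : Fin N, V) →ₗ[ℂ] VertexOperator ℂ W}
    (h₁ : (A.tensorPowerGamma N).IsGammaQuasimodule Y₁)
    (h₂ : (A.tensorPowerGamma N).IsGammaQuasimodule Y₂)
    (h : Y₁ ∘ₗ A.firstFactor N = Y₂ ∘ₗ A.firstFactor N) : Y₁ = Y₂ := by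
  have hpos : ∀ i u, Y₁ (A.atPos i u) = Y₂ (A.atPos i u) := by
    intro i u
    refine HVertexOperator.coeff_inj (funext fun n => ?_)
    rw [A.coeff_atPos h₁, A.coeff_atPos h₂]
    have := LinearMap.congr_fun h (A.powL0 (posChar N i) u)
    simp only [LinearMap.comp_apply, firstFactor_apply] at this
    rw [this]
  have key : ∀ (s : Finset (Fin N)) (v : Fin N → V), (∀ j ∉ s, v j = A.vac) →
      Y₁ (⨂ₜ[ℂ] j, v j) = Y₂ (⨂ₜ[ℂ] j, v j) := by
    intro s
    induction s using Finset.induction_on with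
    | empty =>
      intro v hv
      have hv' : v = fun _ => A.vac := funext fun j => hv j (Finset.notMem_empty j)
      subst hv'
      refine HVertexOperator.coeff_inj (funext fun n => ?_)
      exact (h₁.isQuasimodule.vacuum n).trans (h₂.isQuasimodule.vacuum n).symm
    | insert i s hi ih =>
      intro v hv
      set v' := Function.update v i A.vac with hv'
      have hs : ∀ j ∉ s, v' j = A.vac := by
        intro j hj
        by_cases hji : j = i
        · subst hji
          simp [hv']
        · rw [hv', Function.update_of_ne hji]
          exact hv j (by simp [hji, hj])
      have hvi : v' i = A.vac := by simp [hv']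
      obtain ⟨q₁, hq₁, hI₁⟩ := IsGammaQuasimodule.exists_isIterateWith h₁ (A.atPos i (v i)) (⨂ₜ[ℂ] j, v' j)
      obtain ⟨q₂, hq₂, hI₂⟩ := IsGammaQuasimodule.exists_isIterateWith h₂ (A.atPos i (v i)) (⨂ₜ[ℂ] j, v' j)
      have hz : HVertexOperator.coeff (tensorY A.Y (A.atPos i (v i))) 0 (⨂ₜ[ℂ] j, v' j) =
          ⨂ₜ[ℂ] j, v j := by
        rw [A.coeff_tensorY_atPos_zero i _ hvi, hv', Function.update_idem, Function.update_eq_self]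
      -- A pure tensor is the `(-1)`-st product of its `i`-th factor and the remaining tensor.
      rw [← hz]
      refine HVertexOperator.coeff_inj (funext fun n => LinearMap.ext fun w => ?_)
      exact congrFun (iter_eq_of_cor12_eq hq₁ hq₂ hI₁ hI₂ (hpos _ _) (ih v' hs) w) (pr 0 n)
  refine PiTensorProduct.ext (MultilinearMap.ext fun v => ?_)
  exact key Finset.univ v fun j hj => absurd (Finset.mem_univ j) hj

end GradedVertexAlgebra

/-! ### Localized identification of variables -/

namespace Ser

variable {σ τ W W' : Type*} [AddCommGroup W] [Module ℂ W] [AddCommGroup W'] [Module ℂ W']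

/-- The nonzero constant multiples of monomials. -/
def monomials (τ : Type*) : Submonoid (MvPolynomial τ ℂ) where
  carrier := {p | ∃ d c, c ≠ 0 ∧ p = monomial d c}
  one_mem' := ⟨0, 1, one_ne_zero, rfl⟩
  mul_mem' := by
    rintro _ _ ⟨d, c, hc, rfl⟩ ⟨d', c', hc', rfl⟩
    exact ⟨d + d', c * c', mul_ne_zero hc hc', by rw [monomial_mul]⟩

theorem X_mem_monomials (i : τ) : (X i : MvPolynomial τ ℂ) ∈ monomials τ :=
  ⟨_, 1, one_ne_zero, rfl⟩

theorem C_mem_monomials {c : ℂ} (hc : c ≠ 0) : (C c : MvPolynomial τ ℂ) ∈ monomials τ :=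
  ⟨0, c, hc, rfl⟩

theorem ne_zero_of_mem_monomials {p : MvPolynomial τ ℂ} (hp : p ∈ monomials τ) : p ≠ 0 := by
  obtain ⟨d, c, hc, rfl⟩ := hp
  rwa [Ne, monomial_eq_zero]

theorem smul_left_cancel_of_mem_monomials {p : MvPolynomial τ ℂ} (hp : p ∈ monomials τ)
    {f g : Ser τ W} (h : p • f = p • g) : f = g := by
  obtain ⟨d, c, hc, rfl⟩ := hp
  funext n
  have := congrFun h (n + expo d)
  rw [monomial_smul_apply, monomial_smul_apply, add_sub_cancel_right] at this
  exact smul_right_injective W hc this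

theorem exists_smul_eq_of_mem_monomials {p : MvPolynomial τ ℂ} (hp : p ∈ monomials τ)
    (f : Ser τ W) : ∃ g : Ser τ W, p • g = f := by
  obtain ⟨d, c, hc, rfl⟩ := hp
  refine ⟨fun n => c⁻¹ • f (n + expo d), funext fun n => ?_⟩
  rw [monomial_smul_apply, sub_add_cancel, smul_smul, mul_inv_cancel₀ hc, one_smul]

theorem mem_trunc_of_smul_mem {p : MvPolynomial τ ℂ} (hp : p ∈ monomials τ) {f : Ser τ W}
    (h : p • f ∈ trunc τ W) : f ∈ trunc τ W := by
  obtain ⟨d, c, hc, rfl⟩ := hp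
  rw [mem_trunc] at h ⊢
  intro i
  obtain ⟨B, hB⟩ := h i
  refine ⟨B - d i, fun n hn => ?_⟩
  have := hB (n + expo d) (by rw [Pi.add_apply, expo_apply]; omega)
  rw [monomial_smul_apply, add_sub_cancel_right] at this
  exact (smul_eq_zero.mp this).resolve_left hc

/-- The product of two polynomials in disjoint families of variables acts on a composition of operators
in these variables one factor at a time. -/
theorem smul_nested {σ₁ σ₂ : Type*} {ρ₁ : σ₁ → σ} {ρ₂ : σ₂ → σ}
    (hρ : Function.Injective (Sum.elim ρ₁ ρ₂)) (A : (σ₁ → ℤ) → Module.End ℂ W)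
    (Q : MvPolynomial σ₁ ℂ) (Q' : MvPolynomial σ₂ ℂ) (f : Ser σ₂ W) (n : σ → ℤ) :
    ((rename ρ₁ Q * rename ρ₂ Q') • (fun n => A (n ∘ ρ₁) (f (n ∘ ρ₂)) : Ser σ W)) n =
      (Q • (fun a => A a ((Q' • f) (n ∘ ρ₂)) : Ser σ₁ W)) (n ∘ ρ₁) := by
  have hρ₁ : ρ₁.Injective := fun a b hab => Sum.inl_injective (hρ hab)
  have hρ₂ : ρ₂.Injective := fun a b hab => Sum.inr_injective (hρ hab)
  have hdisj : ∀ i j, ρ₁ i ≠ ρ₂ j := fun i j hij =>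
    Sum.inl_ne_inr (hρ (show Sum.elim ρ₁ ρ₂ (.inl i) = Sum.elim ρ₁ ρ₂ (.inr j) from hij))
  have e₁ : ∀ (a : σ₁ → ℤ) (n : σ → ℤ), Function.extend ρ₁ a n ∘ ρ₂ = n ∘ ρ₂ := fun a n =>
    funext fun j => Function.extend_apply' _ _ _ fun ⟨i, hi⟩ => hdisj i j hi
  have e₂ : ∀ (a : σ₂ → ℤ) (n : σ → ℤ), Function.extend ρ₂ a n ∘ ρ₁ = n ∘ ρ₁ := fun a n =>
    funext fun j => Function.extend_apply' _ _ _ fun ⟨i, hi⟩ => hdisj j i hi.symm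
  have e₃ : ∀ (a : σ₁ → ℤ) (n : σ → ℤ), Function.extend ρ₁ a n ∘ ρ₁ = a := fun a n =>
    funext fun j => hρ₁.extend_apply _ _ _
  have e₄ : ∀ (a : σ₂ → ℤ) (n : σ → ℤ), Function.extend ρ₂ a n ∘ ρ₂ = a := fun a n =>
    funext fun j => hρ₂.extend_apply _ _ _
  have h₂ : rename ρ₂ Q' • (fun n => A (n ∘ ρ₁) (f (n ∘ ρ₂)) : Ser σ W) =
      fun n => A (n ∘ ρ₁) ((Q' • f) (n ∘ ρ₂)) := by
    funext n
    rw [rename_smul_apply hρ₂]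
    have : slice ρ₂ n (fun n => A (n ∘ ρ₁) (f (n ∘ ρ₂)) : Ser σ W) =
        mapVal (A (n ∘ ρ₁)) f := by
      funext a
      simp only [slice, e₂, e₄, mapVal_apply]
    rw [this, ← mapVal_smul, mapVal_apply]
  rw [mul_smul, h₂, rename_smul_apply hρ₁]
  have : slice ρ₁ n (fun n => A (n ∘ ρ₁) ((Q' • f) (n ∘ ρ₂)) : Ser σ W) =
      fun a => A a ((Q' • f) (n ∘ ρ₂)) := by
    funext a
    simp only [slice, e₁, e₃]
  rw [this]

theorem rename_mem_monomials {τ' : Type*} (θ : τ → τ') {p : MvPolynomial τ ℂ}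
    (hp : p ∈ monomials τ) : rename θ p ∈ monomials τ' := by
  obtain ⟨d, c, hc, rfl⟩ := hp
  exact ⟨_, c, hc, rename_monomial _ _ _⟩

variable [Fintype σ] {π : σ → τ}

theorem spec_mem_trunc {f : Ser σ W} (hf : f ∈ trunc σ W) : spec π f ∈ trunc τ W := by
  classical
  obtain ⟨B, hB⟩ := exists_bound_of_mem_trunc hf
  rw [mem_trunc]
  intro t
  refine ⟨∑ i with π i = t, B, fun o ho => ?_⟩
  rw [spec_apply]
  refine finsum_mem_eq_zero_of_forall_eq_zero fun n hn => ?_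
  by_contra h
  have hn' : push π n = o := hn
  rw [← hn', push_apply] at ho
  exact absurd (Finset.sum_le_sum fun i _ => hB n h i) (not_le.mpr ho)

theorem spec_injective_eq (f : Ser σ W) {π : σ → τ} (o : τ → ℤ) (n : σ → ℤ)
    (h : ∀ m, f m ≠ 0 → push π m = o → m = n) (hn : push π n = o) : spec π f o = f n := by
  rw [spec_apply, finsum_mem_def, finsum_eq_single _ n]
  · exact Set.indicator_of_mem (show n ∈ {n | push π n = o} from hn) _
  · intro m hm
    by_contra hne
    have hmem : m ∈ {n | push π n = o} := Set.mem_of_indicator_ne_zero hne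
    rw [Set.indicator_of_mem hmem] at hne
    exact hm (h m hne hmem)

/-- The series `g` arises from `f` by replacing each variable `i` by `π i`, in the sense that this
holds after multiplication by a polynomial that becomes a monomial: `f` itself may have infinitely
many terms of the same degree. -/
def IsSpec (π : σ → τ) (f : Ser σ W) (g : Ser τ W) : Prop :=
  ∃ Q : MvPolynomial σ ℂ, rename π Q ∈ monomials τ ∧ Q • f ∈ finDeg W (push π) ∧
    spec π (Q • f) = rename π Q • g

theorem IsSpec.spec_smul_eq {f : Ser σ W} {g : Ser τ W} (h : IsSpec π f g)
    {p : MvPolynomial σ ℂ} (hp : p • f ∈ finDeg W (push π)) : spec π (p • f) = rename π p • g := by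
  obtain ⟨Q, hQ, hf, hg⟩ := h
  refine smul_left_cancel_of_mem_monomials hQ ?_
  rw [← spec_smul Q hp, smul_comm Q p, spec_smul p hf, hg, smul_comm]

theorem IsSpec.spec_eq {f : Ser σ W} {g : Ser τ W} (h : IsSpec π f g)
    (hf : f ∈ finDeg W (push π)) : spec π f = g := by
  have := h.spec_smul_eq (p := 1) (by rwa [one_smul])
  rwa [map_one, one_smul, one_smul] at this

theorem IsSpec.unique {f : Ser σ W} {g g' : Ser τ W} (h : IsSpec π f g) (h' : IsSpec π f g') :
    g = g' := by
  obtain ⟨Q, hQ, hf, hg⟩ := h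
  refine smul_left_cancel_of_mem_monomials hQ ?_
  rw [← hg, h'.spec_smul_eq hf]

theorem isSpec_of_mem_finDeg {f : Ser σ W} (hf : f ∈ finDeg W (push π)) : IsSpec π f (spec π f) :=
  ⟨1, by rw [map_one]; exact one_mem _, by rwa [one_smul], by rw [map_one, one_smul, one_smul]⟩

theorem exists_isSpec {f : Ser σ W} {Q : MvPolynomial σ ℂ} (hQ : rename π Q ∈ monomials τ)
    (hf : Q • f ∈ finDeg W (push π)) : ∃ g, IsSpec π f g := by
  obtain ⟨g, hg⟩ := exists_smul_eq_of_mem_monomials hQ (spec π (Q • f))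
  exact ⟨g, Q, hQ, hf, hg.symm⟩

theorem IsSpec.mem_trunc {f : Ser σ W} {g : Ser τ W} (h : IsSpec π f g) {Q : MvPolynomial σ ℂ}
    (hQ : rename π Q ∈ monomials τ) (hf : Q • f ∈ trunc σ W) : g ∈ trunc τ W := by
  refine mem_trunc_of_smul_mem hQ ?_
  rw [← h.spec_smul_eq (trunc_le_finDeg_push π hf)]
  exact spec_mem_trunc hf

theorem IsSpec.add {f f' : Ser σ W} {g g' : Ser τ W} (h : IsSpec π f g) (h' : IsSpec π f' g') :
    IsSpec π (f + f') (g + g') := by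
  obtain ⟨Q, hQ, hf, hg⟩ := h
  obtain ⟨Q', hQ', hf', hg'⟩ := h'
  have e1 : (Q * Q') • f ∈ finDeg W (push π) := by
    rw [mul_comm, mul_smul]
    exact Submodule.smul_mem _ _ hf
  have e2 : (Q * Q') • f' ∈ finDeg W (push π) := by
    rw [mul_smul]
    exact Submodule.smul_mem _ _ hf'
  refine ⟨Q * Q', ?_, ?_, ?_⟩
  · rw [map_mul]
    exact mul_mem hQ hQ'
  · rw [smul_add]
    exact Submodule.add_mem _ e1 e2
  · rw [smul_add, spec_add e1 e2, smul_add, IsSpec.spec_smul_eq ⟨Q, hQ, hf, hg⟩ e1,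
      IsSpec.spec_smul_eq ⟨Q', hQ', hf', hg'⟩ e2]

theorem IsSpec.smul {f : Ser σ W} {g : Ser τ W} (h : IsSpec π f g) (p : MvPolynomial σ ℂ) :
    IsSpec π (p • f) (rename π p • g) := by
  obtain ⟨Q, hQ, hf, hg⟩ := h
  refine ⟨Q, hQ, ?_, ?_⟩
  · rw [smul_comm]
    exact Submodule.smul_mem _ _ hf
  · rw [smul_comm, spec_smul p hf, hg, smul_comm]

theorem IsSpec.csmul {f : Ser σ W} {g : Ser τ W} (h : IsSpec π f g) (c : ℂ) :
    IsSpec π (c • f) (c • g) := by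
  have := h.smul (C c)
  rwa [rename_C, C_smul, C_smul] at this

/-- A series that agrees with `f` up to a polynomial that becomes a monomial has the same
specialization. -/
theorem IsSpec.of_smul_eq {f f' : Ser σ W} {g : Ser τ W} (h : IsSpec π f g)
    {p : MvPolynomial σ ℂ} (hp : rename π p ∈ monomials τ) (hf : p • f = p • f') :
    IsSpec π f' g := by
  obtain ⟨Q, hQ, hfin, hg⟩ := h
  have e : (Q * p) • f' = p • Q • f := by
    rw [mul_smul, ← hf, smul_comm]
  refine ⟨Q * p, ?_, ?_, ?_⟩
  · rw [map_mul]
    exact mul_mem hQ hp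
  · rw [e]
    exact Submodule.smul_mem _ _ hfin
  · rw [e, spec_smul p hfin, hg, map_mul, mul_comm, mul_smul]

/-- Specialization of a product of operators in two disjoint families of variables, where the
operators of the outer family can be specialized with a polynomial that does not depend on the
vector they are applied to. -/
theorem isSpec_nested {σ₁ σ₂ τ₁ τ₂ : Type*} [Fintype σ₁] [Fintype σ₂] {π₁ : σ₁ → τ₁}
    {π₂ : σ₂ → τ₂} {ρ₁ : σ₁ → σ} {ρ₂ : σ₂ → σ} {θ₁ : τ₁ → τ} {θ₂ : τ₂ → τ}
    (hρ : Function.Bijective (Sum.elim ρ₁ ρ₂)) (hθ : Function.Injective (Sum.elim θ₁ θ₂))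
    (hπ₁ : π ∘ ρ₁ = θ₁ ∘ π₁) (hπ₂ : π ∘ ρ₂ = θ₂ ∘ π₂)
    (hpush : ∀ n o, push π n = o ↔ push π₁ (n ∘ ρ₁) = o ∘ θ₁ ∧ push π₂ (n ∘ ρ₂) = o ∘ θ₂)
    {A : (σ₁ → ℤ) → Module.End ℂ W} {B : (τ₁ → ℤ) → Module.End ℂ W}
    {Q : MvPolynomial σ₁ ℂ} (hQ : rename π₁ Q ∈ monomials τ₁)
    (hfin : ∀ w, Q • (fun n => A n w : Ser σ₁ W) ∈ finDeg W (push π₁))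
    (hspec : ∀ w, IsSpec π₁ (fun n => A n w) (fun n => B n w))
    {f : Ser σ₂ W} {g : Ser τ₂ W} (h : IsSpec π₂ f g) :
    IsSpec π (fun n => A (n ∘ ρ₁) (f (n ∘ ρ₂))) (fun o => B (o ∘ θ₁) (g (o ∘ θ₂))) := by
  classical
  obtain ⟨Q', hQ', hf, hg⟩ := h
  set A' : W → Ser σ₁ W := fun w => Q • (fun n => A n w : Ser σ₁ W) with hA'
  have hA'0 : A' 0 = 0 := by
    have : (fun n => A n 0 : Ser σ₁ W) = 0 := funext fun n => map_zero _
    rw [hA']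
    simp only
    rw [this, smul_zero]
  set f' := Q' • f with hf'
  let e := Equiv.ofBijective _ hρ
  have he₁ : ∀ i, e.symm (ρ₁ i) = .inl i := fun i => e.symm_apply_apply (.inl i)
  have he₂ : ∀ i, e.symm (ρ₂ i) = .inr i := fun i => e.symm_apply_apply (.inr i)
  let Φ : (σ₂ → ℤ) × (σ₁ → ℤ) ≃ (σ → ℤ) :=
    { toFun := fun x => Sum.elim x.2 x.1 ∘ e.symm
      invFun := fun n => (n ∘ ρ₂, n ∘ ρ₁)
      left_inv := fun x => Prod.ext (funext fun i => by simp [he₂]) (funext fun i => by simp [he₁])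
      right_inv := fun n => by
        funext i
        obtain ⟨s, rfl⟩ := e.surjective i
        simp only [Function.comp_apply, e.symm_apply_apply]
        rcases s with s | s <;> rfl }
  have hΦ₁ : ∀ x, Φ x ∘ ρ₁ = x.2 := fun x => (Prod.ext_iff.mp (Φ.symm_apply_apply x)).2
  have hΦ₂ : ∀ x, Φ x ∘ ρ₂ = x.1 := fun x => (Prod.ext_iff.mp (Φ.symm_apply_apply x)).1
  set F : Ser σ W := fun n => A (n ∘ ρ₁) (f (n ∘ ρ₂)) with hF
  set P : MvPolynomial σ ℂ := rename ρ₁ Q * rename ρ₂ Q' with hP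
  have hPF : ∀ n, (P • F) n = A' (f' (n ∘ ρ₂)) (n ∘ ρ₁) := smul_nested hρ.1 A Q Q' f
  have hPF' : ∀ x, (P • F) (Φ x) = A' (f' x.1) x.2 := fun x => by rw [hPF, hΦ₁, hΦ₂]
  have hpush' : ∀ x o, push π (Φ x) = o ↔ push π₁ x.2 = o ∘ θ₁ ∧ push π₂ x.1 = o ∘ θ₂ :=
    fun x o => by rw [hpush, hΦ₁, hΦ₂]
  have hfinx : ∀ o, {x | push π (Φ x) = o ∧ (P • F) (Φ x) ≠ 0}.Finite := by
    intro o
    refine ((hf (o ∘ θ₂)).biUnion fun m _ =>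
      ((hfin (f' m) (o ∘ θ₁)).image fun l => (m, l))).subset ?_
    rintro ⟨m, l⟩ ⟨h1, h2⟩
    rw [hpush'] at h1
    rw [hPF'] at h2
    refine Set.mem_biUnion (x := m) ⟨h1.2, fun h0 => h2 ?_⟩ ⟨l, ⟨h1.1, h2⟩, rfl⟩
    rw [show f' m = 0 from h0, hA'0]
    rfl
  have hfinP : P • F ∈ finDeg W (push π) := by
    intro o
    refine ((hfinx o).image Φ).subset fun n hn => ⟨Φ.symm n, ?_, Φ.apply_symm_apply n⟩
    rw [Set.mem_ofPred_eq, Φ.apply_symm_apply]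
    exact hn
  have hren : rename π P = rename θ₁ (rename π₁ Q) * rename θ₂ (rename π₂ Q') := by
    rw [hP, map_mul, rename_rename, rename_rename, rename_rename, rename_rename, hπ₁, hπ₂]
  refine ⟨P, ?_, hfinP, ?_⟩
  · rw [hren]
    exact mul_mem (rename_mem_monomials θ₁ hQ) (rename_mem_monomials θ₂ hQ')
  · funext o
    set L : Module.End ℂ W := ∑ m ∈ (rename π₁ Q).support,
      (rename π₁ Q).coeff m • B (o ∘ θ₁ - expo m) with hL
    have hLw : ∀ w, L w = (rename π₁ Q • (fun n => B n w : Ser τ₁ W)) (o ∘ θ₁) := by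
      intro w
      rw [smul_apply, hL, LinearMap.sum_apply]
      rfl
    have hspecA : ∀ w, spec π₁ (A' w) (o ∘ θ₁) = L w := by
      intro w
      rw [hLw, hA']
      exact congrFun ((hspec w).spec_smul_eq (hfin w)) _
    rw [hren, smul_nested hθ, ← hg, ← hLw, ← mapVal_apply L, ← spec_mapVal L hf, spec_apply,
      spec_apply, finsum_mem_def, finsum_mem_def, ← finsum_comp_equiv Φ, finsum_curry]
    · refine finsum_congr fun m => ?_
      by_cases hm : push π₂ m = o ∘ θ₂
      · rw [Set.indicator_of_mem (show m ∈ {n | push π₂ n = o ∘ θ₂} from hm), mapVal_apply,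
          ← hspecA, spec_apply, finsum_mem_def]
        refine finsum_congr fun l => ?_
        by_cases hl : push π₁ l = o ∘ θ₁
        · rw [Set.indicator_of_mem (show l ∈ {n | push π₁ n = o ∘ θ₁} from hl),
            Set.indicator_of_mem (show Φ (m, l) ∈ {n | push π n = o} from (hpush' _ _).mpr ⟨hl, hm⟩),
            hPF']
        · rw [Set.indicator_of_notMem (show l ∉ {n | push π₁ n = o ∘ θ₁} from hl),
            Set.indicator_of_notMem (show Φ (m, l) ∉ {n | push π n = o} from
              fun h => hl ((hpush' _ _).mp h).1)]
      · rw [Set.indicator_of_notMem (show m ∉ {n | push π₂ n = o ∘ θ₂} from hm)]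
        exact finsum_eq_zero_of_forall_eq_zero fun l =>
          Set.indicator_of_notMem (show Φ (m, l) ∉ {n | push π n = o} from
            fun h => hm ((hpush' _ _).mp h).2) _
    · refine (hfinx o).subset fun x hx => ?_
      have hx' : Φ x ∈ {n | push π n = o} := Set.mem_of_indicator_ne_zero hx
      exact ⟨hx', fun h0 => hx ((Set.indicator_of_mem hx' _).trans h0)⟩

end Ser

/-! ### Correlation series of several vertex operators -/

section Correlation

variable {σ W : Type*} [AddCommGroup W] [Module ℂ W]

/-- The operator that is the coefficient of the monomial with exponents `n` in the product, in the
order of the list `l`, of the vertex operators `c i (xᵢ)`. -/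
def corrOp (c : σ → VertexOperator ℂ W) (l : List σ) (n : σ → ℤ) : Module.End ℂ W :=
  (l.map fun i => (HVertexOperator.coeff (c i) (n i) : Module.End ℂ W)).prod

/-- The product of the vertex operators `c i (xᵢ)` in the order of the list `l`, applied to `w`. -/
def corr (c : σ → VertexOperator ℂ W) (l : List σ) (w : W) : Ser σ W := fun n => corrOp c l n w

theorem corrOp_append (c : σ → VertexOperator ℂ W) (l l' : List σ) (n : σ → ℤ) :
    corrOp c (l ++ l') n = corrOp c l n * corrOp c l' n := by
  rw [corrOp, List.map_append, List.prod_append]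
  rfl

theorem corrOp_cons (c : σ → VertexOperator ℂ W) (i : σ) (l : List σ) (n : σ → ℤ) :
    corrOp c (i :: l) n = (HVertexOperator.coeff (c i) (n i) : Module.End ℂ W) * corrOp c l n := by
  rw [corrOp, List.map_cons, List.prod_cons]
  rfl

theorem corrOp_congr {c c' : σ → VertexOperator ℂ W} {l : List σ} {n n' : σ → ℤ}
    (h : ∀ i ∈ l, HVertexOperator.coeff (c i) (n i) = HVertexOperator.coeff (c' i) (n' i)) :
    corrOp c l n = corrOp c' l n' := by
  rw [corrOp, List.map_congr_left h]
  rfl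

theorem corrOp_map {σ' : Type*} (c : σ → VertexOperator ℂ W) (ρ : σ' → σ) (l : List σ')
    (n : σ → ℤ) : corrOp c (l.map ρ) n = corrOp (c ∘ ρ) l (n ∘ ρ) := by
  rw [corrOp, List.map_map]
  rfl

/-- Exchange of two neighbouring vertex operators, after multiplication by a polynomial for which
they commute. -/
theorem corr_swap (c : σ → VertexOperator ℂ W) {p s : List σ} {i j : σ}
    (hnd : (p ++ i :: j :: s).Nodup) {q : MvPolynomial (Unit ⊕ Unit) ℂ}
    (hq : ∀ w, q • cor12 (c i) (c j) w = q • cor21 (c i) (c j) w) (w : W) :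
    rename (Sum.elim (fun _ => i) fun _ => j) q • corr c (p ++ i :: j :: s) w =
      rename (Sum.elim (fun _ => i) fun _ => j) q • corr c (p ++ j :: i :: s) w := by
  have hnd' := List.nodup_append.mp hnd
  simp only [List.nodup_cons, List.mem_cons, not_or] at hnd'
  obtain ⟨-, ⟨⟨hij, his⟩, hjs, -⟩, hdis⟩ := hnd'
  have hip : i ∉ p := fun h => hdis i h i (Or.inl rfl) rfl
  have hjp : j ∉ p := fun h => hdis j h j (Or.inr (Or.inl rfl)) rfl
  set ρ : Unit ⊕ Unit → σ := Sum.elim (fun _ => i) fun _ => j with hρdef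
  have hρ : ρ.Injective := by
    rintro (⟨⟩ | ⟨⟩) (⟨⟩ | ⟨⟩) h
    · rfl
    · exact (hij h).elim
    · exact (hij h.symm).elim
    · rfl
  have hmem : ∀ l : List σ, i ∉ l → j ∉ l → ∀ (a : Unit ⊕ Unit → ℤ) (n : σ → ℤ),
      corrOp c l (Function.extend ρ a n) = corrOp c l n := by
    intro l hi hj a n
    refine corrOp_congr fun k hk => ?_
    rw [Function.extend_apply']
    rintro ⟨(t | t), rfl⟩
    · exact hi hk
    · exact hj hk
  have hei : ∀ (a : Unit ⊕ Unit → ℤ) n, Function.extend ρ a n i = a (.inl ()) := fun a n =>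
    hρ.extend_apply a n (.inl ())
  have hej : ∀ (a : Unit ⊕ Unit → ℤ) n, Function.extend ρ a n j = a (.inr ()) := fun a n =>
    hρ.extend_apply a n (.inr ())
  funext n
  rw [rename_smul_apply hρ, rename_smul_apply hρ]
  have h12 : slice ρ n (corr c (p ++ i :: j :: s) w) =
      mapVal (corrOp c p n) (cor12 (c i) (c j) (corrOp c s n w)) := by
    refine ext_pr fun a b => ?_
    rw [mapVal_apply, cor12_pr, slice, corr, corrOp_append, corrOp_cons, corrOp_cons,
      hmem p hip hjp, hmem s his hjs, hei, hej]
    rfl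
  have h21 : slice ρ n (corr c (p ++ j :: i :: s) w) =
      mapVal (corrOp c p n) (cor21 (c i) (c j) (corrOp c s n w)) := by
    refine ext_pr fun a b => ?_
    rw [mapVal_apply, cor21_pr, slice, corr, corrOp_append, corrOp_cons, corrOp_cons,
      hmem p hip hjp, hmem s his hjs, hei, hej]
    rfl
  rw [h12, h21, ← mapVal_smul, ← mapVal_smul, hq]

/-- The vertex operators `c i` commute in pairs up to polynomials from `G`. -/
def IsLocalFamily (c : σ → VertexOperator ℂ W) (G : Submonoid (MvPolynomial σ ℂ)) : Prop :=
  ∀ i j, i ≠ j → ∃ q : MvPolynomial (Unit ⊕ Unit) ℂ,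
    rename (Sum.elim (fun _ => i) fun _ => j) q ∈ G ∧
      ∀ w, q • cor12 (c i) (c j) w = q • cor21 (c i) (c j) w

variable {c : σ → VertexOperator ℂ W} {G : Submonoid (MvPolynomial σ ℂ)}

theorem IsLocalFamily.exists_corr_append_eq (hc : IsLocalFamily c G) {l l' : List σ} (h : l.Perm l') :
    ∀ p : List σ, (p ++ l).Nodup →
      ∃ Q ∈ G, ∀ w, Q • corr c (p ++ l) w = Q • corr c (p ++ l') w := by
  induction h with
  | nil => exact fun p _ => ⟨1, one_mem _, fun _ => rfl⟩
  | cons x _ ih =>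
    intro p hp
    have := ih (p ++ [x]) (by rwa [List.append_assoc])
    simpa only [List.append_assoc, List.singleton_append] using this
  | swap x y l =>
    intro p hp
    have hyx : y ≠ x := by
      have := (List.nodup_append.mp hp).2.1
      simp only [List.nodup_cons, List.mem_cons, not_or] at this
      exact this.1.1
    obtain ⟨q, hqG, hq⟩ := hc y x hyx
    exact ⟨_, hqG, corr_swap c hp hq⟩
  | trans h₁ _ ih₁ ih₂ =>
    intro p hp
    obtain ⟨Q₁, hQ₁, h₁'⟩ := ih₁ p hp
    obtain ⟨Q₂, hQ₂, h₂'⟩ := ih₂ p (((h₁.append_left p).nodup_iff).mp hp)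
    refine ⟨Q₁ * Q₂, mul_mem hQ₁ hQ₂, fun w => ?_⟩
    rw [mul_comm, mul_smul, h₁', smul_comm, h₂', ← mul_smul, mul_comm]

/-- The order of the vertex operators does not matter, up to a polynomial from `G`. -/
theorem IsLocalFamily.exists_corr_eq (hc : IsLocalFamily c G) {l l' : List σ} (h : l.Perm l')
    (hl : l.Nodup) : ∃ Q ∈ G, ∀ w, Q • corr c l w = Q • corr c l' w :=
  hc.exists_corr_append_eq h [] hl

theorem corr_append_singleton_mem_truncIn (c : σ → VertexOperator ℂ W) (l : List σ) (i : σ) (w : W) :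
    corr c (l ++ [i]) w ∈ truncIn W i := by
  obtain ⟨B, hB⟩ := exists_coeff_eq_zero (c i) w
  refine ⟨B, fun n hn => ?_⟩
  rw [corr, corrOp_append, corrOp_cons, Module.End.mul_apply, Module.End.mul_apply]
  simp only [corrOp, List.map_nil, List.prod_nil, Module.End.one_apply]
  rw [hB _ hn, map_zero]

/-- Up to a polynomial from `G`, the powers of all variables are bounded below. -/
theorem IsLocalFamily.exists_smul_mem_trunc [Fintype σ] (hc : IsLocalFamily c G) {l : List σ}
    (hl : l.Nodup) (hmem : ∀ i, i ∈ l) : ∃ Q ∈ G, ∀ w, Q • corr c l w ∈ trunc σ W := by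
  classical
  have h : ∀ i, ∃ Q ∈ G, ∀ w, Q • corr c l w ∈ truncIn W i := by
    intro i
    have hp : l.Perm (l.erase i ++ [i]) :=
      (List.perm_cons_erase (hmem i)).trans (List.perm_append_singleton i _).symm
    obtain ⟨Q, hQ, h⟩ := hc.exists_corr_eq hp hl
    refine ⟨Q, hQ, fun w => ?_⟩
    rw [h]
    exact Submodule.smul_mem _ _ (corr_append_singleton_mem_truncIn c _ i w)
  choose Q hQ hQ' using h
  refine ⟨∏ i, Q i, prod_mem fun i _ => hQ i, fun w => mem_trunc.mpr fun i => ?_⟩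
  rw [← Finset.prod_erase_mul _ _ (Finset.mem_univ i), mul_smul]
  exact Submodule.smul_mem _ _ (hQ' i w)

end Correlation

/-! ### The vertex operators of the tensor positions -/

section

variable {W : Type*} [AddCommGroup W] [Module ℂ W]

/-- The vertex operator with given coefficients. -/
def vertexOp (f : ℤ → Module.End ℂ W) (hf : ∀ w, ∃ B : ℤ, ∀ n, n < B → f n w = 0) :
    VertexOperator ℂ W :=
  HVertexOperator.of_coeff f fun w => Set.IsWF.isPWO (BddBelow.isWF (by
    obtain ⟨B, hB⟩ := hf w
    exact ⟨B, fun n hn => not_lt.mp fun hlt => hn (hB n hlt)⟩))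

theorem coeff_vertexOp (f : ℤ → Module.End ℂ W) (hf : ∀ w, ∃ B : ℤ, ∀ n, n < B → f n w = 0)
    (n : ℤ) : HVertexOperator.coeff (vertexOp f hf) n = f n :=
  congrFun (HVertexOperator.coeff_of_coeff f _) n

end

namespace GradedVertexAlgebra

variable {V W : Type*} [AddCommGroup V] [Module ℂ V] [AddCommGroup W] [Module ℂ W]
  (A : GradedVertexAlgebra V) (YW : V →ₗ[ℂ] VertexOperator ℂ W)

theorem exists_twist_coeff_eq_zero (β : ℂˣ) (u : V) (w : W) : ∃ B : ℤ, ∀ n, n < B →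
    (((β ^ n : ℂˣ) : ℂ) • HVertexOperator.coeff (YW (A.powL0 β u)) n) w = 0 := by
  obtain ⟨B, hB⟩ := exists_coeff_eq_zero (YW (A.powL0 β u)) w
  exact ⟨B, fun n hn => by rw [LinearMap.smul_apply, hB n hn, smul_zero]⟩

/-- The vertex operators `Y_W(β ^ L(0) u, β x)`. -/
def twistY (β : ℂˣ) : V →ₗ[ℂ] VertexOperator ℂ W where
  toFun u := vertexOp (fun n => ((β ^ n : ℂˣ) : ℂ) • HVertexOperator.coeff (YW (A.powL0 β u)) n)
    (A.exists_twist_coeff_eq_zero YW β u)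
  map_add' u v := HVertexOperator.coeff_inj (funext fun n => by
    rw [map_add HVertexOperator.coeff, Pi.add_apply]
    simp only [coeff_vertexOp, map_add, Pi.add_apply, smul_add])
  map_smul' c u := HVertexOperator.coeff_inj (funext fun n => by
    rw [map_smul HVertexOperator.coeff, Pi.smul_apply]
    simp only [coeff_vertexOp, map_smul, Pi.smul_apply, smul_comm c, RingHom.id_apply])

theorem coeff_twistY (β : ℂˣ) (u : V) (n : ℤ) :
    HVertexOperator.coeff (A.twistY YW β u) n =
      ((β ^ n : ℂˣ) : ℂ) • HVertexOperator.coeff (YW (A.powL0 β u)) n := 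
  coeff_vertexOp _ (A.exists_twist_coeff_eq_zero YW β u) n

theorem twistY_one : A.twistY YW 1 = YW := by
  refine LinearMap.ext fun u => HVertexOperator.coeff_inj (funext fun n => ?_)
  rw [coeff_twistY, powL0_one, one_zpow, Units.val_one, one_smul, Module.End.one_apply]

theorem twistY_powL0 (β γ : ℂˣ) (u : V) (n : ℤ) :
    HVertexOperator.coeff (A.twistY YW (γ * β) (A.powL0 γ⁻¹ u)) n =
      ((γ ^ n : ℂˣ) : ℂ) • HVertexOperator.coeff (A.twistY YW β u) n := by
  rw [coeff_twistY, coeff_twistY, mul_comm γ β, powL0_mul, Module.End.mul_apply, powL0_inv_apply,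
    smul_smul, ← Units.val_mul, mul_zpow, mul_comm (γ ^ n)]

theorem cor12_twistY (β γ : ℂˣ) (u v : V) (w : W) :
    cor12 (A.twistY YW β u) (A.twistY YW γ v) w =
      scale β γ (cor12 (YW (A.powL0 β u)) (YW (A.powL0 γ v)) w) := by
  refine ext_pr fun a b => ?_
  rw [scale_pr, cor12_pr, cor12_pr, coeff_twistY, coeff_twistY]
  simp only [LinearMap.smul_apply, map_smul, smul_smul, Units.val_mul, mul_comm]

theorem cor21_twistY (β γ : ℂˣ) (u v : V) (w : W) :
    cor21 (A.twistY YW β u) (A.twistY YW γ v) w =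
      scale β γ (cor21 (YW (A.powL0 β u)) (YW (A.powL0 γ v)) w) := by
  refine ext_pr fun a b => ?_
  rw [scale_pr, cor21_pr, cor21_pr, coeff_twistY, coeff_twistY]
  simp only [LinearMap.smul_apply, map_smul, smul_smul, Units.val_mul]

theorem iter_twistY (β : ℂˣ) (u v : V) (w : W) :
    iter A.toVertexData (A.twistY YW β) u v w =
      scale β β (iter A.toVertexData YW (A.powL0 β u) (A.powL0 β v) w) := by
  refine ext_pr fun a b => ?_
  rw [scale_pr, iter_pr, iter_pr, coeff_twistY, powL0_coeff]
  simp only [map_smul, Pi.smul_apply, LinearMap.smul_apply, smul_smul, Units.val_mul, mul_comm]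

theorem scalePoly_linPoly_one (β : ℂˣ) : scalePoly β β (linPoly 1) = C (β : ℂ) * linPoly 1 := by
  simp only [linPoly, scalePoly, map_sub, aeval_X, Sum.elim_inl, Sum.elim_inr, C_1, one_mul]
  ring

/-- The vertex operators of each position satisfy the Jacobi identity. -/
theorem isIterateWith_twistY (β : ℂˣ) {u v : V} {k : ℕ}
    (h : IsIterateWith A.toVertexData YW (A.powL0 β u) (A.powL0 β v) (linPoly 1 ^ k)) :
    IsIterateWith A.toVertexData (A.twistY YW β) u v (linPoly 1 ^ k) := by
  intro w
  obtain ⟨h1, h2⟩ := h w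
  have hs : ∀ f : Ser (Unit ⊕ Unit) W, linPoly 1 ^ k • scale β β f =
      ((β⁻¹ ^ k : ℂˣ) : ℂ) • scale β β (linPoly 1 ^ k • f) := by
    intro f
    rw [scale_smul, map_pow, scalePoly_linPoly_one, mul_pow, mul_smul, ← C_pow, C_smul, smul_smul,
      ← Units.val_pow_eq_pow_val, ← Units.val_mul, ← mul_pow, inv_mul_cancel, one_pow, Units.val_one, one_smul]
  have hx : ∀ f : Ser (Unit ⊕ Unit) W, (X (.inl ()) ^ k : MvPolynomial (Unit ⊕ Unit) ℂ) •
      scale β β f = ((β⁻¹ ^ k : ℂˣ) : ℂ) •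
        scale β β ((X (.inl ()) ^ k : MvPolynomial (Unit ⊕ Unit) ℂ) • f) := by
    intro f
    have hX : scalePoly β β (X (.inl ())) = C (β : ℂ) * X (.inl ()) := by simp [scalePoly]
    rw [scale_smul, map_pow, hX, mul_pow, mul_smul, ← C_pow, C_smul, smul_smul,
      ← Units.val_pow_eq_pow_val, ← Units.val_mul, ← mul_pow, inv_mul_cancel, one_pow, Units.val_one, one_smul]
  rw [map_pow, taylorPoly_linPoly_one] at h2 ⊢
  refine ⟨?_, ?_⟩
  · rw [cor12_twistY, cor21_twistY, hs, hs, h1]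
  · rw [cor12_twistY, iter_twistY, hs, hx, taylor_csmul, taylor_scale, h2]

/-- The polynomial `β x₁ - γ x₂`. -/
def posPoly (β γ : ℂˣ) : MvPolynomial (Unit ⊕ Unit) ℂ :=
  C (β : ℂ) * X (.inl ()) - C (γ : ℂ) * X (.inr ())

theorem scalePoly_linPoly_eq_posPoly (β γ : ℂˣ) : scalePoly β γ (linPoly 1) = posPoly β γ := by
  simp [linPoly, scalePoly, posPoly]

theorem local_twistY (β γ : ℂˣ) {u v : V} {k : ℕ}
    (h : IsIterateWith A.toVertexData YW (A.powL0 β u) (A.powL0 γ v) (linPoly 1 ^ k)) (w : W) :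
    posPoly β γ ^ k • cor12 (A.twistY YW β u) (A.twistY YW γ v) w =
      posPoly β γ ^ k • cor21 (A.twistY YW β u) (A.twistY YW γ v) w := by
  rw [cor12_twistY, cor21_twistY, ← scalePoly_linPoly_eq_posPoly, ← map_pow, ← scale_smul,
    ← scale_smul, (h w).1]

end GradedVertexAlgebra

/-! ### The specialized product of the vertex operators of all positions -/

section PositionFields

variable {V W : Type*} [AddCommGroup V] [Module ℂ V] [AddCommGroup W] [Module ℂ W]

/-- A family of vertex operator maps, one for each tensor position, each of which is a module
structure, and for which those of the positions `i` and `j` are local with poles at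
`βᵢ x₁ = βⱼ x₂` only. -/
structure PositionFields (A : VertexData V) {N : ℕ} (β : Fin N → ℂˣ)
    (y : Fin N → V →ₗ[ℂ] VertexOperator ℂ W) : Prop where
  injective : Function.Injective β
  vacuum : ∀ i, IsIdentitySeries (y i A.vac)
  isLocal : ∀ i j u v, ∃ k : ℕ, ∀ w,
    GradedVertexAlgebra.posPoly (β i) (β j) ^ k • cor12 (y i u) (y j v) w =
      GradedVertexAlgebra.posPoly (β i) (β j) ^ k • cor21 (y i u) (y j v) w
  iterate : ∀ i u v, ∃ k : ℕ, IsIterateWith A (y i) u v (linPoly 1 ^ k)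

theorem rename_posPoly {σ : Type*} (s t : σ) (b b' : ℂˣ) :
    rename (Sum.elim (fun _ => s) fun _ => t) (GradedVertexAlgebra.posPoly b b') =
      C (b : ℂ) * X s - C (b' : ℂ) * X t := by
  simp [GradedVertexAlgebra.posPoly]

/-- The map that identifies all the variables. -/
abbrev oneBlock (ι : Type*) : ι → Unit := fun _ => ()

variable {A : VertexData V} {N : ℕ} {β : Fin N → ℂˣ} {y : Fin N → V →ₗ[ℂ] VertexOperator ℂ W}

namespace PositionFields

/-- The product over all positions, as a multilinear function of the vectors. -/
def corrMulti (y : Fin N → V →ₗ[ℂ] VertexOperator ℂ W) (n : Fin N → ℤ) :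
    MultilinearMap ℂ (fun _ : Fin N => V) (Module.End ℂ W) :=
  (MultilinearMap.mkPiAlgebraFin ℂ N (Module.End ℂ W)).compLinearMap fun i =>
    (LinearMap.proj (n i) : (ℤ → Module.End ℂ W) →ₗ[ℂ] Module.End ℂ W) ∘ₗ HVertexOperator.coeff ∘ₗ y i

theorem corrOp_finRange (y : Fin N → V →ₗ[ℂ] VertexOperator ℂ W) (v : Fin N → V) (n : Fin N → ℤ) :
    corrOp (fun i => y i (v i)) (List.finRange N) n = corrMulti y n v := by
  rw [corrMulti, MultilinearMap.compLinearMap_apply, MultilinearMap.mkPiAlgebraFin_apply,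
    List.ofFn_eq_map]
  rfl

variable (h : PositionFields A β y)
include h

/-- The polynomials needed for locality become monomials when the variables are identified, because the
scalars `βᵢ` are distinct. -/
theorem isLocalFamily (v : Fin N → V) : IsLocalFamily (fun i => y i (v i))
    ((monomials Unit).comap (rename (oneBlock (Fin N)) : _ →ₐ[ℂ] MvPolynomial Unit ℂ)) := by
  intro i j hij
  obtain ⟨k, hk⟩ := h.isLocal i j (v i) (v j)
  refine ⟨_, ?_, hk⟩
  rw [Submonoid.mem_comap, map_pow, map_pow, rename_posPoly]
  refine pow_mem ?_ k
  have : (rename (oneBlock (Fin N)) : _ →ₐ[ℂ] MvPolynomial Unit ℂ)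
      (C (β i : ℂ) * X i - C (β j : ℂ) * X j) = C ((β i : ℂ) - β j) * X () := by
    simp [sub_mul]
  rw [this]
  exact mul_mem (C_mem_monomials (sub_ne_zero.mpr fun e => hij (h.injective (Units.ext e))))
    (X_mem_monomials ())

theorem exists_smul_mem_trunc (v : Fin N → V) : ∃ Q : MvPolynomial (Fin N) ℂ,
    rename (oneBlock (Fin N)) Q ∈ monomials Unit ∧
      ∀ w, Q • corr (fun i => y i (v i)) (List.finRange N) w ∈ trunc (Fin N) W :=
  (h.isLocalFamily v).exists_smul_mem_trunc (List.nodup_finRange N) List.mem_finRange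

theorem exists_diag (v : Fin N → V) (w : W) : ∃ g : Ser Unit W,
    IsSpec (oneBlock (Fin N)) (corr (fun i => y i (v i)) (List.finRange N) w) g := by
  obtain ⟨Q, hQ, hf⟩ := h.exists_smul_mem_trunc v
  exact exists_isSpec hQ (trunc_le_finDeg_push _ (hf w))

/-- The series `Y₁(v₁, x) ⋯ Y_N(v_N, x) w`, defined by localization. -/
def diag (v : Fin N → V) (w : W) : Ser Unit W := Classical.choose (h.exists_diag v w)

theorem isSpec_diag (v : Fin N → V) (w : W) : IsSpec (oneBlock (Fin N))
    (corr (fun i => y i (v i)) (List.finRange N) w) (h.diag v w) :=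
  Classical.choose_spec (h.exists_diag v w)

theorem diag_add (v : Fin N → V) (w w' : W) : h.diag v (w + w') = h.diag v w + h.diag v w' := by
  refine (h.isSpec_diag v (w + w')).unique ?_
  have : corr (fun i => y i (v i)) (List.finRange N) (w + w') =
      corr (fun i => y i (v i)) (List.finRange N) w +
        corr (fun i => y i (v i)) (List.finRange N) w' := funext fun n => map_add _ _ _
  rw [this]
  exact (h.isSpec_diag v w).add (h.isSpec_diag v w')

theorem diag_csmul (v : Fin N → V) (c : ℂ) (w : W) : h.diag v (c • w) = c • h.diag v w := by
  refine (h.isSpec_diag v (c • w)).unique ?_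
  have : corr (fun i => y i (v i)) (List.finRange N) (c • w) =
      c • corr (fun i => y i (v i)) (List.finRange N) w := funext fun n => map_smul _ _ _
  rw [this]
  exact (h.isSpec_diag v w).csmul c

theorem exists_diag_eq_zero (v : Fin N → V) (w : W) :
    ∃ B : ℤ, ∀ n, n < B → h.diag v w (fun _ => n) = 0 := by
  obtain ⟨Q, hQ, hf⟩ := h.exists_smul_mem_trunc v
  obtain ⟨B, hB⟩ := mem_trunc.mp ((h.isSpec_diag v w).mem_trunc hQ (hf w)) ()
  exact ⟨B, fun n hn => hB _ hn⟩

/-- The coefficients of `Y₁(v₁, x) ⋯ Y_N(v_N, x)`. -/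
def diagOp (v : Fin N → V) (o : Unit → ℤ) : Module.End ℂ W where
  toFun w := h.diag v w o
  map_add' w w' := by rw [diag_add]; rfl
  map_smul' c w := by rw [diag_csmul]; rfl

theorem exists_diagOp_eq_zero (v : Fin N → V) (w : W) :
    ∃ B : ℤ, ∀ n, n < B → h.diagOp v (fun _ => n) w = 0 := h.exists_diag_eq_zero v w

/-- The vertex operator `Y₁(v₁, x) ⋯ Y_N(v_N, x)`. -/
def diagVertexOp (v : Fin N → V) : VertexOperator ℂ W :=
  vertexOp (fun n => h.diagOp v fun _ => n) (h.exists_diagOp_eq_zero v)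

theorem coeff_diagVertexOp (v : Fin N → V) (n : ℤ) (w : W) :
    HVertexOperator.coeff (h.diagVertexOp v) n w = h.diag v w fun _ => n :=
  LinearMap.congr_fun (coeff_vertexOp _ (h.exists_diagOp_eq_zero v) n) w

theorem diagVertexOp_eq {v : Fin N → V} {a : VertexOperator ℂ W}
    (ha : ∀ w, IsSpec (oneBlock (Fin N)) (corr (fun i => y i (v i)) (List.finRange N) w)
      fun o => HVertexOperator.coeff a (o ()) w) : h.diagVertexOp v = a := by
  refine HVertexOperator.coeff_inj (funext fun n => LinearMap.ext fun w => ?_)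
  rw [coeff_diagVertexOp, (h.isSpec_diag v w).unique (ha w)]

theorem isSpec_coeff_diagVertexOp (v : Fin N → V) (w : W) : IsSpec (oneBlock (Fin N))
    (corr (fun i => y i (v i)) (List.finRange N) w)
      fun o => HVertexOperator.coeff (h.diagVertexOp v) (o ()) w := by
  have : (fun o => HVertexOperator.coeff (h.diagVertexOp v) (o ()) w) = h.diag v w :=
    funext fun o => h.coeff_diagVertexOp v (o ()) w
  rw [this]
  exact h.isSpec_diag v w

/-- The vertex operators `Y₁(v₁, x) ⋯ Y_N(v_N, x)` as a multilinear map. -/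
def diagMulti : MultilinearMap ℂ (fun _ : Fin N => V) (VertexOperator ℂ W) where
  toFun := h.diagVertexOp
  map_update_add' v i a b := by
    refine h.diagVertexOp_eq fun w => ?_
    have e : corr (fun j => y j (Function.update v i (a + b) j)) (List.finRange N) w =
        corr (fun j => y j (Function.update v i a j)) (List.finRange N) w +
          corr (fun j => y j (Function.update v i b j)) (List.finRange N) w := by
      funext n
      simp only [corr, Pi.add_apply, corrOp_finRange, MultilinearMap.map_update_add,
        LinearMap.add_apply]
    rw [e, map_add]
    exact (h.isSpec_coeff_diagVertexOp _ w).add (h.isSpec_coeff_diagVertexOp _ w)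
  map_update_smul' v i c a := by
    refine h.diagVertexOp_eq fun w => ?_
    have e : corr (fun j => y j (Function.update v i (c • a) j)) (List.finRange N) w =
        c • corr (fun j => y j (Function.update v i a j)) (List.finRange N) w := by
      funext n
      simp only [corr, Pi.smul_apply, corrOp_finRange, MultilinearMap.map_update_smul,
        LinearMap.smul_apply]
    rw [e, map_smul]
    exact (h.isSpec_coeff_diagVertexOp _ w).csmul c

/-- The extension of the vertex operators of the positions to the tensor power. -/
def extend : (⨂[ℂ] _ : Fin N, V) →ₗ[ℂ] VertexOperator ℂ W := PiTensorProduct.lift h.diagMulti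

theorem extend_tprod (v : Fin N → V) : h.extend (⨂ₜ[ℂ] i, v i) = h.diagVertexOp v :=
  PiTensorProduct.lift.tprod v

theorem isSpec_extend (v : Fin N → V) (w : W) : IsSpec (oneBlock (Fin N))
    (corr (fun i => y i (v i)) (List.finRange N) w)
      fun o => HVertexOperator.coeff (h.extend (⨂ₜ[ℂ] i, v i)) (o ()) w := by
  rw [extend_tprod]
  exact h.isSpec_coeff_diagVertexOp v w

/-- The extension of a vector in a single position, with the vacuum in all others, is the given field of
that position. -/
theorem extend_update_vac (i : Fin N) (u : V) :
    h.extend (⨂ₜ[ℂ] j, Function.update (fun _ => A.vac) i u j) = y i u := by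
  rw [extend_tprod]
  refine h.diagVertexOp_eq fun w => ?_
  set v : Fin N → V := Function.update (fun _ => A.vac) i u with hv
  have hne : ∀ j, j ≠ i → v j = A.vac := fun j hj => Function.update_of_ne hj _ _
  have h0 : ∀ n : Fin N → ℤ, (∃ j, j ≠ i ∧ n j ≠ 0) →
      corr (fun i => y i (v i)) (List.finRange N) w n = 0 := by
    rintro n ⟨j, hj, hn⟩
    have : corrOp (fun i => y i (v i)) (List.finRange N) n = 0 := by
      refine List.prod_eq_zero (List.mem_map.mpr ⟨j, List.mem_finRange j, ?_⟩)
      change HVertexOperator.coeff (y j (v j)) (n j) = 0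
      rw [hne j hj, h.vacuum j, if_neg hn]
    rw [corr, this, LinearMap.zero_apply]
  have h1 : ∀ m : ℤ, corr (fun i => y i (v i)) (List.finRange N) w (Pi.single i m) =
      HVertexOperator.coeff (y i u) m w := by
    intro m
    obtain ⟨s, t, hst⟩ := List.append_of_mem (List.mem_finRange i)
    have hnd : (s ++ i :: t).Nodup := hst ▸ List.nodup_finRange N
    have hi : i ∉ s ∧ i ∉ t := by
      have h2 := List.nodup_append.mp hnd
      exact ⟨fun hs => h2.2.2 i hs i List.mem_cons_self rfl, (List.nodup_cons.mp h2.2.1).1⟩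
    have hone : ∀ l : List (Fin N), i ∉ l →
        corrOp (fun i => y i (v i)) l (Pi.single i m) = 1 := by
      intro l hl
      refine List.prod_eq_one fun x hx => ?_
      obtain ⟨j, hj, rfl⟩ := List.mem_map.mp hx
      have hji : j ≠ i := fun e => hl (e ▸ hj)
      change HVertexOperator.coeff (y j (v j)) (Pi.single (M := fun _ => ℤ) i m j) = 1
      rw [hne j hji, h.vacuum j, Pi.single_eq_of_ne hji, if_pos rfl]
      rfl
    rw [corr, hst, corrOp_append, corrOp_cons, hone s hi.1, hone t hi.2, one_mul, mul_one,
      Pi.single_eq_same, hv, Function.update_self]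
  have hsing : ∀ (n : Fin N → ℤ) (o : Unit → ℤ), push (oneBlock (Fin N)) n = o →
      corr (fun i => y i (v i)) (List.finRange N) w n ≠ 0 → n = Pi.single i (o ()) := by
    intro n o hn hc
    have hz : ∀ j, j ≠ i → n j = 0 := fun j hj => by
      by_contra hnj
      exact hc (h0 n ⟨j, hj, hnj⟩)
    funext j
    by_cases hj : j = i
    · subst hj
      rw [Pi.single_eq_same, ← hn, push_apply, Finset.filter_true_of_mem (fun _ _ => rfl),
        Finset.sum_eq_single j (fun k _ hk => hz k hk) (by simp)]
    · rw [Pi.single_eq_of_ne hj, hz j hj]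
  have hpush : ∀ o : Unit → ℤ, push (oneBlock (Fin N)) (Pi.single i (o ())) = o := by
    intro o
    funext t
    rw [push_apply, Finset.filter_true_of_mem (fun _ _ => rfl), Finset.sum_pi_single']
    simp
  have hfin : corr (fun i => y i (v i)) (List.finRange N) w ∈
      finDeg W (push (oneBlock (Fin N))) := fun o =>
    (Set.finite_singleton (Pi.single i (o ()))).subset fun n hn =>
      Set.mem_singleton_iff.mpr (hsing n o hn.1 hn.2)
  have hs := isSpec_of_mem_finDeg hfin
  have e : spec (oneBlock (Fin N)) (corr (fun i => y i (v i)) (List.finRange N) w) =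
      fun o => HVertexOperator.coeff (y i u) (o ()) w := by
    funext o
    rw [spec_injective_eq _ o _ (fun n hn hp => hsing n o hp hn) (hpush o), h1]
  rwa [e] at hs

end PositionFields

end PositionFields

/-! ### Ordered products of operator-valued series -/

section OrderedProduct

variable {W : Type*} [AddCommGroup W] [Module ℂ W]

/-- A product of pointwise finite sums of operators is the sum of the products. -/
theorem finsum_mkPiAlgebraFin {P : Type*} {N : ℕ} (G : Fin N → P → Module.End ℂ W)
    (H : Fin N → Module.End ℂ W) (hfin : ∀ i w, (Function.support fun p => G i p w).Finite)
    (hH : ∀ i w, ∑ᶠ p, G i p w = H i w) (w : W) :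
    (Function.support fun a : Fin N → P =>
      MultilinearMap.mkPiAlgebraFin ℂ N (Module.End ℂ W) (fun i => G i (a i)) w).Finite ∧
    ∑ᶠ a : Fin N → P, MultilinearMap.mkPiAlgebraFin ℂ N (Module.End ℂ W) (fun i => G i (a i)) w =
      MultilinearMap.mkPiAlgebraFin ℂ N (Module.End ℂ W) H w := by
  induction N with
  | zero =>
    refine ⟨Set.toFinite _, ?_⟩
    rw [finsum_unique]
    simp
  | succ N ih =>
    obtain ⟨ih1, ih2⟩ := ih (fun i => G i.succ) (fun i => H i.succ) (fun i => hfin i.succ)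
      (fun i => hH i.succ)
    have hcons : ∀ (p : P) (a : Fin N → P),
        MultilinearMap.mkPiAlgebraFin ℂ (N + 1) (Module.End ℂ W)
          (fun i => G i ((Fin.cons p a : Fin (N + 1) → P) i)) w =
        G 0 p (MultilinearMap.mkPiAlgebraFin ℂ N (Module.End ℂ W) (fun i => G i.succ (a i)) w) := by
      intro p a
      simp [MultilinearMap.mkPiAlgebraFin_apply, List.ofFn_succ]
    let e : (Fin N → P) × P ≃ (Fin (N + 1) → P) :=
      (Equiv.prodComm _ _).trans (Fin.consEquiv fun _ => P)
    have he : ∀ x, MultilinearMap.mkPiAlgebraFin ℂ (N + 1) (Module.End ℂ W)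
        (fun i => G i (e x i)) w =
        G 0 x.2 (MultilinearMap.mkPiAlgebraFin ℂ N (Module.End ℂ W) (fun i => G i.succ (x.1 i)) w) :=
      fun x => hcons x.2 x.1
    have hfinx : (Function.support fun x : (Fin N → P) × P => G 0 x.2
        (MultilinearMap.mkPiAlgebraFin ℂ N (Module.End ℂ W) (fun i => G i.succ (x.1 i)) w)).Finite := by
      refine (ih1.biUnion fun a _ => (hfin 0 (MultilinearMap.mkPiAlgebraFin ℂ N (Module.End ℂ W)
        (fun i => G i.succ (a i)) w)).image fun p => (a, p)).subset ?_
      rintro ⟨a, p⟩ hx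
      refine Set.mem_biUnion (x := a) (fun h0 => hx ?_) ⟨p, hx, rfl⟩
      simp only at h0 ⊢
      rw [h0, map_zero]
    refine ⟨?_, ?_⟩
    · refine (hfinx.image e).subset fun a ha => ⟨e.symm a, ?_, e.apply_symm_apply a⟩
      rw [Function.mem_support, ← he, e.apply_symm_apply]
      exact ha
    · rw [← finsum_comp_equiv e, finsum_congr he, finsum_curry _ hfinx]
      simp only [hH]
      have : MultilinearMap.mkPiAlgebraFin ℂ (N + 1) (Module.End ℂ W) H w =
          H 0 (MultilinearMap.mkPiAlgebraFin ℂ N (Module.End ℂ W) (fun i => H i.succ) w) := by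
        simp [MultilinearMap.mkPiAlgebraFin_apply, List.ofFn_succ]
      rw [this, ← ih2]
      exact ((H 0).toAddMonoidHom.map_finsum ih1).symm

variable {N : ℕ}

/-- The variables of the pair with index `i`. -/
def pairVars (i : Fin N) : Unit ⊕ Unit → Fin N ⊕ Fin N := Sum.map (fun _ => i) fun _ => i

theorem pairVars_injective (i : Fin N) : (pairVars i).Injective := by
  rintro (⟨⟩ | ⟨⟩) (⟨⟩ | ⟨⟩) h
  · rfl
  · cases h
  · cases h
  · rfl

theorem pairVars_ne {i j : Fin N} (hij : i ≠ j) (s t : Unit ⊕ Unit) :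
    pairVars i s ≠ pairVars j t := by
  rintro h
  rcases s with s | s <;> rcases t with t | t <;> simp [pairVars] at h <;> exact hij h

/-- The ordered product of operator-valued series, each in its own pair of variables. -/
def prodSer (D : Fin N → Ser (Unit ⊕ Unit) (Module.End ℂ W)) : Ser (Fin N ⊕ Fin N) (Module.End ℂ W) :=
  fun n => MultilinearMap.mkPiAlgebraFin ℂ N (Module.End ℂ W) fun i => D i (n ∘ pairVars i)

theorem smul_prodSer (D : Fin N → Ser (Unit ⊕ Unit) (Module.End ℂ W)) (i : Fin N)
    (p : MvPolynomial (Unit ⊕ Unit) ℂ) :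
    rename (pairVars i) p • prodSer D = prodSer (Function.update D i (p • D i)) := by
  funext n
  have hi : ∀ a : Unit ⊕ Unit → ℤ, Function.extend (pairVars i) a n ∘ pairVars i = a := fun a =>
    funext fun t => (pairVars_injective i).extend_apply _ _ _
  have hj : ∀ (a : Unit ⊕ Unit → ℤ) (j), j ≠ i →
      Function.extend (pairVars i) a n ∘ pairVars j = n ∘ pairVars j := fun a j hji =>
    funext fun t => Function.extend_apply' _ _ _ fun ⟨s, hs⟩ => pairVars_ne hji.symm s t hs
  have hs : ∀ (D' : Ser (Unit ⊕ Unit) (Module.End ℂ W)) (a : Unit ⊕ Unit → ℤ),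
      (fun j => (Function.update D i D' j) (Function.extend (pairVars i) a n ∘ pairVars j)) =
        Function.update (fun j => D j (n ∘ pairVars j)) i (D' a) := by
    intro D' a
    funext j
    by_cases hji : j = i
    · subst hji
      rw [Function.update_self, Function.update_self, hi]
    · rw [Function.update_of_ne hji, Function.update_of_ne hji, hj a j hji]
  have hsl : slice (pairVars i) n (prodSer D) =
      mapVal ((MultilinearMap.mkPiAlgebraFin ℂ N (Module.End ℂ W)).toLinearMap
        (fun j => D j (n ∘ pairVars j)) i) (D i) := by
    funext a
    have := hs (D i) a
    rw [Function.update_eq_self] at this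
    rw [slice, prodSer, this]
    rfl
  rw [rename_smul_apply (pairVars_injective i), hsl, ← mapVal_smul, mapVal_apply]
  have := hs (p • D i) (n ∘ pairVars i)
  have hext : Function.extend (pairVars i) (n ∘ pairVars i) n = n := by
    funext k
    by_cases hk : ∃ t, pairVars i t = k
    · obtain ⟨t, rfl⟩ := hk
      rw [(pairVars_injective i).extend_apply]
      rfl
    · rw [Function.extend_apply' _ _ _ hk]
  rw [hext] at this
  rw [prodSer, this]
  rfl

theorem prod_smul_prodSer (D : Fin N → Ser (Unit ⊕ Unit) (Module.End ℂ W))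
    (p : Fin N → MvPolynomial (Unit ⊕ Unit) ℂ) :
    (∏ i, rename (pairVars i) (p i)) • prodSer D = prodSer fun i => p i • D i := by
  have h : ∀ s : Finset (Fin N), (∏ i ∈ s, rename (pairVars i) (p i)) • prodSer D =
      prodSer fun i => if i ∈ s then p i • D i else D i := by
    intro s
    induction s using Finset.induction_on with
    | empty => simp
    | insert i s hi ih =>
      rw [Finset.prod_insert hi, mul_smul, ih, smul_prodSer]
      congr 1
      funext j
      by_cases hj : j = i
      · subst hj
        simp [hi]
      · simp [hj]
  simpa using h Finset.univ

/-- The Taylor expansion acts separately on each pair of variables. -/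
theorem taylorKer_eq_prod (o n : Fin N ⊕ Fin N → ℤ) :
    taylorKer (Fin N) o n = ∏ i, taylorKer Unit (o ∘ pairVars i) (n ∘ pairVars i) := by
  have h : ∀ i, taylorKer Unit (o ∘ pairVars i) (n ∘ pairVars i) =
      if n (.inl i) + n (.inr i) = o (.inl i) + o (.inr i) then bin (n (.inl i)) (o (.inl i))
        else 0 := by
    intro i
    have : pairDeg Unit (n ∘ pairVars i) = pairDeg Unit (o ∘ pairVars i) ↔
        n (.inl i) + n (.inr i) = o (.inl i) + o (.inr i) :=
      ⟨fun h => congrFun h (), fun h => funext fun _ => h⟩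
    simp only [taylorKer, this, Finset.univ_unique, Finset.prod_singleton]
    rfl
  rw [Finset.prod_congr rfl fun i _ => h i, taylorKer]
  split_ifs with hd
  · exact Finset.prod_congr rfl fun i _ => (if_pos (congrFun hd i)).symm
  · obtain ⟨i, hi⟩ := Function.ne_iff.mp hd
    exact (Finset.prod_eq_zero (Finset.mem_univ i) (if_neg hi)).symm

/-- The Taylor expansion of an ordered product of series in separate pairs of variables. -/
theorem taylor_prodSer (D H : Fin N → Ser (Unit ⊕ Unit) (Module.End ℂ W))
    (hfin : ∀ i w, (fun m => D i m w : Ser (Unit ⊕ Unit) W) ∈ finDeg W (pairDeg Unit))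
    (hH : ∀ i w, taylor (fun m => D i m w : Ser (Unit ⊕ Unit) W) = fun m => H i m w) (w : W) :
    (fun n => prodSer D n w : Ser (Fin N ⊕ Fin N) W) ∈ finDeg W (pairDeg (Fin N)) ∧
      taylor (fun n => prodSer D n w : Ser (Fin N ⊕ Fin N) W) = fun n => prodSer H n w := by
  let e : (Fin N → Unit ⊕ Unit → ℤ) ≃ (Fin N ⊕ Fin N → ℤ) :=
    { toFun := fun a => Sum.elim (fun i => a i (.inl ())) fun i => a i (.inr ())
      invFun := fun n i => n ∘ pairVars i
      left_inv := fun a => by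
        funext i t
        rcases t with t | t <;> rfl
      right_inv := fun n => by
        funext t
        rcases t with t | t <;> rfl }
  have he : ∀ a i, e a ∘ pairVars i = a i := fun a i => congrFun (e.symm_apply_apply a) i
  refine ⟨fun d => ?_, funext fun o => ?_⟩
  · classical
    let G : Fin N → (Unit ⊕ Unit → ℤ) → Module.End ℂ W := fun i p =>
      if pairDeg Unit p = (fun _ => d i) then D i p else 0
    have hG : ∀ i w, (Function.support fun p => G i p w).Finite := by
      intro i w
      refine (hfin i w fun _ => d i).subset fun p hp => ?_
      by_cases hpd : pairDeg Unit p = fun _ => d i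
      · refine ⟨hpd, fun h0 => hp ?_⟩
        simp only [G, if_pos hpd]
        exact h0
      · exact (hp (by simp [G, hpd])).elim
    let S : Fin N → Module.End ℂ W := fun i =>
      { toFun := fun w => ∑ᶠ p, G i p w
        map_add' := fun w w' => by
          simp only [map_add]
          exact finsum_add_distrib (hG i w) (hG i w')
        map_smul' := fun c w => by
          simp only [map_smul, RingHom.id_apply, smul_finsum] }
    refine ((finsum_mkPiAlgebraFin G S hG (fun i w => rfl) w).1.image e).subset fun n hn =>
      ⟨e.symm n, ?_, e.apply_symm_apply n⟩
    have hGD : (fun i => G i (e.symm n i)) = fun i => D i (n ∘ pairVars i) := by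
      funext i
      have : pairDeg Unit (n ∘ pairVars i) = fun _ => d i := funext fun _ => congrFun hn.1 i
      exact if_pos this
    rw [Function.mem_support, hGD]
    exact hn.2
  · have hsup : ∀ i w, (Function.support fun p =>
        (taylorKer Unit (o ∘ pairVars i) p • D i p) w).Finite := by
      intro i w
      refine (taylor_finite (hfin i w) (o ∘ pairVars i)).subset fun p hp => ⟨fun h0 => hp ?_, fun h0 => hp ?_⟩
      · simp only [h0, zero_smul, LinearMap.zero_apply]
      · change (taylorKer Unit (o ∘ pairVars i) p • D i p) w = 0
        rw [LinearMap.smul_apply, h0, smul_zero]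
    have key := (finsum_mkPiAlgebraFin (fun i p => taylorKer Unit (o ∘ pairVars i) p • D i p)
      (fun i => H i (o ∘ pairVars i)) hsup (fun i w => ?_) w).2
    · rw [show prodSer H o w = _ from key.symm]
      change ∑ᶠ n, taylorKer (Fin N) o n • prodSer D n w = _
      rw [← finsum_comp_equiv e]
      refine finsum_congr fun a => ?_
      have hz : ∀ (z : ℤ) (x : Module.End ℂ W), z • x = (z : ℂ) • x := fun z x =>
        (Int.cast_smul_eq_zsmul ℂ z x).symm
      simp only [hz]
      rw [MultilinearMap.map_smul_univ, taylorKer_eq_prod, prodSer]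
      simp only [he]
      rw [LinearMap.smul_apply, ← Int.cast_prod, Int.cast_smul_eq_zsmul]
    · exact congrFun (hH i w) (o ∘ pairVars i)

end OrderedProduct

/-! ### Identification of the variables of each block -/

namespace Ser

variable {σ τ τ' ι W : Type*} [AddCommGroup W] [Module ℂ W]

theorem push_push [Fintype σ] [Fintype τ] (π : σ → τ) (π' : τ → τ') (n : σ → ℤ) :
    push π' (push π n) = push (π' ∘ π) n := by
  classical
  funext t
  rw [push_apply, push_apply]
  simp only [push_apply]
  rw [Finset.sum_sigma']
  refine Finset.sum_nbij' (fun x => x.2) (fun i => ⟨π i, i⟩) ?_ ?_ ?_ ?_ ?_ <;> simp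
  · rintro ⟨a, b⟩ h1 h
    simp only at h1 h
    rw [h, h1]
  · rintro ⟨a, b⟩ _ h
    simp only at h
    subst h
    rfl

theorem spec_spec [Fintype σ] [Fintype τ] (π : σ → τ) (π' : τ → τ') {f : Ser σ W}
    (hf : f ∈ finDeg W (push (π' ∘ π))) : spec π' (spec π f) = spec (π' ∘ π) f := by
  funext p
  refine (kerSum_kerSum _ _ f p ?_ fun a => ?_).trans (finsum_congr fun a => ?_)
  · refine ((hf p).image fun n => (push π n, n)).subset ?_
    rintro ⟨o, n⟩ ⟨h1, h2, h3⟩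
    simp only at h1 h2 h3
    have h2' := push_eq_of_specKer_ne_zero h2
    refine ⟨n, ⟨?_, h3⟩, Prod.ext h2' rfl⟩
    rw [← push_push, h2', push_eq_of_specKer_ne_zero h1]
  · refine (Set.finite_singleton (push π a)).subset fun o ho => ?_
    exact (push_eq_of_specKer_ne_zero ho.2).symm
  · congr 1
    rw [finsum_eq_single _ (push π a)]
    · rw [specKer_of_eq (π := π) rfl, mul_one]
      by_cases h : push (π' ∘ π) a = p
      · rw [specKer_of_eq h, specKer_of_eq ((push_push π π' a).trans h)]
      · rw [specKer_of_ne h, specKer_of_ne fun h' => h ((push_push π π' a).symm.trans h')]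
    · intro o ho
      rw [specKer_of_ne ho.symm, mul_zero]

variable [Fintype ι]

/-- Specialization of the second block, for each monomial in the variables of the first block, is
compatible with polynomials in all variables. -/
theorem isSpec_slice_smul (p : MvPolynomial (ι ⊕ ι) ℂ) {f : Ser (ι ⊕ ι) W} {g : Ser (ι ⊕ Unit) W}
    (H : ∀ k, IsSpec (oneBlock ι) (fun l => f (Sum.elim k l)) fun m => g (Sum.elim k m)) :
    ∀ k, IsSpec (oneBlock ι) (fun l => (p • f) (Sum.elim k l)) fun m =>
      (rename (Sum.map id (oneBlock ι)) p • g) (Sum.elim k m) := by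
  classical
  induction p using MvPolynomial.induction_on generalizing f g with
  | C c =>
    intro k
    rw [rename_C, C_smul, C_smul]
    exact (H k).csmul c
  | add p q hp hq =>
    intro k
    rw [map_add, add_smul, add_smul]
    exact (hp H k).add (hq H k)
  | mul_X p i hp =>
    rw [map_mul]
    simp only [mul_smul]
    refine hp fun k => ?_
    rw [rename_X]
    have hsub : ∀ (k l : ι → ℤ) (i : ι), (Sum.elim k l - Pi.single (.inl i) 1 : ι ⊕ ι → ℤ) =
        Sum.elim (k - Pi.single i 1) l := by
      intro k l i
      funext t
      rcases t with t | t <;> simp [Pi.single_apply]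
    have hsub' : ∀ (k : ι → ℤ) (m : Unit → ℤ) (i : ι),
        (Sum.elim k m - Pi.single (.inl i) 1 : ι ⊕ Unit → ℤ) = Sum.elim (k - Pi.single i 1) m := by
      intro k l i
      funext t
      rcases t with t | t <;> simp [Pi.single_apply]
    have hsub2 : ∀ (k l : ι → ℤ) (i : ι), (Sum.elim k l - Pi.single (.inr i) 1 : ι ⊕ ι → ℤ) =
        Sum.elim k (l - Pi.single i 1) := by
      intro k l i
      funext t
      rcases t with t | t <;> simp [Pi.single_apply]
    have hsub2' : ∀ (k : ι → ℤ) (m : Unit → ℤ),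
        (Sum.elim k m - Pi.single (.inr ()) 1 : ι ⊕ Unit → ℤ) = Sum.elim k (m - Pi.single () 1) := by
      intro k l
      funext t
      rcases t with t | t <;> simp
    rcases i with i | i
    · have e1 : (fun l => ((X (.inl i) : MvPolynomial (ι ⊕ ι) ℂ) • f) (Sum.elim k l)) =
          fun l => f (Sum.elim (k - Pi.single i 1) l) := by
        funext l
        rw [X_smul_apply, hsub]
      have e2 : (fun m => ((X (Sum.map id (oneBlock ι) (.inl i)) :
          MvPolynomial (ι ⊕ Unit) ℂ) • g) (Sum.elim k m)) =
          fun m => g (Sum.elim (k - Pi.single i 1) m) := by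
        funext m
        rw [Sum.map_inl, id, X_smul_apply, hsub']
      rw [e1, e2]
      exact H _
    · have e1 : (fun l => ((X (.inr i) : MvPolynomial (ι ⊕ ι) ℂ) • f) (Sum.elim k l)) =
          (X i : MvPolynomial ι ℂ) • (fun l => f (Sum.elim k l) : Ser ι W) := by
        funext l
        rw [X_smul_apply, X_smul_apply, hsub2]
      have e2 : (fun m => ((X (Sum.map id (oneBlock ι) (.inr i)) :
          MvPolynomial (ι ⊕ Unit) ℂ) • g) (Sum.elim k m)) =
          (X () : MvPolynomial Unit ℂ) • (fun m => g (Sum.elim k m) : Ser Unit W) := by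
        funext m
        rw [Sum.map_inr, X_smul_apply, X_smul_apply, hsub2']
      rw [e1, e2]
      have := (H k).smul (X i)
      rwa [rename_X] at this

/-- A partial specialization can be computed for each monomial in the remaining variables. -/
theorem spec_map_id_eq {f : Ser (ι ⊕ ι) W} {g : Ser (ι ⊕ Unit) W}
    (hf : f ∈ finDeg W (push (twoBlocks ι)))
    (H : ∀ k, IsSpec (oneBlock ι) (fun l => f (Sum.elim k l)) fun m => g (Sum.elim k m)) :
    spec (Sum.map id (oneBlock ι)) f = g := by
  classical
  have hpush : ∀ (n : ι ⊕ ι → ℤ) (o : ι ⊕ Unit → ℤ), push (Sum.map id (oneBlock ι)) n = o ↔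
      n ∘ Sum.inl = o ∘ Sum.inl ∧ push (oneBlock ι) (n ∘ Sum.inr) = o ∘ Sum.inr := by
    intro n o
    have h1 : ∀ i, push (Sum.map id (oneBlock ι)) n (.inl i) = n (.inl i) := by
      intro i
      rw [push_apply, Finset.sum_filter, Fintype.sum_sum_type]
      simp
    have h2 : push (Sum.map id (oneBlock ι)) n (.inr ()) = push (oneBlock ι) (n ∘ Sum.inr) () := by
      rw [push_apply, push_apply, Finset.sum_filter, Finset.sum_filter, Fintype.sum_sum_type]
      simp
    constructor
    · rintro rfl
      exact ⟨funext fun i => (h1 i).symm, funext fun _ => h2.symm⟩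
    · rintro ⟨ha, hb⟩
      funext t
      rcases t with t | t
      · rw [h1]
        exact congrFun ha t
      · rw [h2]
        exact congrFun hb ()
  funext o
  have hsl : (fun l => f (Sum.elim (o ∘ Sum.inl) l) : Ser ι W) ∈ finDeg W (push (oneBlock ι)) := by
    intro d
    refine Set.Finite.of_finite_image ((hf (Sum.elim (fun _ => ∑ i, o (.inl i)) d)).subset ?_)
      (f := fun l => (Sum.elim (o ∘ Sum.inl) l : ι ⊕ ι → ℤ)) fun l _ l' _ h => ?_
    · rintro _ ⟨l, ⟨hl, hne⟩, rfl⟩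
      refine ⟨(push_twoBlocks_eq_iff _ _).mpr ⟨?_, ?_⟩, hne⟩
      · simp
      · rw [← hl]
        simp [push_apply]
    · funext i
      exact congrFun h (.inr i)
  have hg := (H (o ∘ Sum.inl)).spec_eq hsl
  have hg' := congrFun hg (o ∘ Sum.inr)
  rw [Sum.elim_comp_inl_inr] at hg'
  rw [← hg', spec_apply, spec_apply, finsum_mem_def, finsum_mem_def,
    finsum_eq_finsum_comp (g := fun l : ι → ℤ => (Sum.elim (o ∘ Sum.inl) l : ι ⊕ ι → ℤ))
      (fun l l' h => funext fun i => congrFun h (.inr i))]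
  · refine finsum_congr fun l => ?_
    by_cases hl : push (oneBlock ι) l = o ∘ Sum.inr
    · rw [Set.indicator_of_mem (show l ∈ {n | push (oneBlock ι) n = o ∘ Sum.inr} from hl),
        Set.indicator_of_mem]
      exact (hpush _ _).mpr ⟨rfl, hl⟩
    · rw [Set.indicator_of_notMem (show l ∉ {n | push (oneBlock ι) n = o ∘ Sum.inr} from hl),
        Set.indicator_of_notMem]
      exact fun h => hl ((hpush _ _).mp h).2
  · intro n hn
    have hmem : n ∈ {n | push (Sum.map id (oneBlock ι)) n = o} := Set.mem_of_indicator_ne_zero hn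
    have h1 := ((hpush n o).mp hmem).1
    refine ⟨n ∘ Sum.inr, ?_⟩
    simp only
    rw [← h1, Sum.elim_comp_inl_inr]

theorem taylor_mem_finDeg_twoBlocks {f : Ser (ι ⊕ ι) W} (hf : f ∈ trunc (ι ⊕ ι) W) :
    taylor f ∈ finDeg W (push (twoBlocks ι)) := by
  classical
  intro p
  obtain ⟨B, hB⟩ := exists_bound_of_mem_trunc hf
  -- On the exponents in question, the Taylor expansion agrees with a truncated series.
  set g : Ser (ι ⊕ ι) W := fun n =>
    if ∀ i, n (.inl i) ≤ p (.inl ()) then taylor f n else 0 with hg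
  have hgt : g ∈ trunc (ι ⊕ ι) W := by
    rw [mem_trunc]
    rintro (i | i)
    · refine ⟨0, fun n hn => ?_⟩
      rw [hg]
      simp only [taylor_eq_zero_of_neg f hn, ite_self]
    · refine ⟨2 * B - p (.inl ()), fun n hn => ?_⟩
      rw [hg]
      simp only
      split_ifs with hle
      · refine finsum_eq_zero_of_forall_eq_zero fun a => ?_
        by_contra hne
        have h1 : f a ≠ 0 := fun h0 => hne (by rw [h0, smul_zero])
        have h2 : pairDeg ι a = pairDeg ι n := by
          by_contra h2
          exact hne (by rw [taylorKer, if_neg h2, zero_smul])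
        have h3 := congrFun h2 i
        rw [pairDeg_apply, pairDeg_apply] at h3
        have := hB a h1 (.inl i)
        have := hB a h1 (.inr i)
        have := hle i
        omega
      · rfl
  refine (trunc_le_finDeg_push (twoBlocks ι) hgt p).subset fun n hn => ⟨hn.1, ?_⟩
  have hnn : ∀ i, 0 ≤ n (.inl i) := fun i => by
    by_contra hlt
    exact hn.2 (taylor_eq_zero_of_neg f (not_le.mp hlt))
  have hsum := ((push_twoBlocks_eq_iff n p).mp hn.1).1
  have hle : ∀ i, n (.inl i) ≤ p (.inl ()) := fun i => by
    rw [← hsum]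
    exact Finset.single_le_sum (f := fun i => n (.inl i)) (fun j _ => hnn j) (Finset.mem_univ i)
  rw [hg]
  simp only [if_pos hle]
  exact hn.2

end Ser

/-! ### Associativity of the extension to the tensor power -/

/-- The products of a monomial with polynomials `x₁ - α x₂`, `α ∈ S`. -/
def linProducts (S : Subgroup ℂˣ) : Submonoid (MvPolynomial (Unit ⊕ Unit) ℂ) where
  carrier := {p | ∃ m ∈ monomials (Unit ⊕ Unit), ∃ L : List ℂˣ, (∀ a ∈ L, a ∈ S) ∧
    p = m * (L.map fun a : ℂˣ => linPoly (a : ℂ)).prod}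
  one_mem' := ⟨1, one_mem _, [], by simp, by simp⟩
  mul_mem' := by
    rintro _ _ ⟨m, hm, L, hL, rfl⟩ ⟨m', hm', L', hL', rfl⟩
    refine ⟨m * m', mul_mem hm hm', L ++ L', fun a ha => ?_, ?_⟩
    · exact (List.mem_append.mp ha).elim (hL a) (hL' a)
    · rw [List.map_append, List.prod_append]
      ring

theorem monomials_le_linProducts (S : Subgroup ℂˣ) : monomials (Unit ⊕ Unit) ≤ linProducts S :=
  fun p hp => ⟨p, hp, [], by simp, by simp⟩

theorem linPoly_mem_linProducts {S : Subgroup ℂˣ} {a : ℂˣ} (ha : a ∈ S) :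
    linPoly (a : ℂ) ∈ linProducts S :=
  ⟨1, one_mem _, [a], by simpa using ha, by simp⟩

theorem ne_zero_of_mem_linProducts {S : Subgroup ℂˣ} {p : MvPolynomial (Unit ⊕ Unit) ℂ}
    (hp : p ∈ linProducts S) : p ≠ 0 := by
  obtain ⟨m, hm, L, -, rfl⟩ := hp
  exact mul_ne_zero (ne_zero_of_mem_monomials hm) (prod_linPoly_ne_zero L)

namespace PositionFields

variable {V W : Type*} [AddCommGroup V] [Module ℂ V] [AddCommGroup W] [Module ℂ W]
  {A : VertexData V} {N : ℕ} {β : Fin N → ℂˣ} {y : Fin N → V →ₗ[ℂ] VertexOperator ℂ W}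
  (h : PositionFields A β y)
include h

/-- When the variables of two pure tensors are identified, the polynomials needed for locality of all
their `2N` fields become products of a monomial and factors `x₁ - α x₂` with `α ∈ S`. -/
theorem isLocalFamily_two {S : Subgroup ℂˣ} (hβ : ∀ i, β i ∈ S) (u v : Fin N → V) :
    IsLocalFamily (Sum.elim (fun i => y i (u i)) fun i => y i (v i))
      ((linProducts S).comap (rename (twoBlocks (Fin N)) :
        _ →ₐ[ℂ] MvPolynomial (Unit ⊕ Unit) ℂ)) := by
  have hmono : ∀ (i j : Fin N) (t : Unit ⊕ Unit), i ≠ j →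
      C (β i : ℂ) * X t - C (β j : ℂ) * X t ∈ linProducts S := by
    intro i j t hij
    have : (C (β i : ℂ) * X t - C (β j : ℂ) * X t : MvPolynomial (Unit ⊕ Unit) ℂ) =
        C ((β i : ℂ) - β j) * X t := by simp [sub_mul]
    rw [this]
    exact monomials_le_linProducts S (mul_mem
      (C_mem_monomials (sub_ne_zero.mpr fun e => hij (h.injective (Units.ext e))))
      (X_mem_monomials t))
  have hlin : ∀ (c a b : ℂˣ), a ∈ S → b ∈ S → C ((c * a : ℂˣ) : ℂ) * X (.inl ()) -
      C ((c * b : ℂˣ) : ℂ) * X (.inr ()) ∈ linProducts S := by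
    intro c a b ha hb
    have : (C ((c * a : ℂˣ) : ℂ) * X (.inl ()) - C ((c * b : ℂˣ) : ℂ) * X (.inr ()) :
        MvPolynomial (Unit ⊕ Unit) ℂ) = C ((c * a : ℂˣ) : ℂ) * linPoly ((a⁻¹ * b : ℂˣ) : ℂ) := by
      rw [linPoly, mul_sub, ← mul_assoc, ← C_mul, ← Units.val_mul, mul_assoc c a,
        mul_inv_cancel_left]
    rw [this]
    exact mul_mem (monomials_le_linProducts S (C_mem_monomials (Units.ne_zero _)))
      (linPoly_mem_linProducts (mul_mem (inv_mem ha) hb))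
  rintro (i | i) (j | j) hij
  · obtain ⟨k, hk⟩ := h.isLocal i j (u i) (u j)
    refine ⟨_, ?_, hk⟩
    rw [Submonoid.mem_comap, map_pow, map_pow, rename_posPoly]
    refine pow_mem ?_ k
    simpa [twoBlocks] using hmono i j (.inl ()) fun e => hij (by rw [e])
  · obtain ⟨k, hk⟩ := h.isLocal i j (u i) (v j)
    refine ⟨_, ?_, hk⟩
    rw [Submonoid.mem_comap, map_pow, map_pow, rename_posPoly]
    refine pow_mem ?_ k
    simpa [twoBlocks] using hlin 1 _ _ (hβ i) (hβ j)
  · obtain ⟨k, hk⟩ := h.isLocal i j (v i) (u j)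
    refine ⟨_, ?_, hk⟩
    rw [Submonoid.mem_comap, map_pow, map_pow, rename_posPoly]
    refine pow_mem ?_ k
    have := hlin (-1) _ _ (hβ j) (hβ i)
    simp only [Units.val_neg, neg_mul, one_mul, C_neg,
      sub_neg_eq_add] at this
    have e : (rename (twoBlocks (Fin N)) : _ →ₐ[ℂ] MvPolynomial (Unit ⊕ Unit) ℂ)
        (C (β i : ℂ) * X (.inr i) - C (β j : ℂ) * X (.inl j)) =
          -(C (β j : ℂ) * X (.inl ())) + C (β i : ℂ) * X (.inr ()) := by
      simp [twoBlocks]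
      ring
    rw [e]
    exact this
  · obtain ⟨k, hk⟩ := h.isLocal i j (v i) (v j)
    refine ⟨_, ?_, hk⟩
    rw [Submonoid.mem_comap, map_pow, map_pow, rename_posPoly]
    refine pow_mem ?_ k
    simpa [twoBlocks] using hmono i j (.inr ()) fun e => hij (by rw [e])

end PositionFields

theorem rename_twoBlocks_taylorPoly (ι : Type*) [Fintype ι] (Q : MvPolynomial (ι ⊕ ι) ℂ) :
    rename (twoBlocks ι) (taylorPoly ι Q) = taylorPoly Unit (rename (twoBlocks ι) Q) := by
  have h : (rename (twoBlocks ι)).comp (taylorPoly ι) =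
      (taylorPoly Unit).comp (rename (R := ℂ) (twoBlocks ι)) := by
    ext1 i
    rcases i with i | i <;> simp [twoBlocks]
  exact DFunLike.congr_fun h Q

namespace PositionFields

variable {V W : Type*} [AddCommGroup V] [Module ℂ V] [AddCommGroup W] [Module ℂ W]
  {A : VertexData V} {N : ℕ} {β : Fin N → ℂˣ} {y : Fin N → V →ₗ[ℂ] VertexOperator ℂ W}

/-- The product over all positions of the iterates of the vectors `uᵢ` and `vᵢ`. -/
def iterates (A : VertexData V) (y : Fin N → V →ₗ[ℂ] VertexOperator ℂ W) (u v : Fin N → V) (w : W) :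
    Ser (Fin N ⊕ Fin N) W := fun n =>
  corr (fun i => y i (HVertexOperator.coeff (A.Y (u i)) (n (.inl i)) (v i))) (List.finRange N) w
    (n ∘ .inr)

variable (h : PositionFields A β y)
include h

/-- The product of two vertex operators of the extension is a specialization of the product of the
vertex operators of all positions. -/
theorem isSpec_cor12 (u v : Fin N → V) (w : W) : IsSpec (twoBlocks (Fin N))
    (corr (Sum.elim (fun i => y i (u i)) fun i => y i (v i))
      ((List.finRange N).map .inl ++ (List.finRange N).map .inr) w)
    (cor12 (h.extend (⨂ₜ[ℂ] i, u i)) (h.extend (⨂ₜ[ℂ] i, v i)) w) := by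
  obtain ⟨Q, hQ, hf⟩ := h.exists_smul_mem_trunc u
  have := isSpec_nested (π := twoBlocks (Fin N)) (π₁ := oneBlock (Fin N)) (π₂ := oneBlock (Fin N))
    (ρ₁ := Sum.inl) (ρ₂ := Sum.inr) (θ₁ := Sum.inl) (θ₂ := Sum.inr)
    (by rw [Sum.elim_inl_inr]; exact Function.bijective_id)
    (by rw [Sum.elim_inl_inr]; exact Function.injective_id) rfl rfl
    (fun n o => by
      rw [push_twoBlocks_eq_iff]
      simp only [_root_.funext_iff, push_apply, Finset.filter_true, Unique.forall_iff,
        Function.comp_apply])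
    (A := corrOp (fun i => y i (u i)) (List.finRange N))
    (B := fun o => HVertexOperator.coeff (h.extend (⨂ₜ[ℂ] i, u i)) (o ())) hQ
    (fun w => trunc_le_finDeg_push _ (hf w)) (fun w => h.isSpec_extend u w) (h.isSpec_extend v w)
  have e : corr (Sum.elim (fun i => y i (u i)) fun i => y i (v i))
      ((List.finRange N).map .inl ++ (List.finRange N).map .inr) w =
      fun n => corrOp (fun i => y i (u i)) (List.finRange N) (n ∘ Sum.inl)
        (corr (fun i => y i (v i)) (List.finRange N) w (n ∘ Sum.inr)) := by
    funext n
    rw [corr, corrOp_append, corrOp_map, corrOp_map]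
    rfl
  rw [e]
  exact this

theorem isSpec_cor21 (u v : Fin N → V) (w : W) : IsSpec (twoBlocks (Fin N))
    (corr (Sum.elim (fun i => y i (u i)) fun i => y i (v i))
      ((List.finRange N).map .inr ++ (List.finRange N).map .inl) w)
    (cor21 (h.extend (⨂ₜ[ℂ] i, u i)) (h.extend (⨂ₜ[ℂ] i, v i)) w) := by
  obtain ⟨Q, hQ, hf⟩ := h.exists_smul_mem_trunc v
  have hsw : ∀ α β : Type, (Sum.elim Sum.inr Sum.inl : α ⊕ β → β ⊕ α) = Sum.swap := fun α β =>
    funext fun x => by rcases x with x | x <;> rfl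
  have := isSpec_nested (π := twoBlocks (Fin N)) (π₁ := oneBlock (Fin N)) (π₂ := oneBlock (Fin N))
    (ρ₁ := Sum.inr) (ρ₂ := Sum.inl) (θ₁ := Sum.inr) (θ₂ := Sum.inl)
    (by rw [hsw]; exact (Equiv.sumComm _ _).bijective)
    (by rw [hsw]; exact (Equiv.sumComm _ _).injective) rfl rfl
    (fun n o => by
      rw [push_twoBlocks_eq_iff, and_comm]
      simp only [_root_.funext_iff, push_apply, Finset.filter_true, Unique.forall_iff,
        Function.comp_apply])
    (A := corrOp (fun i => y i (v i)) (List.finRange N))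
    (B := fun o => HVertexOperator.coeff (h.extend (⨂ₜ[ℂ] i, v i)) (o ())) hQ
    (fun w => trunc_le_finDeg_push _ (hf w)) (fun w => h.isSpec_extend v w) (h.isSpec_extend u w)
  have e : corr (Sum.elim (fun i => y i (u i)) fun i => y i (v i))
      ((List.finRange N).map .inr ++ (List.finRange N).map .inl) w =
      fun n => corrOp (fun i => y i (v i)) (List.finRange N) (n ∘ Sum.inr)
        (corr (fun i => y i (u i)) (List.finRange N) w (n ∘ Sum.inl)) := by
    funext n
    rw [corr, corrOp_append, corrOp_map, corrOp_map]
    rfl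
  rw [e]
  exact this

/-- The order in which the two vertex operators of each position are neighbours. -/
abbrev pairedList (N : ℕ) : List (Fin N ⊕ Fin N) :=
  (List.finRange N).flatMap fun i => [.inl i, .inr i]

/-- In the order by pairs, the Taylor expansion of the product of all fields is the product of the
iterates, up to a product of powers of the differences of the two variables of each pair. These
become monomials under the Taylor expansion. -/
theorem exists_taylor_paired (u v : Fin N → V) : ∃ P : MvPolynomial (Fin N ⊕ Fin N) ℂ,
    taylorPoly (Fin N) P ∈ monomials (Fin N ⊕ Fin N) ∧
    ∀ w, P • corr (Sum.elim (fun i => y i (u i)) fun i => y i (v i)) (pairedList N) w ∈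
        finDeg W (pairDeg (Fin N)) ∧
      taylor (P • corr (Sum.elim (fun i => y i (u i)) fun i => y i (v i)) (pairedList N) w) =
        taylorPoly (Fin N) P • iterates A y u v w := by
  choose k hk using fun i => h.iterate i (u i) (v i)
  let D : Fin N → Ser (Unit ⊕ Unit) (Module.End ℂ W) := fun i m =>
    (HVertexOperator.coeff (y i (u i)) (m (.inl ())) : Module.End ℂ W) *
      HVertexOperator.coeff (y i (v i)) (m (.inr ()))
  let K : Fin N → Ser (Unit ⊕ Unit) (Module.End ℂ W) := fun i m =>
    HVertexOperator.coeff (y i (HVertexOperator.coeff (A.Y (u i)) (m (.inl ())) (v i)))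
      (m (.inr ()))
  have hap : ∀ {σ : Type} (p : MvPolynomial σ ℂ) (F : Ser σ (Module.End ℂ W)) (w : W),
      (fun n => (p • F) n w) = p • (fun n => F n w : Ser σ W) := fun p F w =>
    mapVal_smul (LinearMap.applyₗ w) p F
  have hD : ∀ w, corr (Sum.elim (fun i => y i (u i)) fun i => y i (v i)) (pairedList N) w =
      fun n => prodSer D n w := by
    intro w
    funext n
    rw [corr, prodSer, MultilinearMap.mkPiAlgebraFin_apply, List.ofFn_eq_map]
    have : ∀ l : List (Fin N), corrOp (Sum.elim (fun i => y i (u i)) fun i => y i (v i))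
        (l.flatMap fun i => [.inl i, .inr i]) n =
        (l.map fun i => D i (n ∘ pairVars i)).prod := by
      intro l
      induction l with
      | nil => rfl
      | cons i l ih =>
        rw [List.flatMap_cons, corrOp_append, ih, List.map_cons, List.prod_cons, corrOp_cons,
          corrOp_cons]
        simp only [corrOp, List.map_nil, List.prod_nil, mul_one]
        rfl
    rw [this]
  have hK : ∀ w, iterates A y u v w = fun n => prodSer K n w := by
    intro w
    funext n
    rw [iterates, corr, prodSer, MultilinearMap.mkPiAlgebraFin_apply, List.ofFn_eq_map]
    rfl
  have hP : taylorPoly (Fin N) (∏ i, rename (pairVars i) (linPoly 1 ^ k i)) =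
      ∏ i, rename (pairVars i) (X (.inl ()) ^ k i) := by
    rw [map_prod]
    refine Finset.prod_congr rfl fun i _ => ?_
    simp [linPoly_one, pairVars]
  -- Associativity in each pair of variables turns `(xᵢ - yᵢ) ^ kᵢ` into `tᵢ ^ kᵢ`.
  have key := taylor_prodSer (fun i => linPoly 1 ^ k i • D i)
    (fun i => (X (.inl ()) ^ k i : MvPolynomial (Unit ⊕ Unit) ℂ) • K i) (fun i w => ?_)
    fun i w => ?_
  · refine ⟨∏ i, rename (pairVars i) (linPoly 1 ^ k i), ?_, fun w => ?_⟩
    · rw [hP]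
      exact prod_mem fun i _ => rename_mem_monomials _ (pow_mem (X_mem_monomials _) _)
    · rw [hP, hD, hK, ← hap, ← hap, prod_smul_prodSer, prod_smul_prodSer]
      exact key w
  · rw [hap]
    obtain ⟨h1, -⟩ := hk i w
    exact trunc_le_finDeg_pairDeg
      (mem_trunc_of_smul_eq (cor12_mem_truncIn _ _ _) (cor21_mem_truncIn _ _ _) h1)
  · rw [hap, hap]
    have h2 := (hk i w).2
    rw [map_pow, taylorPoly_linPoly_one] at h2
    exact h2

/-- The Taylor expansion of `exists_taylor_paired` for any polynomial that makes it well defined. -/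
theorem taylor_smul_paired (u v : Fin N → V) {Q : MvPolynomial (Fin N ⊕ Fin N) ℂ} {w : W}
    (hQ : Q • corr (Sum.elim (fun i => y i (u i)) fun i => y i (v i)) (pairedList N) w ∈
      finDeg W (pairDeg (Fin N))) :
    taylor (Q • corr (Sum.elim (fun i => y i (u i)) fun i => y i (v i)) (pairedList N) w) =
      taylorPoly (Fin N) Q • iterates A y u v w := by
  obtain ⟨P, hP, hPw⟩ := h.exists_taylor_paired u v
  refine smul_left_cancel_of_mem_monomials hP ?_
  rw [← taylor_smul P hQ, smul_comm P Q, taylor_smul Q (hPw w).1, (hPw w).2, smul_comm]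

/-- The specialization of the product of the iterates is the iterate of the extension. -/
theorem spec_smul_iterates (u v : Fin N → V) (w : W) {Q : MvPolynomial (Fin N ⊕ Fin N) ℂ}
    (hQ : Q • iterates A y u v w ∈ finDeg W (push (twoBlocks (Fin N)))) :
    spec (twoBlocks (Fin N)) (Q • iterates A y u v w) = rename (twoBlocks (Fin N)) Q •
      iter (A.tensorPower (Fin N)) h.extend (⨂ₜ[ℂ] i, u i) (⨂ₜ[ℂ] i, v i) w := by
  classical
  let F : (Fin N → ℤ) → ⨂[ℂ] _ : Fin N, V := fun k =>
    ⨂ₜ[ℂ] i, HVertexOperator.coeff (A.Y (u i)) (k i) (v i)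
  let G : Ser (Fin N ⊕ Unit) W := fun m =>
    HVertexOperator.coeff (h.extend (F (m ∘ .inl))) (m (.inr ())) w
  let π' : Fin N ⊕ Unit → Unit ⊕ Unit := Sum.map (oneBlock (Fin N)) id
  have hcomp : π' ∘ Sum.map id (oneBlock (Fin N)) = twoBlocks (Fin N) := by
    funext t
    rcases t with t | t <;> rfl
  have hG : ∀ k, IsSpec (oneBlock (Fin N)) (fun l => iterates A y u v w (Sum.elim k l))
      fun m => G (Sum.elim k m) := fun k =>
    h.isSpec_extend (fun i => HVertexOperator.coeff (A.Y (u i)) (k i) (v i)) w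
  have hF : ∀ n : ℤ, ({k : Fin N → ℤ | ∑ i, k i = n} ∩ Function.support F).Finite :=
    finite_exponents fun i => A.Y (u i) (v i)
  have hpush : ∀ (m : Fin N ⊕ Unit → ℤ) (o : Unit ⊕ Unit → ℤ), push π' m = o ↔
      ∑ i, m (.inl i) = o (.inl ()) ∧ m (.inr ()) = o (.inr ()) := by
    intro m o
    have h1 : push π' m (.inl ()) = ∑ i, m (.inl i) := by
      rw [push_apply, Finset.sum_filter, Fintype.sum_sum_type]
      simp [π']
    have h2 : push π' m (.inr ()) = m (.inr ()) := by
      rw [push_apply, Finset.sum_filter, Fintype.sum_sum_type]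
      simp [π']
    rw [← h1, ← h2]
    constructor
    · rintro rfl
      exact ⟨rfl, rfl⟩
    · rintro ⟨ha, hb⟩
      funext t
      rcases t with t | t
      · exact ha
      · exact hb
  have hG0 : ∀ m, G m ≠ 0 → F (m ∘ .inl) ≠ 0 := by
    intro m hm h0
    refine hm ?_
    simp only [G, h0, map_zero]
    rfl
  have hGfin : G ∈ finDeg W (push π') := by
    intro o
    refine ((hF (o (.inl ()))).image fun k => (Sum.elim k (o ∘ .inr) : Fin N ⊕ Unit → ℤ)).subset ?_
    rintro m ⟨hm, hne⟩
    rw [hpush] at hm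
    refine ⟨m ∘ .inl, ⟨hm.1, hG0 m hne⟩, ?_⟩
    funext t
    rcases t with t | t
    · rfl
    · exact hm.2.symm
  have hiter : spec π' G =
      iter (A.tensorPower (Fin N)) h.extend (⨂ₜ[ℂ] i, u i) (⨂ₜ[ℂ] i, v i) w := by
    funext o
    let L : (⨂[ℂ] _ : Fin N, V) →ₗ[ℂ] W :=
      { toFun := fun x => HVertexOperator.coeff (h.extend x) (o (.inr ())) w
        map_add' := fun x y => by simp only [map_add, Pi.add_apply, LinearMap.add_apply]
        map_smul' := fun c x => by
          simp only [map_smul, Pi.smul_apply, LinearMap.smul_apply, RingHom.id_apply] }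
    have e1 : iter (A.tensorPower (Fin N)) h.extend (⨂ₜ[ℂ] i, u i) (⨂ₜ[ℂ] i, v i) w o =
        L (∑ᶠ k ∈ {k : Fin N → ℤ | ∑ i, k i = o (.inl ())}, F k) := by
      rw [← tensorY_tprod]
      rfl
    have e2 := L.toAddMonoidHom.map_finsum_mem' (hF (o (.inl ())))
    rw [e1]
    refine Eq.trans ?_ e2.symm
    rw [spec_apply, finsum_mem_def, finsum_mem_def, finsum_eq_finsum_comp
      (g := fun k : Fin N → ℤ => (Sum.elim k (o ∘ .inr) : Fin N ⊕ Unit → ℤ))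
      fun l l' h => funext fun i => congrFun h (.inl i)]
    · refine finsum_congr fun k => ?_
      by_cases hk : ∑ i, k i = o (.inl ())
      · rw [Set.indicator_of_mem (show k ∈ {k : Fin N → ℤ | ∑ i, k i = o (.inl ())} from hk),
          Set.indicator_of_mem]
        · rfl
        · exact (hpush _ _).mpr ⟨hk, rfl⟩
      · rw [Set.indicator_of_notMem (show k ∉ {k : Fin N → ℤ | ∑ i, k i = o (.inl ())} from hk),
          Set.indicator_of_notMem]
        exact fun h => hk ((hpush _ _).mp h).1
    · intro m hm
      have hmem : m ∈ {m | push π' m = o} := Set.mem_of_indicator_ne_zero hm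
      refine ⟨m ∘ .inl, ?_⟩
      funext t
      rcases t with t | t
      · rfl
      · exact ((hpush m o).mp hmem).2.symm
  rw [← hcomp, ← spec_spec _ _ (by rwa [hcomp]),
    spec_map_id_eq hQ (isSpec_slice_smul Q hG), spec_smul _ hGfin, hiter, rename_rename]

/-- Locality and associativity of the extension on pure tensors. -/
theorem exists_isIterateWith_tprod {S : Subgroup ℂˣ} (hβ : ∀ i, β i ∈ S) (u v : Fin N → V) :
    ∃ q ∈ linProducts S, IsIterateWith (A.tensorPower (Fin N)) h.extend
      (⨂ₜ[ℂ] i, u i) (⨂ₜ[ℂ] i, v i) q := by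
  have hloc := h.isLocalFamily_two hβ u v
  set c := Sum.elim (fun i => y i (u i)) fun i => y i (v i) with hc
  set l := (List.finRange N).map Sum.inl ++ (List.finRange N).map (Sum.inr : Fin N → Fin N ⊕ Fin N)
    with hl
  set l' := (List.finRange N).map Sum.inr ++ (List.finRange N).map (Sum.inl : Fin N → Fin N ⊕ Fin N)
    with hl'
  have hnd : l.Nodup := by
    rw [hl, List.nodup_append]
    refine ⟨(List.nodup_finRange N).map Sum.inl_injective,
      (List.nodup_finRange N).map Sum.inr_injective, ?_⟩
    simp
  have hmem : ∀ t, t ∈ l := by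
    rintro (t | t) <;> simp [hl]
  have hperm : l.Perm l' := List.perm_append_comm
  have hnd2 : (pairedList N).Nodup := by
    rw [pairedList, List.nodup_flatMap]
    refine ⟨fun i _ => by simp, (List.nodup_finRange N).imp fun hij => ?_⟩
    simp [Function.onFun, Ne.symm hij]
  have hperm2 : l.Perm (pairedList N) := (List.perm_ext_iff_of_nodup hnd hnd2).mpr fun t => by
    refine iff_of_true (hmem t) ?_
    rcases t with t | t <;> simp [pairedList]
  -- A common polynomial for the two orders of the blocks, for the order by pairs, and for the
  -- truncation.
  obtain ⟨Q₁, hQ₁, h₁⟩ := hloc.exists_corr_eq hperm hnd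
  obtain ⟨Q₂, hQ₂, h₂⟩ := hloc.exists_corr_eq hperm2 hnd
  obtain ⟨Q₃, hQ₃, h₃⟩ := hloc.exists_smul_mem_trunc hnd hmem
  have hmemQ := mul_mem (mul_mem hQ₁ hQ₂) hQ₃
  set Q := Q₁ * Q₂ * Q₃ with hQ
  have hl1 : ∀ w, Q • corr c l w = Q • corr c l' w := by
    intro w
    rw [hQ, mul_assoc, mul_comm, mul_smul, h₁, ← mul_smul]
  have hl2 : ∀ w, Q • corr c l w = Q • corr c (pairedList N) w := by
    intro w
    rw [hQ, mul_right_comm, mul_smul, h₂, ← mul_smul]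
  have htr : ∀ w, Q • corr c l w ∈ trunc _ W := by
    intro w
    rw [hQ, mul_smul]
    exact Submodule.smul_mem _ _ (h₃ w)
  refine ⟨rename (twoBlocks (Fin N)) Q, hmemQ, fun w => ?_⟩
  have hfin := trunc_le_finDeg_push (twoBlocks (Fin N)) (htr w)
  have e1 := (h.isSpec_cor12 u v w).spec_smul_eq hfin
  have e2 := (h.isSpec_cor21 u v w).spec_smul_eq (hl1 w ▸ hfin)
  refine ⟨by rw [← e1, ← e2, ← hl1], ?_⟩
  have e3 := h.taylor_smul_paired u v (hl2 w ▸ trunc_le_finDeg_pairDeg (htr w))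
  rw [← hc, ← hl2] at e3
  rw [← e1, ← spec_taylor (htr w), e3, h.spec_smul_iterates, rename_twoBlocks_taylorPoly]
  rw [← e3]
  exact taylor_mem_finDeg_twoBlocks (htr w)

end PositionFields

/-! ### Linearity of locality and associativity -/

section Bilinear

variable {V W : Type*} [AddCommGroup V] [Module ℂ V] [AddCommGroup W] [Module ℂ W]
  {A : VertexData V} {YW : V →ₗ[ℂ] VertexOperator ℂ W} {u u' v v' : V}
  {q : MvPolynomial (Unit ⊕ Unit) ℂ}

theorem IsIterateWith.smul_cor12_mem_trunc (h : IsIterateWith A YW u v q) (w : W) :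
    q • cor12 (YW u) (YW v) w ∈ trunc (Unit ⊕ Unit) W :=
  mem_trunc_of_smul_eq (cor12_mem_truncIn _ _ _) (cor21_mem_truncIn _ _ _) (h w).1

theorem IsIterateWith.add_left (h : IsIterateWith A YW u v q) (h' : IsIterateWith A YW u' v q) :
    IsIterateWith A YW (u + u') v q := by
  intro w
  have e1 : cor12 (YW (u + u')) (YW v) w = cor12 (YW u) (YW v) w + cor12 (YW u') (YW v) w :=
    ext_pr fun a b => by
      simp only [cor12_pr, Pi.add_apply, map_add, LinearMap.add_apply]
  have e2 : cor21 (YW (u + u')) (YW v) w = cor21 (YW u) (YW v) w + cor21 (YW u') (YW v) w :=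
    ext_pr fun a b => by
      simp only [cor21_pr, Pi.add_apply, map_add, LinearMap.add_apply]
  have e3 : iter A YW (u + u') v w = iter A YW u v w + iter A YW u' v w :=
    ext_pr fun a b => by
      simp only [iter_pr, Pi.add_apply, map_add, LinearMap.add_apply]
  rw [e1, e2, e3, smul_add, smul_add, smul_add, taylor_add
    (trunc_le_finDeg_pairDeg (h.smul_cor12_mem_trunc w))
    (trunc_le_finDeg_pairDeg (h'.smul_cor12_mem_trunc w)), (h w).2, (h' w).2, (h w).1, (h' w).1]
  exact ⟨rfl, rfl⟩

theorem IsIterateWith.add_right (h : IsIterateWith A YW u v q) (h' : IsIterateWith A YW u v' q) :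
    IsIterateWith A YW u (v + v') q := by
  intro w
  have e1 : cor12 (YW u) (YW (v + v')) w = cor12 (YW u) (YW v) w + cor12 (YW u) (YW v') w :=
    ext_pr fun a b => by
      simp only [cor12_pr, Pi.add_apply, map_add, LinearMap.add_apply]
  have e2 : cor21 (YW u) (YW (v + v')) w = cor21 (YW u) (YW v) w + cor21 (YW u) (YW v') w :=
    ext_pr fun a b => by
      simp only [cor21_pr, Pi.add_apply, map_add, LinearMap.add_apply]
  have e3 : iter A YW u (v + v') w = iter A YW u v w + iter A YW u v' w :=
    ext_pr fun a b => by
      simp only [iter_pr, Pi.add_apply, map_add, LinearMap.add_apply]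
  rw [e1, e2, e3, smul_add, smul_add, smul_add, taylor_add
    (trunc_le_finDeg_pairDeg (h.smul_cor12_mem_trunc w))
    (trunc_le_finDeg_pairDeg (h'.smul_cor12_mem_trunc w)), (h w).2, (h' w).2, (h w).1, (h' w).1]
  exact ⟨rfl, rfl⟩

theorem IsIterateWith.csmul_left (h : IsIterateWith A YW u v q) (c : ℂ) :
    IsIterateWith A YW (c • u) v q := by
  intro w
  have e1 : cor12 (YW (c • u)) (YW v) w = c • cor12 (YW u) (YW v) w :=
    ext_pr fun a b => by
      simp only [cor12_pr, Pi.smul_apply, map_smul, LinearMap.smul_apply]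
  have e2 : cor21 (YW (c • u)) (YW v) w = c • cor21 (YW u) (YW v) w :=
    ext_pr fun a b => by
      simp only [cor21_pr, Pi.smul_apply, map_smul, LinearMap.smul_apply]
  have e3 : iter A YW (c • u) v w = c • iter A YW u v w :=
    ext_pr fun a b => by
      simp only [iter_pr, Pi.smul_apply, map_smul, LinearMap.smul_apply]
  rw [e1, e2, e3, smul_comm q, smul_comm q, smul_comm (taylorPoly Unit q), taylor_csmul, (h w).2,
    (h w).1]
  exact ⟨rfl, rfl⟩

theorem IsIterateWith.csmul_right (h : IsIterateWith A YW u v q) (c : ℂ) :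
    IsIterateWith A YW u (c • v) q := by
  intro w
  have e1 : cor12 (YW u) (YW (c • v)) w = c • cor12 (YW u) (YW v) w :=
    ext_pr fun a b => by
      simp only [cor12_pr, Pi.smul_apply, map_smul, LinearMap.smul_apply]
  have e2 : cor21 (YW u) (YW (c • v)) w = c • cor21 (YW u) (YW v) w :=
    ext_pr fun a b => by
      simp only [cor21_pr, Pi.smul_apply, map_smul, LinearMap.smul_apply]
  have e3 : iter A YW u (c • v) w = c • iter A YW u v w :=
    ext_pr fun a b => by
      simp only [iter_pr, Pi.smul_apply, map_smul, LinearMap.smul_apply]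
  rw [e1, e2, e3, smul_comm q, smul_comm q, smul_comm (taylorPoly Unit q), taylor_csmul, (h w).2,
    (h w).1]
  exact ⟨rfl, rfl⟩

end Bilinear

namespace PositionFields

variable {V W : Type*} [AddCommGroup V] [Module ℂ V] [AddCommGroup W] [Module ℂ W]
  {A : VertexData V} {N : ℕ} {β : Fin N → ℂˣ} {y : Fin N → V →ₗ[ℂ] VertexOperator ℂ W}
  (h : PositionFields A β y)
include h

theorem exists_isIterateWith {S : Subgroup ℂˣ} (hβ : ∀ i, β i ∈ S) (x x' : ⨂[ℂ] _ : Fin N, V) :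
    ∃ q ∈ linProducts S, IsIterateWith (A.tensorPower (Fin N)) h.extend x x' q := by
  induction x using PiTensorProduct.induction_on with
  | smul_tprod r u =>
    induction x' using PiTensorProduct.induction_on with
    | smul_tprod s v =>
      obtain ⟨q, hq, H⟩ := h.exists_isIterateWith_tprod hβ u v
      exact ⟨q, hq, (H.csmul_left r).csmul_right s⟩
    | add x x' hx hx' =>
      obtain ⟨q, hq, H⟩ := hx
      obtain ⟨q', hq', H'⟩ := hx'
      refine ⟨q * q', mul_mem hq hq', IsIterateWith.add_right ?_ (H'.mul q)⟩
      rw [mul_comm]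
      exact H.mul q'
  | add x x' hx hx' =>
    obtain ⟨q, hq, H⟩ := hx
    obtain ⟨q', hq', H'⟩ := hx'
    refine ⟨q * q', mul_mem hq hq', IsIterateWith.add_left ?_ (H'.mul q)⟩
    rw [mul_comm]
    exact H.mul q'

/-- Locality without the monomial factor, which can be cancelled. -/
theorem exists_prod_linPoly_smul_eq {S : Subgroup ℂˣ} (hβ : ∀ i, β i ∈ S)
    (x x' : ⨂[ℂ] _ : Fin N, V) : ∃ L : List ℂˣ, (∀ a ∈ L, a ∈ S) ∧ ∀ w,
      (L.map fun a : ℂˣ => linPoly (a : ℂ)).prod • cor12 (h.extend x) (h.extend x') w =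
        (L.map fun a : ℂˣ => linPoly (a : ℂ)).prod • cor21 (h.extend x) (h.extend x') w := by
  obtain ⟨_, ⟨m, hm, L, hL, rfl⟩, H⟩ := h.exists_isIterateWith hβ x x'
  refine ⟨L, hL, fun w => smul_left_cancel_of_mem_monomials hm ?_⟩
  rw [← mul_smul, ← mul_smul]
  exact (H w).1

end PositionFields

/-! ### Equivariance of the extension -/

namespace Ser

variable {ι W : Type*} [Fintype ι] [AddCommGroup W] [Module ℂ W]

/-- Permuting the variables and multiplying all of them by `c` before they are identified amounts to
multiplying the remaining variable by `c`. -/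
theorem IsSpec.scale_comp {f : Ser ι W} {g : Ser Unit W} (h : IsSpec (oneBlock ι) f g)
    (c : ℂˣ) (e : Equiv.Perm ι) :
    IsSpec (oneBlock ι) (fun n => ((c ^ ∑ i, n i : ℂˣ) : ℂ) • f (n ∘ e))
      fun o => ((c ^ o () : ℂˣ) : ℂ) • g o := by
  classical
  obtain ⟨Q, hQ, hf, hg⟩ := h
  let Φ : Ser ι W → Ser ι W := fun f n => ((c ^ ∑ i, n i : ℂˣ) : ℂ) • f (n ∘ e)
  let Ψ : Ser Unit W → Ser Unit W := fun g o => ((c ^ o () : ℂˣ) : ℂ) • g o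
  let s : MvPolynomial ι ℂ →ₐ[ℂ] MvPolynomial ι ℂ := aeval fun i => C (c : ℂ) * X (e i)
  let t : MvPolynomial Unit ℂ →ₐ[ℂ] MvPolynomial Unit ℂ := aeval fun i => C (c : ℂ) * X i
  have hΦ : ∀ (p : MvPolynomial ι ℂ) (f : Ser ι W), Φ (p • f) = s p • Φ f := by
    intro p f
    refine map_smul_of_map_X s.toRingHom ⊤ Φ (fun f _ g _ => ?_) (fun a f _ => ?_)
      (fun i f _ => ?_) p trivial
    · funext n
      exact smul_add _ _ _
    · funext n
      simp only [Φ, C_smul, AlgHom.toRingHom_eq_coe, RingHom.coe_coe, algHom_C, algebraMap_eq,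
        Pi.smul_apply]
      exact smul_comm _ _ _
    · funext n
      have e1 : (n ∘ e - Pi.single i 1 : ι → ℤ) = (n - Pi.single (e i) 1) ∘ e := by
        funext j
        simp [Pi.single_apply]
      have e2 : ∑ j, (n - Pi.single (e i) 1 : ι → ℤ) j = ∑ j, n j - 1 := by
        simp
      simp only [s, AlgHom.toRingHom_eq_coe, RingHom.coe_coe, aeval_X, mul_smul, C_smul,
        Pi.smul_apply, X_smul_apply, Φ, e1, e2]
      rw [smul_smul, ← Units.val_mul, ← zpow_one_add, add_sub_cancel]
  have hΨ : ∀ (p : MvPolynomial Unit ℂ) (g : Ser Unit W), Ψ (p • g) = t p • Ψ g := by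
    intro p f
    refine map_smul_of_map_X t.toRingHom ⊤ Ψ (fun f _ g _ => ?_) (fun a f _ => ?_)
      (fun i f _ => ?_) p trivial
    · funext n
      exact smul_add _ _ _
    · funext n
      simp only [Ψ, C_smul, AlgHom.toRingHom_eq_coe, RingHom.coe_coe, algHom_C, algebraMap_eq,
        Pi.smul_apply]
      exact smul_comm _ _ _
    · funext n
      simp only [t, AlgHom.toRingHom_eq_coe, RingHom.coe_coe, aeval_X, mul_smul, C_smul,
        Pi.smul_apply, X_smul_apply, Ψ, Pi.sub_apply, Pi.single_eq_same]
      rw [smul_smul, ← Units.val_mul, ← zpow_one_add, add_sub_cancel]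
  have hst : rename (oneBlock ι) (s Q) = t (rename (oneBlock ι) Q) := by
    have : (rename (oneBlock ι)).comp s = t.comp (rename (R := ℂ) (oneBlock ι)) := by
      ext1 i
      simp [s, t]
    exact DFunLike.congr_fun this Q
  have ht : t (rename (oneBlock ι) Q) ∈ monomials Unit := by
    obtain ⟨d, a, ha, hd⟩ := hQ
    rw [hd, aeval_monomial]
    exact mul_mem (C_mem_monomials ha) (prod_mem fun i _ =>
      pow_mem (mul_mem (C_mem_monomials (Units.ne_zero c)) (X_mem_monomials i)) _)
  have hsum : ∀ n : ι → ℤ, push (oneBlock ι) n () = ∑ i, n i := by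
    intro n
    simp [push_apply]
  have hpush : ∀ n : ι → ℤ, push (oneBlock ι) (n ∘ e) = push (oneBlock ι) n := by
    intro n
    funext x
    rw [hsum, hsum]
    exact Equiv.sum_comp e n
  let E : (ι → ℤ) ≃ (ι → ℤ) := e.symm.arrowCongr (Equiv.refl ℤ)
  have hE : ∀ n, E n = n ∘ e := fun n => rfl
  refine ⟨s Q, hst ▸ ht, ?_, ?_⟩
  · change s Q • Φ f ∈ _
    rw [← hΦ]
    intro o
    refine ((hf o).image E.symm).subset fun n hn => ⟨E n, ⟨?_, fun h0 => hn.2 ?_⟩, E.symm_apply_apply n⟩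
    · rw [hE, hpush]
      exact hn.1
    · change _ • (Q • f) (n ∘ e) = 0
      rw [← hE, h0, smul_zero]
  · change spec _ (s Q • Φ f) = _ • Ψ g
    rw [← hΦ, hst, ← hΨ, ← hg]
    funext o
    simp only [Ψ]
    rw [spec_apply, spec_apply, finsum_mem_def, finsum_mem_def, smul_finsum,
      ← finsum_comp_equiv E.symm]
    refine finsum_congr fun n => ?_
    have hn' : E.symm n ∘ e = n := E.apply_symm_apply n
    have hpn : push (oneBlock ι) (E.symm n) = push (oneBlock ι) n := by rw [← hpush, hn']
    by_cases hn : push (oneBlock ι) n = o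
    · rw [Set.indicator_of_mem (show n ∈ {n | push (oneBlock ι) n = o} from hn),
        Set.indicator_of_mem (show E.symm n ∈ {n | push (oneBlock ι) n = o} from hpn.trans hn)]
      simp only [Φ]
      rw [hn', ← hsum, hpn, hn]
    · rw [Set.indicator_of_notMem (show n ∉ {n | push (oneBlock ι) n = o} from hn),
        Set.indicator_of_notMem (show E.symm n ∉ {n | push (oneBlock ι) n = o} from
          fun h => hn (hpn.symm.trans h)), smul_zero]

end Ser

namespace PositionFields

variable {V W : Type*} [AddCommGroup V] [Module ℂ V] [AddCommGroup W] [Module ℂ W]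
  {A : VertexData V} {N : ℕ} {β : Fin N → ℂˣ} {y : Fin N → V →ₗ[ℂ] VertexOperator ℂ W}
  (h : PositionFields A β y)
include h

/-- The vertex operators of all positions may be multiplied in any order. -/
theorem isSpec_extend_perm (v : Fin N → V) (w : W) {l : List (Fin N)}
    (hl : (List.finRange N).Perm l) : IsSpec (oneBlock (Fin N)) (corr (fun i => y i (v i)) l w)
      fun o => HVertexOperator.coeff (h.extend (⨂ₜ[ℂ] i, v i)) (o ()) w := by
  obtain ⟨Q, hQ, he⟩ := (h.isLocalFamily v).exists_corr_eq hl (List.nodup_finRange N)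
  exact (h.isSpec_extend v w).of_smul_eq hQ (he w)

/-- If the permutation `e` of the positions carries the fields of `v` to those of `v'` up to scaling the
variable by `c`, then the extension of `v'` is that of `v` with the variable scaled by `c`. -/
theorem coeff_extend_of_perm {c : ℂˣ} {e : Equiv.Perm (Fin N)} {v v' : Fin N → V}
    (hv : ∀ i n, HVertexOperator.coeff (y (e i) (v' (e i))) n =
      ((c ^ n : ℂˣ) : ℂ) • HVertexOperator.coeff (y i (v i)) n) (n : ℤ) :
    HVertexOperator.coeff (h.extend (⨂ₜ[ℂ] i, v' i)) n =
      ((c ^ n : ℂˣ) : ℂ) • HVertexOperator.coeff (h.extend (⨂ₜ[ℂ] i, v i)) n := by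
  refine LinearMap.ext fun w => ?_
  have hp : (List.finRange N).Perm ((List.finRange N).map e) :=
    (List.perm_ext_iff_of_nodup (List.nodup_finRange N)
      ((List.nodup_finRange N).map e.injective)).mpr fun i =>
        iff_of_true (List.mem_finRange i) (List.mem_map.mpr ⟨e.symm i, List.mem_finRange _, by simp⟩)
  have h1 := h.isSpec_extend_perm v' w hp
  have h2 := (h.isSpec_extend v w).scale_comp c e
  have e1 : corr (fun i => y i (v' i)) ((List.finRange N).map e) w = fun n =>
      ((c ^ ∑ i, n i : ℂˣ) : ℂ) • corr (fun i => y i (v i)) (List.finRange N) w (n ∘ e) := by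
    funext n
    have : ∀ l : List (Fin N), corrOp (fun i => y i (v' i)) (l.map e) n =
        ((c ^ (l.map fun i => n (e i)).sum : ℂˣ) : ℂ) • corrOp (fun i => y i (v i)) l (n ∘ e) := by
      intro l
      induction l with
      | nil => simp [corrOp]
      | cons i l ih =>
        rw [List.map_cons, corrOp_cons, corrOp_cons, ih, hv, List.map_cons, List.sum_cons, zpow_add,
          Units.val_mul, mul_smul_comm, smul_mul_assoc, smul_smul, mul_comm]
        rfl
    rw [corr, this, ← Fin.sum_univ_def, Equiv.sum_comp e n]
    rfl
  rw [e1] at h1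
  exact congrFun (h1.unique h2) fun _ => n

end PositionFields

/-! ### The extension of a module -/

namespace GradedVertexAlgebra

variable {V W : Type*} [AddCommGroup V] [Module ℂ V] [AddCommGroup W] [Module ℂ W]
  (A : GradedVertexAlgebra V) (N : ℕ) [NeZero N] {YW : V →ₗ[ℂ] VertexOperator ℂ W}

/-- The fields `Y_W(β ^ L(0) u, β x)`, for the distinct values `β` attached to the positions, satisfy the
hypotheses for the extension to the tensor power. -/
theorem positionFields_twistY (hY : A.toVertexData.IsModule YW) :
    PositionFields A.toVertexData (posChar N) fun i => A.twistY YW (posChar N i) where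
  injective := posChar_injective N
  vacuum i n := by
    rw [coeff_twistY, powL0_vac, hY.vacuum]
    split_ifs with hn
    · rw [hn, zpow_zero, Units.val_one, one_smul]
    · rw [smul_zero]
  isLocal i j u v := by
    obtain ⟨k, hk⟩ := exists_isIterateWith_of_jacobi (A.powL0 (posChar N i) u)
      (A.powL0 (posChar N j) v) (hY.jacobi _ _)
    exact ⟨k, A.local_twistY YW _ _ hk⟩
  iterate i u v := by
    obtain ⟨k, hk⟩ := exists_isIterateWith_of_jacobi (A.powL0 (posChar N i) u)
      (A.powL0 (posChar N i) v) (hY.jacobi _ _)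
    exact ⟨k, A.isIterateWith_twistY YW _ hk⟩

theorem isGammaQuasimodule_extend (hY : A.toVertexData.IsModule YW) :
    (A.tensorPowerGamma N).IsGammaQuasimodule (A.positionFields_twistY N hY).extend where
  isQuasimodule :=
    { vacuum := by
        have := (A.positionFields_twistY N hY).extend_update_vac 0 A.vac
        rw [Function.update_eq_self_iff.mpr rfl] at this
        change IsIdentitySeries ((A.positionFields_twistY N hY).extend (⨂ₜ[ℂ] _, A.vac))
        rw [this]
        exact (A.positionFields_twistY N hY).vacuum 0
      quasiJacobi := fun x x' => by
        obtain ⟨q, hq, H⟩ := (A.positionFields_twistY N hY).exists_isIterateWith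
          (posChar_mem_range N) x x'
        exact H.quasiJacobi (ne_zero_of_mem_linProducts hq) }
  equivariant g x n := by
    change HVertexOperator.coeff ((A.positionFields_twistY N hY).extend
      ((A.tensorR N g : (⨂[ℂ] _ : Fin N, V) →ₗ[ℂ] _) x)) n = ((cycleChar N g ^ n : ℂˣ) : ℂ) • _
    induction x using PiTensorProduct.induction_on with
    | smul_tprod r v =>
      rw [map_smul, map_smul, map_smul, map_smul, map_smul, Pi.smul_apply, Pi.smul_apply, tensorR_tprod,
        (A.positionFields_twistY N hY).coeff_extend_of_perm (c := cycleChar N g)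
          (e := (g : Equiv.Perm (Fin N))) (v := v), smul_comm]
      intro i n
      rw [posChar_apply, twistY_powL0, Equiv.symm_apply_apply]
    | add x x' hx hx' =>
      simp only [map_add, Pi.add_apply, smul_add, hx, hx']
  gammaLocal x x' := by
    obtain ⟨L, hL, H⟩ := (A.positionFields_twistY N hY).exists_prod_linPoly_smul_eq
      (posChar_mem_range N) x x'
    exact ⟨L, hL, fun w => (polyMul2_prod_eq_zero_iff L _ _ w).mpr (H w)⟩

theorem extend_comp_firstFactor (hY : A.toVertexData.IsModule YW) :
    (A.positionFields_twistY N hY).extend ∘ₗ A.firstFactor N = YW := by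
  refine LinearMap.ext fun u => ?_
  rw [LinearMap.comp_apply, firstFactor_apply, atPos_apply,
    (A.positionFields_twistY N hY).extend_update_vac 0 u, posChar_zero, twistY_one]

end GradedVertexAlgebra

end

theorem theorem3p2 {V : Type*} [AddCommGroup V] [Module ℂ V] (A : GradedVertexAlgebra V)
    (N : ℕ) [NeZero N] {W : Type*} [AddCommGroup W] [Module ℂ W] :
    (∀ Ybar : (⨂[ℂ] _ : Fin N, V) →ₗ[ℂ] VertexOperator ℂ W,
      (A.tensorPowerGamma N).IsGammaQuasimodule Ybar →
        A.toVertexData.IsModule (Ybar ∘ₗ A.firstFactor N)) ∧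
    (∀ YW : V →ₗ[ℂ] VertexOperator ℂ W, A.toVertexData.IsModule YW →
      ∃! Ybar : (⨂[ℂ] _ : Fin N, V) →ₗ[ℂ] VertexOperator ℂ W,
        (A.tensorPowerGamma N).IsGammaQuasimodule Ybar ∧ Ybar ∘ₗ A.firstFactor N = YW) := by
  refine ⟨fun Ybar h => A.isModule_comp_firstFactor h, fun YW h => ?_⟩
  have hY := A.isGammaQuasimodule_extend N h
  have hr := A.extend_comp_firstFactor N h
  exact ⟨_, ⟨hY, hr⟩, fun Y' h' => A.eq_of_comp_firstFactor_eq h'.1 hY (h'.2.trans hr.symm)⟩
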